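/- Let $r>0$, $m\ge 1$, and let $\mu$ be the law of a stationary ergodic $m$-coloured $r$-uniformly discrete point process on $\mathbb R^d$: a probability measure on the space $X$ of point measures $\lambda$ on $\mathbb R^d\times\{1,\dots,m\}$ having at most one atom (all colours together, counted with multiplicity) over each translate of the open cube $C_r$ of edge length $r$, with the $\sigma$-algebra generated by $\lambda\mapsto\lambda(A)$ (the Borel $\sigma$-algebra of the vague topology), such that $\mu$ is invariant and ergodic under the translations $(T_t\lambda)(A)=\lambda(-t+A)$. Assume that every colour has positive intensity. Let $\lambda^i$ be the part of $\lambda$ of colour $i$, let $w\in\mathbb R^m$, $\lambda^w=\sum_i w_i\lambda^i$ and $N^w_f(\lambda)=\lambda^w(f)$. Let $\chi_k(x)=e^{2\pi i k\cdot x}$, let $\hat f(k)=\int e^{-2\pi i k\cdot x}f(x)\,dx$, and define the Fourier transform of a measure by $\hat\gamma(\varphi)=\gamma(\hat\varphi)$ for rapidly decreasing $\varphi$. Inner products are linear in the first variable, and $(T_tF)(\lambda)=F(T_{-t}\lambda)$ on $L^2(X,\mu)$. (1) (Dworkin's theorem.) Let $f\in C_c(\mathbb R^d)$. Then $N^w_f\in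 L^2(X,\mu)$ has a unique spectral measure, that is, a unique finite positive measure $\sigma$ on $\mathbb R^d$ with $(N^w_f,T_tN^w_f)=\int e^{2\pi i x\cdot t}\,d\sigma(x)$ for all $t$. For $\mu$-almost every $\lambda$ the autocorrelation $\gamma^w_{f*\lambda}$ exists, where, with $g=f*\lambda^w$, it is the vague limit as $R\to\infty$ of $\frac1{\ell(C_R)}\,g|_{C_R}*\widetilde{g|_{C_R}}$ (here $\ell$ is Lebesgue measure, $C_R$ the open cube of edge length $R$ about $0$, and $\tilde h(x)=\overline{h(-x)}$), and its Fourier transform, the diffraction $\widehat{\gamma^w_{f*\lambda}}$, exists and is equal to $\sigma$. Let $\dot\mu^i(D)=\frac1{\ell(C_1)}\int\sum_{x\in C_1}\lambda^i(\{x\})\mathbf 1_D(T_{-x}\lambda)\,d\mu(\lambda)$ be the Palm measure of colour $i$, and let $\dot\mu^w_1(f)=\sum_i w_i\int N^w_f\,d\dot\mu^i$. Its Fourier transform is a unique positive Radon measure $\omega=\widehat{\dot\mu^w_1}$, and there is a unique linear isometric embedding $\theta^w:L^2(\mathbb R^d,\omega)\to L^2(X,\mu)$ with $\theta^w(\hat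 f)=N^w_f$ for all rapidly decreasing $f$; it intertwines $T$ with the representation $(U_tf)(x)=e^{-2\pi i t\cdot x}f(x)$ on $L^2(\mathbb R^d,\omega)$. Moreover: (2) For all $f,g\in L^2(\mathbb R^d,\omega)$, the spectral measures $\langle U_tf,g\rangle^\vee$ and $(T_t\theta^w(f),\theta^w(g))^\vee$ exist and are equal (hence of the same spectral type): there is one complex measure $\rho$ on $\mathbb R^d$ which is the unique complex measure with $\langle U_tf,g\rangle=\int e^{-2\pi i x\cdot t}\,d\rho(x)$ for all $t$, and also the unique one with $(T_t\theta^w(f),\theta^w(g))=\int e^{-2\pi i x\cdot t}\,d\rho(x)$ for all $t$. (3) For $k\in\mathbb R^d$, $\chi_k$ is in the point spectrum of $U$ (there is $f\ne0$ with $U_tf=\chi_k(t)f$ for all $t$) if and only if $\omega(\{k\})\ne0$, and this holds if and only if $\theta^w(\mathbf 1_{\{-k\}})$ is an eigenfunction of $T$ for $\chi_k$ (in particular is nonzero). In this case the eigenfunctions of $U$ for $\chi_k$ are exactly the nonzero multiples of $\mathbf 1_{\{-k\}}$, those of $T$ are exactly the nonzero multiples of $\theta^w(\mathbf 1_{\{-k\}})$,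 and $\|\theta^w(\mathbf 1_{\{-k\}})\|=\omega(\{k\})^{1/2}$. -/

import Mathlib

open MeasureTheory Filter Topology SchwartzMap FourierTransform CompactlySupported ComplexConjugate

noncomputable section

/-! ### Coloured uniformly discrete point measures and their translations -/

/-- The ambient space `ℝ^d` with its Euclidean structure. -/
abbrev Space (d : ℕ) : Type := EuclideanSpace ℝ (Fin d)

/-- The open cube `C_R` of edge length `R` about `0`. -/
def cube (d : ℕ) (R : ℝ) : Set (Space d) := {x | ∀ i, |x i| < R / 2}

/-- Translation of the coloured space `ℝ^d × {1, …, m}` by `t`; colours are kept. -/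
def shift {d m : ℕ} (t : Space d) : Space d × Fin m ≃ₜ Space d × Fin m :=
  (Homeomorph.addLeft t).prodCongr (Homeomorph.refl _)

/-- `lam` is a point measure on `ℝ^d × {1, …, m}` (its value on every relatively compact Borel set
is a natural number) which has at most one atom, counted over all colours, over every translate
of the open cube of edge length `r`. -/
structure IsUniformlyDiscrete {d m : ℕ} (r : ℝ) (lam : Measure (Space d × Fin m)) : Prop where
  natural : ∀ A : Set (Space d × Fin m), MeasurableSet A → IsCompact (closure A) →
    ∃ n : ℕ, lam A = n
  le_one : ∀ a : Space d, lam {p | p.1 - a ∈ cube d r} ≤ 1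

/-- The space of `m`-coloured `r`-uniformly discrete point measures. It carries the trace of the
σ-algebra that is generated by the evaluations `lam ↦ lam A`, which is the Borel σ-algebra of the
vague topology. -/
def Config (d m : ℕ) (r : ℝ) : Type :=
  {lam : Measure (Space d × Fin m) // IsUniformlyDiscrete r lam}

instance (d m : ℕ) (r : ℝ) : MeasurableSpace (Config d m r) :=
  inferInstanceAs (MeasurableSpace {lam : Measure (Space d × Fin m) // IsUniformlyDiscrete r lam})

theorem IsUniformlyDiscrete.map_shift {d m : ℕ} {r : ℝ} {lam : Measure (Space d × Fin m)}
    (h : IsUniformlyDiscrete r lam) (t : Space d) :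
    IsUniformlyDiscrete r (lam.map (shift t)) := by
  constructor
  · intro A hA hc
    rw [Measure.map_apply (shift t).measurable hA]
    refine h.natural _ ((shift t).measurable hA) ?_
    rw [← (shift t).preimage_closure]
    exact (shift t).isCompact_preimage.2 hc
  · intro a
    have hcube : MeasurableSet {p : Space d × Fin m | p.1 - a ∈ cube d r} := by
      have : {p : Space d × Fin m | p.1 - a ∈ cube d r} =
          ⋂ i, {p : Space d × Fin m | |(p.1 - a) i| < r / 2} := by
        ext p; simp [cube]
      rw [this]
      refine MeasurableSet.iInter fun i => (isOpen_lt ?_ continuous_const).measurableSet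
      fun_prop
    rw [Measure.map_apply (shift t).measurable hcube]
    have : (shift t) ⁻¹' {p : Space d × Fin m | p.1 - a ∈ cube d r} =
        {p : Space d × Fin m | p.1 - (a - t) ∈ cube d r} := by
      ext p
      have e : t + p.1 - a = p.1 - (a - t) := by abel
      simp [shift, e]
    rw [this]
    exact h.le_one (a - t)

/-- The translation action `(T_t lam)(A) = lam (-t + A)` of `ℝ^d`. -/
instance (d m : ℕ) (r : ℝ) : AddAction (Space d) (Config d m r) where
  vadd t lam := ⟨lam.1.map (shift t), lam.2.map_shift t⟩
  zero_vadd lam := by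
    refine Subtype.ext ?_
    change lam.1.map (shift 0) = lam.1
    have : ⇑(shift (m := m) (0 : Space d)) = id := by
      ext p <;> simp [shift]
    rw [this, Measure.map_id]
  add_vadd s t lam := by
    refine Subtype.ext ?_
    change lam.1.map (shift (s + t)) = (lam.1.map (shift t)).map (shift s)
    rw [Measure.map_map (shift s).measurable (shift t).measurable]
    congr 1
    ext p <;> simp [shift, add_assoc]

instance (d m : ℕ) (r : ℝ) : MeasurableConstVAdd (Space d) (Config d m r) where
  measurable_const_vadd t :=
    ((Measure.measurable_map _ (shift t).measurable).comp measurable_subtype_coe).subtype_mk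

/-- The restriction `lam^i` of `lam` to the colour `i`, as a measure on `ℝ^d`. -/
def colour {d m : ℕ} {r : ℝ} (i : Fin m) (lam : Config d m r) : Measure (Space d) :=
  lam.1.comap fun x => (x, i)

/-- The intensity `I^{(i)}` of the colour `i`: the expected number of points of colour `i` in the
unit cube. -/
def intensity {d m : ℕ} {r : ℝ} (μ : Measure (Config d m r)) (i : Fin m) : ENNReal :=
  ∫⁻ lam, colour i lam (cube d 1) ∂μ

/-- The weighted counting function `N^w_f(lam) = lam^w(f)` with `lam^w = ∑ i, w i • lam^i`. -/
def countingFn {d m : ℕ} {r : ℝ} (w : Fin m → ℝ) (f : Space d → ℂ) (lam : Config d m r) : ℂ :=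
  ∑ i, (w i : ℂ) * ∫ x, f x ∂colour i lam

/-- The function `f * lam^w` on `ℝ^d`. -/
def weightedConv {d m : ℕ} {r : ℝ} (w : Fin m → ℝ) (f : Space d → ℂ) (lam : Config d m r)
    (x : Space d) : ℂ :=
  ∑ i, (w i : ℂ) * ∫ y, f (x - y) ∂colour i lam

/-- The Palm measure of the colour `i`:
`D ↦ (1 / ℓ(C)) ∫ ∑_{x ∈ C} lam^i({x}) 1_D(T_{-x} lam) dμ(lam)` with `C` the unit cube. -/
def palm {d m : ℕ} {r : ℝ} (μ : Measure (Config d m r)) (i : Fin m) : Measure (Config d m r) :=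
  μ.bind fun lam => ((colour i lam).restrict (cube d 1)).map fun x : Space d => (-x) +ᵥ lam

/-- The weighted first moment `f ↦ ∫ N^w_f` of the weighted Palm measure `∑ i, w i • palm μ i`. -/
def palmMoment {d m : ℕ} {r : ℝ} (μ : Measure (Config d m r)) (w : Fin m → ℝ)
    (f : Space d → ℂ) : ℂ :=
  ∑ i, (w i : ℂ) * ∫ lam, countingFn w f lam ∂palm μ i

/-! ### Autocorrelation, Fourier transform and diffraction -/

/-- A complex Radon measure on `ℝ^d` in polar form: total variation and phase. -/
structure ComplexRadon (d : ℕ) where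
  /-- The total variation. -/
  variation : Measure (Space d)
  locallyFinite : IsLocallyFiniteMeasure variation
  /-- The phase. -/
  phase : Space d → ℂ
  measurable_phase : Measurable phase
  norm_phase : ∀ x, ‖phase x‖ = 1

/-- The integral of a function against a complex Radon measure. -/
def ComplexRadon.integral {d : ℕ} (γ : ComplexRadon d) (φ : Space d → ℂ) : ℂ :=
  ∫ x, γ.phase x * φ x ∂γ.variation

/-- `γ` is the autocorrelation of the locally integrable function `g`, that is of the measure with
density `g`: the vague limit of `(1 / ℓ(C_R)) g|_{C_R} * (g|_{C_R})~` as `R → ∞`, where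
`h~(x) = conj (h (-x))`. -/
def IsAutocorrelation {d : ℕ} (g : Space d → ℂ) (γ : ComplexRadon d) : Prop :=
  LocallyIntegrable g volume ∧
  ∀ φ : C_c(Space d, ℂ),
    Tendsto (fun R : ℝ => ((volume (cube d R)).toReal : ℂ)⁻¹ *
        ∫ x in cube d R, ∫ y in cube d R, g x * conj (g y) * φ (x - y))
      atTop (𝓝 (γ.integral φ))

/-- The positive measure `ω` is the Fourier transform of the measure that is given by the linear
functional `L`: `ω(φ) = L(φ^)` for all rapidly decreasing `φ`. -/
def IsFourierTransform {d : ℕ} (L : (Space d → ℂ) → ℂ) (ω : Measure (Space d)) : Prop :=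
  ∀ φ : 𝓢(Space d, ℂ), Integrable φ ω ∧ ∫ k, φ k ∂ω = L (𝓕 φ : 𝓢(Space d, ℂ))

/-- `ω` is the diffraction of (the measure with density) `g`: the autocorrelation of `g` exists and
the positive Radon measure `ω` is its Fourier transform. -/
def IsDiffraction {d : ℕ} (g : Space d → ℂ) (ω : Measure (Space d)) : Prop :=
  ∃ γ : ComplexRadon d, IsAutocorrelation g γ ∧
    (∀ φ : 𝓢(Space d, ℂ), Integrable (𝓕 φ : 𝓢(Space d, ℂ)) γ.variation) ∧
    IsLocallyFiniteMeasure ω ∧ IsFourierTransform γ.integral ω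

/-! ### Representations of `ℝ^d` and their spectral measures -/

/-- The character `χ_k(x) = exp(2πi k·x)`. -/
def chi {d : ℕ} (k x : Space d) : ℂ := (Real.fourierChar (inner ℝ k x) : ℂ)

/-- The translation representation `(T_t F)(lam) = F(T_{-t} lam)` on `L²(X, μ)`. -/
def translationRep {d m : ℕ} {r : ℝ} (μ : Measure (Config d m r))
    [VAddInvariantMeasure (Space d) (Config d m r) μ] (t : Space d) (F : Lp ℂ 2 μ) : Lp ℂ 2 μ :=
  Lp.compMeasurePreserving (fun lam => (-t) +ᵥ lam) (measurePreserving_vadd (-t) μ) F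

theorem memLp_chi_mul {d : ℕ} (ω : Measure (Space d)) (t : Space d) (f : Lp ℂ 2 ω) :
    MemLp (fun x => chi (-t) x * f x) 2 ω := by
  have hc : Continuous (chi (-t)) :=
    continuous_subtype_val.comp (Real.continuous_fourierChar.comp (by fun_prop))
  refine (Lp.memLp f).of_le
    (hc.aestronglyMeasurable.mul (Lp.memLp f).aestronglyMeasurable) (ae_of_all _ fun x => ?_)
  rw [norm_mul, chi, Circle.norm_coe, one_mul]

/-- The multiplication representation `(U_t f)(x) = exp(-2πi t·x) f(x)` on `L²(ℝ^d, ω)`. -/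
def multiplicationRep {d : ℕ} (ω : Measure (Space d)) (t : Space d) (f : Lp ℂ 2 ω) : Lp ℂ 2 ω :=
  (memLp_chi_mul ω t f).toLp _

/-- The finite positive measure `σ` is the spectral measure of `u` for the representation `S`:
`(u, S_t u) = ∫ exp(2πi x·t) dσ(x)`, where `(·,·)` is linear in its first variable
(so that `(u, v)` is `inner ℂ v u`). -/
def IsSpectralMeasure {d : ℕ} {H : Type*} [NormedAddCommGroup H] [InnerProductSpace ℂ H]
    (S : Space d → H → H) (u : H) (σ : Measure (Space d)) : Prop :=
  IsFiniteMeasure σ ∧ ∀ t : Space d, inner ℂ (S t u) u = ∫ x, chi x t ∂σ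

/-- The complex measure `ρ` is the spectral measure of the pair `u, v` for the representation `S`,
that is the inverse Fourier transform of `t ↦ (S_t u, v)`:
`(S_t u, v) = ∫ exp(-2πi x·t) dρ(x)`, where `(·,·)` is linear in its first variable. -/
def IsCrossSpectralMeasure {d : ℕ} {H : Type*} [NormedAddCommGroup H] [InnerProductSpace ℂ H]
    (S : Space d → H → H) (u v : H) (ρ : ComplexMeasure (Space d)) : Prop :=
  ∀ t : Space d, inner ℂ v (S t u) =
    VectorMeasure.integral ρ (fun x => chi (-x) t) (ContinuousLinearMap.mul ℝ ℂ)

/-- `u` is an eigenfunction of the representation `S` for the character `χ_k`. -/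
def IsEigenfunction {d : ℕ} {H : Type*} [NormedAddCommGroup H] [InnerProductSpace ℂ H]
    (S : Space d → H → H) (k : Space d) (u : H) : Prop :=
  u ≠ 0 ∧ ∀ t : Space d, S t u = chi k t • u

/-- `θ` is an isometric embedding of `L²(ℝ^d, ω)` into `L²(X, μ)` that sends `f^` to `N^w_f` for
every rapidly decreasing `f`. -/
def IsCountingEmbedding {d m : ℕ} {r : ℝ} (μ : Measure (Config d m r)) (w : Fin m → ℝ)
    (ω : Measure (Space d)) (θ : Lp ℂ 2 ω →ₗᵢ[ℂ] Lp ℂ 2 μ) : Prop :=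
  ∀ f : 𝓢(Space d, ℂ),
    ∃ (h₁ : MemLp (𝓕 f : 𝓢(Space d, ℂ)) 2 ω) (h₂ : MemLp (countingFn w f) 2 μ),
      θ (h₁.toLp _) = h₂.toLp _

/-- The indicator function of the point `{x}` in `L²(ℝ^d, ω)`. -/
def pointIndicator {d : ℕ} (ω : Measure (Space d)) [IsLocallyFiniteMeasure ω] (x : Space d) :
    Lp ℂ 2 ω :=
  indicatorConstLp 2 (measurableSet_singleton x) isCompact_singleton.measure_ne_top (1 : ℂ)

end

/-! Everything rests on one identity for second moments. By stationarity and uniqueness of Haar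
measure, a configuration seen from its points of a given colour is distributed as Lebesgue measure
times the Palm measure (`map_compProd_colourKernel`). Recentring one of the two sums at its points
turns `∫ N_f conj(N_g) dμ` into the Palm moment of the correlation `f * g~`
(`integral_countingFn_mul_conj`). So the Palm moment is a positive definite functional, although the
weights may be negative.

A Bochner-Schwartz argument produces `ω`. Multiply the Palm moment by autocorrelations `h_n * h_n~`
that tend to `1`. The Fourier transform then has at `k` the density `∫ |N_{χ_{-k} h_n}|² dμ ≥ 0`.
These positive measures are translation bounded uniformly in `n`, so vague compactness gives a limit
(`exists_fourierTransform_combination`, `exists_fourierTransform_palmMoment`). Since the weights are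
real, `ω` is invariant under reflection, and the identity becomes a Plancherel formula `(N_f, N_g) =
(f^, g^)_ω`. As the functions `f^` are dense in `L²(ω)`, the map `f^ ↦ N_f` extends to the isometry
`θ`. It intertwines the two representations because translating `f` multiplies `f^` by a character.

Through `θ` the spectral questions concern multiplication operators. The cross spectral measure of
`f, g` is `f conj(g) ω`. An eigenfunction of `U` for `χ_k` is concentrated at the point `-k`.
Ergodicity makes eigenvalues of `T` simple, since the quotient of two eigenfunctions is invariant.

For Dworkin's theorem, `θ(f^) = N_f` is extended to continuous `f` of compact support, so that `N_f`
has spectral measure `|f^|² ω`. The function `f * λ` is a bounded function of the orbit of `λ`, and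
up to boundary terms its autocorrelation is an average of orbit products over cubes. The pointwise
ergodic theorem (`ae_tendsto_cubeAvg`), obtained from Wiener's maximal inequality and the density of
coboundaries, gives the limit for each test function. Separability gives it for all test functions
almost surely. The limit has as density a matrix coefficient of `T`, whose Fourier transform is the
spectral measure. -/

noncomputable section

/-! ### Translation bounded measures -/

/-- The weight `(1 + ‖x‖)⁻ⁿ`. -/
def decayWeight {d : ℕ} (n : ℕ) (x : Space d) : ℝ := ((1 + ‖x‖) ^ n)⁻¹

section Weights

variable {d : ℕ}

theorem decayWeight_pos (n : ℕ) (x : Space d) : 0 < decayWeight n x := by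
  unfold decayWeight; positivity

theorem continuous_decayWeight (n : ℕ) : Continuous (decayWeight n : Space d → ℝ) := by
  unfold decayWeight
  exact Continuous.inv₀ (by fun_prop) fun x => by positivity

/-- Peetre's inequality: `1 + ‖y‖ ≤ (1 + ‖x‖) (1 + ‖x - y‖)`. -/
theorem decayWeight_le_mul (n : ℕ) (x y : Space d) :
    decayWeight n x ≤ (1 + ‖x - y‖) ^ n * decayWeight n y := by
  unfold decayWeight
  rw [← div_eq_mul_inv, inv_eq_one_div, div_le_div_iff₀ (by positivity) (by positivity),
    one_mul, ← mul_pow]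
  gcongr
  have := norm_add_le x (y - x)
  rw [add_sub_cancel, norm_sub_rev] at this
  nlinarith [norm_nonneg x, norm_nonneg (x - y)]

theorem decayWeight_succ_mul (n : ℕ) (x : Space d) :
    (1 + ‖x‖) * decayWeight (n + 1) x = decayWeight n x := by
  unfold decayWeight
  have : (1 + ‖x‖) ≠ 0 := by positivity
  rw [pow_succ, mul_inv]
  field_simp

theorem integrable_decayWeight {n : ℕ} (hn : d < n) :
    Integrable (decayWeight n : Space d → ℝ) := by
  have h := integrable_one_add_norm (E := Space d) (μ := volume) (r := n) (by simpa using hn)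
  refine h.congr (ae_of_all _ fun x => ?_)
  simp only [decayWeight]
  rw [Real.rpow_neg (by positivity), Real.rpow_natCast]

/-- The bound for the integral of the weight against a measure that gives mass at most `1` to the
balls of radius `ρ`. -/
def weightConst (d : ℕ) (ρ : ℝ) (n : ℕ) : ENNReal :=
  ENNReal.ofReal ((1 + ρ) ^ n) * (∫⁻ y : Space d, ENNReal.ofReal (decayWeight n y)) *
    (volume (Metric.ball (0 : Space d) ρ))⁻¹

theorem weightConst_lt_top {ρ : ℝ} (hρ : 0 < ρ) {n : ℕ} (hn : d < n) :
    weightConst d ρ n < ⊤ := by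
  unfold weightConst
  refine ENNReal.mul_lt_top (ENNReal.mul_lt_top ENNReal.ofReal_lt_top ?_) ?_
  · exact (integrable_decayWeight hn).lintegral_lt_top
  · exact ENNReal.inv_lt_top.2 (Metric.measure_ball_pos _ _ hρ)

/-- A measure is translation bounded if the mass of the balls of a fixed radius is bounded. -/
def TranslationBounded (τ : Measure (Space d)) (ρ : ℝ) (M : ENNReal) : Prop :=
  ∀ x, τ (Metric.ball x ρ) ≤ M

theorem TranslationBounded.isLocallyFinite {τ : Measure (Space d)} {ρ : ℝ} {M : ENNReal}
    (h : TranslationBounded τ ρ M) (hρ : 0 < ρ) (hM : M ≠ ⊤) : IsLocallyFiniteMeasure τ :=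
  ⟨fun x => ⟨_, Metric.ball_mem_nhds x hρ, (h x).trans_lt hM.lt_top⟩⟩

/-- The weight varies by at most the factor `(1 + ρ) ^ n` on a ball of radius `ρ`, so it may be
replaced by its Lebesgue average over that ball. After Tonelli the inner integral is the `τ`-mass of
a ball, which is at most `M`. -/
theorem TranslationBounded.lintegral_decayWeight_le {τ : Measure (Space d)} {ρ : ℝ} {M : ENNReal}
    (h : TranslationBounded τ ρ M) (hρ : 0 < ρ) (hM : M ≠ ⊤) (n : ℕ) :
    ∫⁻ x, ENNReal.ofReal (decayWeight n x) ∂τ ≤ M * weightConst d ρ n := by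
  have := h.isLocallyFinite hρ hM
  set V := volume (Metric.ball (0 : Space d) ρ) with hV
  have hV0 : V ≠ 0 := (Metric.measure_ball_pos _ _ hρ).ne'
  have hVt : V ≠ ⊤ := measure_ball_lt_top.ne
  have hball : ∀ x : Space d, volume (Metric.ball x ρ) = V := fun x => by
    rw [hV, Measure.addHaar_ball_center]
  have hm : Measurable fun p : Space d × Space d =>
      (Metric.ball p.1 ρ).indicator (fun y => ENNReal.ofReal ((1 + ρ) ^ n * decayWeight n y))
        p.2 := by
    have hs : MeasurableSet {p : Space d × Space d | p.2 ∈ Metric.ball p.1 ρ} := by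
      simp only [Metric.mem_ball]
      exact (isOpen_lt (by fun_prop) continuous_const).measurableSet
    have hf : Measurable fun p : Space d × Space d =>
        ENNReal.ofReal ((1 + ρ) ^ n * decayWeight n p.2) :=
      (continuous_const.mul
        ((continuous_decayWeight n).comp continuous_snd)).measurable.ennreal_ofReal
    exact hf.indicator hs
  have key : V * ∫⁻ x, ENNReal.ofReal (decayWeight n x) ∂τ ≤
      M * (ENNReal.ofReal ((1 + ρ) ^ n) * ∫⁻ y : Space d, ENNReal.ofReal (decayWeight n y)) := by
    calc V * ∫⁻ x, ENNReal.ofReal (decayWeight n x) ∂τ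
        = ∫⁻ x, ENNReal.ofReal (decayWeight n x) * volume (Metric.ball x ρ) ∂τ := by
          simp_rw [hball]
          rw [lintegral_mul_const _ (continuous_decayWeight n).measurable.ennreal_ofReal, mul_comm]
      _ ≤ ∫⁻ x, (∫⁻ y, (Metric.ball x ρ).indicator
            (fun y => ENNReal.ofReal ((1 + ρ) ^ n * decayWeight n y)) y) ∂τ := by
          refine lintegral_mono fun x => ?_
          rw [lintegral_indicator measurableSet_ball, ← setLIntegral_const]
          refine setLIntegral_mono' measurableSet_ball fun y hy => ?_
          refine ENNReal.ofReal_le_ofReal ((decayWeight_le_mul n x y).trans ?_)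
          have : ‖x - y‖ ≤ ρ := by
            rw [← dist_eq_norm, dist_comm]; exact (Metric.mem_ball.1 hy).le
          have h0 := (decayWeight_pos n y).le
          gcongr
      _ = ∫⁻ y, ∫⁻ x, (Metric.ball y ρ).indicator
            (fun _ => ENNReal.ofReal ((1 + ρ) ^ n * decayWeight n y)) x ∂τ := by
          rw [lintegral_lintegral_swap hm.aemeasurable]
          refine lintegral_congr fun y => lintegral_congr fun x => ?_
          simp only [Set.indicator, Metric.mem_ball, dist_comm]
      _ ≤ ∫⁻ y : Space d, M * ENNReal.ofReal ((1 + ρ) ^ n * decayWeight n y) := by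
          refine lintegral_mono fun y => ?_
          rw [lintegral_indicator measurableSet_ball, setLIntegral_const, mul_comm]
          gcongr
          exact h y
      _ = _ := by
          have h1 : (0 : ℝ) ≤ (1 + ρ) ^ n := by positivity
          simp_rw [ENNReal.ofReal_mul h1]
          rw [lintegral_const_mul _
            ((continuous_decayWeight n).measurable.ennreal_ofReal.const_mul _),
            lintegral_const_mul _ (continuous_decayWeight n).measurable.ennreal_ofReal]
  unfold weightConst
  rw [← mul_assoc, ← ENNReal.div_eq_inv_mul.trans (mul_comm _ _),
    ENNReal.le_div_iff_mul_le (Or.inl hV0) (Or.inl hVt), mul_comm]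
  exact key

theorem TranslationBounded.integrable_of_le {τ : Measure (Space d)} {ρ : ℝ} {M : ENNReal}
    (h : TranslationBounded τ ρ M) (hρ : 0 < ρ) (hM : M ≠ ⊤) {n : ℕ} (hn : d < n)
    {f : Space d → ℂ} (hf : AEStronglyMeasurable f τ) {A : ℝ}
    (hA : ∀ x, ‖f x‖ ≤ A * decayWeight n x) : Integrable f τ := by
  have : Integrable (decayWeight n : Space d → ℝ) τ := by
    refine ⟨(continuous_decayWeight n).aestronglyMeasurable, ?_⟩
    rw [hasFiniteIntegral_iff_ofReal (ae_of_all _ fun x => (decayWeight_pos n x).le)]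
    exact (h.lintegral_decayWeight_le hρ hM n).trans_lt
      (ENNReal.mul_lt_top hM.lt_top (weightConst_lt_top hρ hn))
  exact (this.const_mul A).mono' hf (ae_of_all _ hA)

theorem TranslationBounded.integral_norm_le {τ : Measure (Space d)} {ρ : ℝ} {M : ENNReal}
    (h : TranslationBounded τ ρ M) (hρ : 0 < ρ) (hM : M ≠ ⊤) {n : ℕ} (hn : d < n)
    {f : Space d → ℂ} {A : ℝ} (h0 : 0 ≤ A)
    (hA : ∀ x, ‖f x‖ ≤ A * decayWeight n x) :
    ∫ x, ‖f x‖ ∂τ ≤ A * (M * weightConst d ρ n).toReal := by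
  have hfin : M * weightConst d ρ n ≠ ⊤ :=
    (ENNReal.mul_lt_top hM.lt_top (weightConst_lt_top hρ hn)).ne
  have hle := h.lintegral_decayWeight_le hρ hM n
  have hi : Integrable (decayWeight n : Space d → ℝ) τ := by
    refine ⟨(continuous_decayWeight n).aestronglyMeasurable, ?_⟩
    rw [hasFiniteIntegral_iff_ofReal (ae_of_all _ fun x => (decayWeight_pos n x).le)]
    exact hle.trans_lt hfin.lt_top
  calc ∫ x, ‖f x‖ ∂τ ≤ ∫ x, A * decayWeight n x ∂τ :=
        integral_mono_of_nonneg (ae_of_all _ fun x => norm_nonneg _) (hi.const_mul A)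
          (ae_of_all _ hA)
    _ = A * (∫⁻ x, ENNReal.ofReal (decayWeight n x) ∂τ).toReal := by
        rw [integral_const_mul, integral_eq_lintegral_of_nonneg_ae
          (ae_of_all _ fun x => (decayWeight_pos n x).le)
          (continuous_decayWeight n).aestronglyMeasurable]
    _ ≤ _ := by
        gcongr

theorem SchwartzMap.exists_norm_le_decayWeight (f : 𝓢(Space d, ℂ)) (n : ℕ) :
    ∃ A : ℝ, 0 ≤ A ∧ ∀ x, ‖f x‖ ≤ A * decayWeight n x := by
  refine ⟨2 ^ n * ((Finset.Iic (n, 0)).sup fun m => SchwartzMap.seminorm ℝ m.1 m.2) f,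
    by positivity, fun x => ?_⟩
  have h := SchwartzMap.one_add_le_sup_seminorm_apply (𝕜 := ℝ) (m := (n, 0)) (k := n) (n := 0)
    le_rfl le_rfl f x
  rw [norm_iteratedFDeriv_zero] at h
  unfold decayWeight
  rw [← div_eq_mul_inv, le_div_iff₀ (by positivity), mul_comm]
  exact h

theorem exists_norm_le_decayWeight_of_hasCompactSupport {f : Space d → ℂ} (hf : Continuous f)
    (hs : HasCompactSupport f) (n : ℕ) :
    ∃ A : ℝ, 0 ≤ A ∧ ∀ x, ‖f x‖ ≤ A * decayWeight n x := by
  have hc : Continuous fun x => f x * ((1 + ‖x‖ : ℝ) ^ n : ℝ) := by fun_prop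
  obtain ⟨A, hA⟩ := (hs.mul_right (f' := fun x : Space d => (((1 + ‖x‖ : ℝ) ^ n : ℝ) : ℂ))
    ).exists_bound_of_continuous hc
  refine ⟨A, (norm_nonneg _).trans (hA 0), fun x => ?_⟩
  unfold decayWeight
  rw [← div_eq_mul_inv, le_div_iff₀ (by positivity)]
  refine le_trans (le_of_eq ?_) (hA x)
  rw [Pi.mul_apply, norm_mul, Complex.norm_real, Real.norm_of_nonneg (by positivity)]

end Weights

/-! ### Measurability on the space of configurations -/

section Config

open ProbabilityTheory

variable {d m : ℕ} {r : ℝ}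

theorem measurableEmbedding_colour (i : Fin m) :
    MeasurableEmbedding fun x : Space d => (x, i) := by
  exact measurableEmbedding_prod_mk_right i

theorem colour_apply (i : Fin m) (lam : Config d m r) (s : Set (Space d)) :
    colour i lam s = lam.1 ((fun x => (x, i)) '' s) :=
  (measurableEmbedding_colour i).comap_apply _ _

theorem measurable_colour (i : Fin m) :
    Measurable (colour i : Config d m r → Measure (Space d)) := by
  refine Measure.measurable_of_measurable_coe _ fun s hs => ?_
  simp_rw [colour_apply]
  exact (Measure.measurable_coe ((measurableEmbedding_colour i).measurableSet_image.2 hs)).comp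
    measurable_subtype_coe

/-- A ball of radius `r / 2` fits into an open cube of edge length `r`. The bound is uniform in the
configuration, which makes the counting functions of rapidly decaying functions bounded on the whole
space of configurations. -/
theorem translationBounded_colour (i : Fin m) (lam : Config d m r) :
    TranslationBounded (colour i lam) (r / 2) 1 := by
  intro x
  rw [colour_apply]
  refine le_trans (measure_mono ?_) (lam.2.le_one x)
  rintro _ ⟨y, hy, rfl⟩ j
  have : |(y - x) j| ≤ ‖y - x‖ := by
    simpa using PiLp.norm_apply_le (y - x) j
  exact this.trans_lt (by rwa [← dist_eq_norm])

/-- The kernel that maps a configuration to the part of colour `i`. -/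
def colourKernel (i : Fin m) : Kernel (Config d m r) (Space d) := ⟨colour i, measurable_colour i⟩

theorem colourKernel_apply (i : Fin m) (lam : Config d m r) :
    colourKernel i lam = colour i lam := rfl

theorem half_pos_of_fact [hr : Fact (0 < r)] : 0 < r / 2 := half_pos hr.out

instance [Fact (0 < r)] (i : Fin m) (lam : Config d m r) :
    IsLocallyFiniteMeasure (colour i lam) :=
  (translationBounded_colour i lam).isLocallyFinite half_pos_of_fact ENNReal.one_ne_top

/-- The colour measures may be infinite, but weighting them with `decayWeight (d + 1)` bounds their
masses uniformly. Dividing the resulting finite kernel by the weight recovers the original one. -/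
instance [Fact (0 < r)] (i : Fin m) :
    IsSFiniteKernel (colourKernel i : Kernel (Config d m r) (Space d)) := by
  have hw : Measurable fun x : Space d => ENNReal.ofReal (decayWeight (d + 1) x) :=
    (continuous_decayWeight _).measurable.ennreal_ofReal
  let κ : Kernel (Config d m r) (Space d) :=
    ⟨fun lam => (colour i lam).withDensity fun x => ENNReal.ofReal (decayWeight (d + 1) x), by
      refine Measure.measurable_of_measurable_coe _ fun s hs => ?_
      simp_rw [withDensity_apply _ hs, ← lintegral_indicator hs]
      exact (Measure.measurable_lintegral (hw.indicator hs)).comp (measurable_colour i)⟩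
  have hκ : IsFiniteKernel κ := by
    refine ⟨⟨1 * weightConst d (r / 2) (d + 1), ?_, fun lam => ?_⟩⟩
    · exact ENNReal.mul_lt_top ENNReal.one_lt_top
        (weightConst_lt_top half_pos_of_fact (Nat.lt_succ_self d))
    · change (colour i lam).withDensity _ Set.univ ≤ _
      rw [withDensity_apply _ MeasurableSet.univ, Measure.restrict_univ]
      exact (translationBounded_colour i lam).lintegral_decayWeight_le half_pos_of_fact
        ENNReal.one_ne_top _
  have heq : colourKernel i =
      κ.withDensity fun _ x => (ENNReal.ofReal (decayWeight (d + 1) x))⁻¹ := by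
    ext1 lam
    rw [Kernel.withDensity_apply _ (by exact (hw.inv.comp measurable_snd))]
    change colour i lam = ((colour i lam).withDensity _).withDensity _
    rw [withDensity_inv_same hw]
    · exact ae_of_all _ fun x => (ENNReal.ofReal_pos.2 (decayWeight_pos _ x)).ne'
    · exact ae_of_all _ fun x => ENNReal.ofReal_ne_top
  rw [heq]
  exact Kernel.IsSFiniteKernel.withDensity κ fun _ x => by
    simp [decayWeight_pos]

theorem colour_vadd (i : Fin m) (t : Space d) (lam : Config d m r) :
    colour i (t +ᵥ lam) = (colour i lam).map (t + ·) := by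
  ext s hs
  have hmap : (t +ᵥ lam).1 ((fun x => (x, i)) '' s) =
      lam.1 (shift t ⁻¹' ((fun x => (x, i)) '' s)) :=
    (shift t).toMeasurableEquiv.measurableEmbedding.map_apply _ _
  rw [Measure.map_apply (measurable_const_add t) hs, colour_apply, colour_apply, hmap]
  congr 1
  ext ⟨x, j⟩
  constructor
  · rintro ⟨y, hy, hxy⟩
    have hxy' : (y, i) = (t + x, j) := hxy
    obtain ⟨rfl, rfl⟩ := Prod.mk.inj hxy'
    exact ⟨x, hy, rfl⟩
  · rintro ⟨y, hy, hxy⟩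
    simp only [Prod.mk.injEq] at hxy
    refine ⟨t + y, hy, ?_⟩
    simp [shift, hxy.1, hxy.2]

theorem integral_colour_vadd {E : Type*} [NormedAddCommGroup E] [NormedSpace ℝ E] (i : Fin m)
    (t : Space d) (lam : Config d m r) (f : Space d → E) :
    ∫ x, f x ∂colour i (t +ᵥ lam) = ∫ x, f (t + x) ∂colour i lam := by
  rw [colour_vadd]
  exact (measurableEmbedding_addLeft t).integral_map f

theorem countingFn_vadd (w : Fin m → ℝ) (f : Space d → ℂ) (t : Space d) (lam : Config d m r) :
    countingFn w f (t +ᵥ lam) = countingFn w (fun x => f (t + x)) lam := by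
  simp only [countingFn, integral_colour_vadd]

theorem val_eq_sum_map_colour (lam : Config d m r) {s : Set (Space d × Fin m)}
    (hs : MeasurableSet s) :
    lam.1 s = ∑ i, colour i lam {x | (x, i) ∈ s} := by
  have : s = ⋃ i ∈ (Finset.univ : Finset (Fin m)), (fun x => (x, i)) '' {x | (x, i) ∈ s} := by
    ext ⟨x, j⟩
    simp
  conv_lhs => rw [this]
  rw [measure_biUnion_finset]
  · simp_rw [colour_apply]
  · intro i _ j _ hij
    refine Set.disjoint_left.2 ?_
    rintro _ ⟨x, _, rfl⟩ ⟨y, _, h⟩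
    exact hij (Prod.mk.inj h).2.symm
  · intro i _
    exact (measurableEmbedding_colour i).measurableSet_image.2 (measurable_prodMk_right hs)

/-- Joint measurability in the translation and the configuration is what permits Fubini along
orbits. The mass of a set under a translated configuration is a sum over colours of kernel masses of
sections of one measurable set, and such masses are measurable for s-finite kernels. -/
instance [Fact (0 < r)] : MeasurableVAdd₂ (Space d) (Config d m r) where
  measurable_vadd := by
    refine Measurable.subtype_mk (f := fun p : Space d × Config d m r => p.2.1.map (shift p.1))
      (Measure.measurable_of_measurable_coe _ fun s hs => ?_)
    have : (fun p : Space d × Config d m r => p.2.1.map (shift p.1) s) =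
        fun p => ∑ i, ((colourKernel i).comap Prod.snd measurable_snd :
            Kernel (Space d × Config d m r) (Space d)) p
          (Prod.mk p ⁻¹' {q : (Space d × Config d m r) × Space d | (q.1.1 + q.2, i) ∈ s}) := by
      ext p
      rw [Measure.map_apply (shift p.1).measurable hs,
        val_eq_sum_map_colour _ ((shift p.1).measurable hs)]
      rfl
    rw [this]
    refine Finset.measurable_sum _ fun i _ => Kernel.measurable_kernel_prodMk_left ?_
    exact (Measurable.prodMk (by fun_prop) measurable_const) hs

theorem measurable_countingFn (w : Fin m → ℝ) {f : Space d → ℂ} (hf : Measurable f) :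
    Measurable (countingFn w f : Config d m r → ℂ) := by
  refine Finset.measurable_sum _ fun i _ => Measurable.const_mul ?_ _
  exact (hf.stronglyMeasurable.integral_kernel (κ := colourKernel i)).measurable

theorem norm_countingFn_le [Fact (0 < r)] (w : Fin m → ℝ) {f : Space d → ℂ} {A : ℝ} (hA : 0 ≤ A)
    (hf : ∀ x, ‖f x‖ ≤ A * decayWeight (d + 1) x) (lam : Config d m r) :
    ‖countingFn w f lam‖ ≤ A * ((∑ i, |w i|) * (1 * weightConst d (r / 2) (d + 1)).toReal) := by
  refine (norm_sum_le _ _).trans ?_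
  rw [Finset.sum_mul, Finset.mul_sum]
  refine Finset.sum_le_sum fun i _ => ?_
  rw [norm_mul, Complex.norm_real, Real.norm_eq_abs, mul_left_comm]
  gcongr
  exact (norm_integral_le_integral_norm _).trans
    ((translationBounded_colour i lam).integral_norm_le half_pos_of_fact ENNReal.one_ne_top
      (Nat.lt_succ_self d) hA hf)

theorem integrable_colour [Fact (0 < r)] {f : Space d → ℂ} (hm : Measurable f) {A : ℝ}
    (hf : ∀ x, ‖f x‖ ≤ A * decayWeight (d + 1) x) (i : Fin m) (lam : Config d m r) :
    Integrable f (colour i lam) :=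
  (translationBounded_colour i lam).integrable_of_le half_pos_of_fact ENNReal.one_ne_top
    (Nat.lt_succ_self d) hm.aestronglyMeasurable hf

end Config

/-! ### Averages over cubes -/

section Cubes

variable {d : ℕ}

theorem isOpen_cube (R : ℝ) : IsOpen (cube d R) := by
  have : cube d R = ⋂ i, {x : Space d | |x i| < R / 2} := by
    ext x; simp [cube]
  rw [this]
  exact isOpen_iInter_of_finite fun i => isOpen_lt (by fun_prop) continuous_const

theorem measurableSet_cube (R : ℝ) : MeasurableSet (cube d R) := (isOpen_cube R).measurableSet

theorem volume_cube {R : ℝ} (hR : 0 < R) : volume (cube d R) = ENNReal.ofReal (R ^ d) := by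
  have h := (EuclideanSpace.volume_preserving_symm_measurableEquiv_toLp
    (Fin d)).measure_preimage_equiv (Set.univ.pi fun _ => Set.Ioo (-(R / 2)) (R / 2))
  have hpre : (MeasurableEquiv.toLp 2 (Fin d → ℝ)).symm ⁻¹'
      (Set.univ.pi fun _ => Set.Ioo (-(R / 2)) (R / 2)) = cube d R := by
    ext x
    simp [cube, abs_lt]
  rw [hpre] at h
  rw [h, Real.volume_pi_Ioo]
  simp [ENNReal.ofReal_pow hR.le]

/-- The volume of the cube as a real number. -/
def cubeVol (d : ℕ) (R : ℝ) : ℝ := (volume (cube d R)).toReal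

theorem cubeVol_eq {R : ℝ} (hR : 0 < R) : cubeVol d R = R ^ d := by
  rw [cubeVol, volume_cube hR, ENNReal.toReal_ofReal (by positivity)]

theorem cubeVol_pos {R : ℝ} (hR : 0 < R) : 0 < cubeVol d R := by
  rw [cubeVol_eq hR]; positivity

theorem cube_mono {R S : ℝ} (h : R ≤ S) : cube d R ⊆ cube d S := fun x hx i =>
  (hx i).trans_le (by linarith)

/-- The Euclidean norm is at most the sum of the absolute coordinates. The factor `d + 1` in place
of `d` keeps the radius positive for positive `R` in dimension `0` too. -/
theorem cube_subset_closedBall {R : ℝ} (hR : 0 ≤ R) :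
    cube d R ⊆ Metric.closedBall 0 ((d + 1) * R) := by
  intro x hx
  rw [mem_closedBall_zero_iff]
  calc ‖x‖ ≤ ∑ i, |x i| := by
        rw [EuclideanSpace.norm_eq]
        simp only [Real.norm_eq_abs, sq_abs]
        refine Real.sqrt_le_iff.2 ⟨Finset.sum_nonneg fun i _ => abs_nonneg _, ?_⟩
        have := Finset.sum_sq_le_sq_sum_of_nonneg (s := Finset.univ) (f := fun i => |x i|)
          fun i _ => abs_nonneg _
        simpa using this
    _ ≤ ∑ _i : Fin d, R := Finset.sum_le_sum fun i _ => by linarith [hx i]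
    _ ≤ _ := by simp; nlinarith

theorem volume_cube_lt_top (R : ℝ) : volume (cube d R) < ⊤ := by
  refine (measure_mono (cube_mono (le_max_left R 1))).trans_lt ?_
  rw [volume_cube (by positivity)]
  exact ENNReal.ofReal_lt_top

/-- Twice the norm appears because `R` is an edge length: the half edge shrinks by `‖t‖`. -/
theorem add_mem_cube {R : ℝ} {x t : Space d} (hx : x ∈ cube d (R - 2 * ‖t‖)) :
    x + t ∈ cube d R := by
  intro i
  have h1 := hx i
  have h2 : |t i| ≤ ‖t‖ := by simpa using PiLp.norm_apply_le t i
  have h3 := abs_add_le (x i) (t i)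
  simp only [PiLp.add_apply]
  linarith

/-- The average over the cube of edge length `R`. -/
def cubeAvg (R : ℝ) (F : Space d → ℂ) : ℂ :=
  ((volume (cube d R)).toReal : ℂ)⁻¹ * ∫ x in cube d R, F x

theorem tendsto_cubeVol_boundary (a : ℝ) :
    Tendsto (fun R : ℝ => (cubeVol d R)⁻¹ * (cubeVol d R - cubeVol d (R - a))) atTop (𝓝 0) := by
  have h1 : Tendsto (fun R : ℝ => 1 - (1 - a * R⁻¹) ^ d) atTop (𝓝 (1 - (1 - a * 0) ^ d)) :=
    ((tendsto_inv_atTop_zero.const_mul a).const_sub 1).pow d |>.const_sub 1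
  simp only [mul_zero, sub_zero, one_pow, sub_self] at h1
  refine h1.congr' ?_
  filter_upwards [eventually_gt_atTop 0, eventually_gt_atTop a] with R hR hRa
  rw [cubeVol_eq hR, cubeVol_eq (by linarith), mul_sub, inv_mul_cancel₀ (by positivity),
    ← inv_pow, ← mul_pow]
  congr 2
  field_simp

/-- A shell of fixed thickness has volume of lower order than the cube, so bounded contributions
from it disappear in the average. -/
theorem tendsto_inv_cubeVol_mul_of_boundary {H : ℝ → ℂ} {K a : ℝ}
    (h : ∀ᶠ R in atTop, ‖H R‖ ≤ K * (cubeVol d R - cubeVol d (R - a))) :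
    Tendsto (fun R : ℝ => ((volume (cube d R)).toReal : ℂ)⁻¹ * H R) atTop (𝓝 0) := by
  have h1 := (tendsto_cubeVol_boundary (d := d) a).const_mul K
  rw [mul_zero] at h1
  refine squeeze_zero_norm' ?_ h1
  filter_upwards [h, eventually_gt_atTop 0] with R hR hR0
  rw [norm_mul, norm_inv, Complex.norm_real, Real.norm_of_nonneg ENNReal.toReal_nonneg]
  calc (cubeVol d R)⁻¹ * ‖H R‖ ≤ (cubeVol d R)⁻¹ * (K * (cubeVol d R - cubeVol d (R - a))) := by
        have := (cubeVol_pos (d := d) hR0).le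
        gcongr
    _ = _ := by ring

theorem measureReal_cube_diff {R a : ℝ} (ha : 0 ≤ a) :
    (volume (cube d R \ cube d (R - a))).toReal = cubeVol d R - cubeVol d (R - a) := by
  rw [measure_sdiff (cube_mono (by linarith)) (measurableSet_cube _).nullMeasurableSet
    (volume_cube_lt_top _).ne, ENNReal.toReal_sub_of_le (measure_mono (cube_mono (by linarith)))
    (volume_cube_lt_top _).ne]
  rfl

theorem integrableOn_of_bounded {F : Space d → ℂ} (hF : Measurable F) {C : ℝ}
    (hC : ∀ x, ‖F x‖ ≤ C) {s : Set (Space d)} (hs : volume s < ⊤) : IntegrableOn F s :=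
  Measure.integrableOn_of_bounded hs.ne hF.aestronglyMeasurable (ae_of_all _ hC)

/-- The cube and its translate both contain the cube of edge `R - 2‖t‖`. The two integrals agree
there and differ only over two shells of equal small volume. -/
theorem tendsto_cubeAvg_sub_translate {F : Space d → ℂ} (hF : Measurable F) {C : ℝ}
    (hC : ∀ x, ‖F x‖ ≤ C) (t : Space d) :
    Tendsto (fun R => cubeAvg R fun x => F x - F (x - t)) atTop (𝓝 0) := by
  have hC0 : 0 ≤ C := (norm_nonneg _).trans (hC 0)
  refine tendsto_inv_cubeVol_mul_of_boundary (K := 2 * C) (a := 2 * ‖t‖) (Eventually.of_forall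
    fun R => ?_)
  have hFt : Measurable fun x => F (x - t) := hF.comp (measurable_id.sub_const t)
  have hi := fun S : ℝ => integrableOn_of_bounded hF hC (volume_cube_lt_top (d := d) S)
  rw [integral_sub (hi R) (integrableOn_of_bounded hFt (fun x => hC _) (volume_cube_lt_top R))]
  have hdiff : volume (cube d R \ cube d (R - 2 * ‖t‖)) < ⊤ :=
    (measure_mono Set.sdiff_subset).trans_lt (volume_cube_lt_top R)
  have hsplit : ∀ G : Space d → ℂ, IntegrableOn G (cube d R) →
      ∫ x in cube d R, G x = (∫ x in cube d (R - 2 * ‖t‖), G x) +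
        ∫ x in cube d R \ cube d (R - 2 * ‖t‖), G x := by
    intro G hG
    rw [← setIntegral_union Set.disjoint_sdiff_right
      ((measurableSet_cube _).diff (measurableSet_cube _))
      (hG.mono_set (cube_mono (by linarith [norm_nonneg t]))) (hG.mono_set Set.sdiff_subset),
      Set.union_sdiff_cancel (cube_mono (by linarith [norm_nonneg t]))]
  have hpre : ∫ x in cube d R, F (x - t) = ∫ x in (fun x => x + t) ⁻¹' cube d R, F x := by
    have h := (measurePreserving_add_right volume t).setIntegral_preimage_emb
      (measurableEmbedding_addRight t) (fun x => F (x - t)) (cube d R)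
    rw [← h]
    simp
  have hsub : cube d (R - 2 * ‖t‖) ⊆ (fun x => x + t) ⁻¹' cube d R := fun x hx => add_mem_cube hx
  have hmp : MeasurableSet ((fun x : Space d => x + t) ⁻¹' cube d R) :=
    measurable_add_const t (measurableSet_cube R)
  have hvp : volume ((fun x : Space d => x + t) ⁻¹' cube d R) = volume (cube d R) :=
    measure_preimage_add_right volume t _
  have hsplit2 : ∫ x in (fun x => x + t) ⁻¹' cube d R, F x =
      (∫ x in cube d (R - 2 * ‖t‖), F x) +
        ∫ x in (fun x => x + t) ⁻¹' cube d R \ cube d (R - 2 * ‖t‖), F x := by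
    have hG : IntegrableOn F ((fun x => x + t) ⁻¹' cube d R) :=
      integrableOn_of_bounded hF hC (by rw [hvp]; exact volume_cube_lt_top R)
    rw [← setIntegral_union Set.disjoint_sdiff_right (hmp.diff (measurableSet_cube _))
      (hG.mono_set hsub) (hG.mono_set Set.sdiff_subset), Set.union_sdiff_cancel hsub]
  have hvol2 : (volume ((fun x => x + t) ⁻¹' cube d R \ cube d (R - 2 * ‖t‖))).toReal =
      cubeVol d R - cubeVol d (R - 2 * ‖t‖) := by
    rw [measure_sdiff hsub (measurableSet_cube _).nullMeasurableSet
      (volume_cube_lt_top _).ne, ENNReal.toReal_sub_of_le (measure_mono hsub)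
      (by rw [hvp]; exact (volume_cube_lt_top _).ne), hvp]
    rfl
  have hdiff2 : volume ((fun x => x + t) ⁻¹' cube d R \ cube d (R - 2 * ‖t‖)) < ⊤ :=
    (measure_mono Set.sdiff_subset).trans_lt (by rw [hvp]; exact volume_cube_lt_top R)
  rw [hpre, hsplit2, hsplit F (hi R), add_sub_add_left_eq_sub]
  refine (norm_sub_le _ _).trans ?_
  have e1 := norm_setIntegral_le_of_norm_le_const (f := F) hdiff (C := C) fun x _ => hC x
  have e2 := norm_setIntegral_le_of_norm_le_const (f := F) hdiff2 (C := C) fun x _ => hC x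
  rw [Measure.real, measureReal_cube_diff (by positivity)] at e1
  rw [Measure.real, hvol2] at e2
  linarith

end Cubes

/-! ### The maximal inequality -/

section Maximal

open ProbabilityTheory

open ENNReal

variable {d : ℕ}

/-- Vitali's covering lemma selects disjoint balls whose enlargements still cover `E`; summing the
hypothesis over them gives the estimate. The bounds `L` and `S` keep the right side local, since
orbit functions need not be integrable on the whole space. -/
theorem hardyLittlewood_maximal {G : Space d → ℝ≥0∞} {α : ℝ≥0∞}
    {S L : ℝ} {E : Set (Space d)} (hE : E ⊆ Metric.closedBall 0 L)
    {ρ : Space d → ℝ} (hρ : ∀ x, 0 < ρ x) (hS : ∀ x, ρ x ≤ S)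
    (h : ∀ x ∈ E, α * volume (Metric.closedBall x (ρ x)) ≤
      ∫⁻ y in Metric.closedBall x (ρ x), G y) :
    α * volume E ≤ ENNReal.ofReal (4 ^ d) * ∫⁻ y in Metric.closedBall 0 (L + S), G y := by
  -- Any enlargement ratio above `3` is admissible; `4` is the source of the factor `4 ^ d`.
  obtain ⟨u, huE, hdisj, hcov⟩ := Vitali.exists_disjoint_subfamily_covering_enlargement_closedBall
    E id ρ S (fun x _ => hS x) 4 (by norm_num)
  simp only [id] at hdisj hcov
  have hcount : u.Countable := by
    refine hdisj.countable_of_nonempty_interior fun x _ => ?_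
    exact ⟨x, Metric.ball_subset_interior_closedBall (Metric.mem_ball_self (hρ x))⟩
  have hsub : E ⊆ ⋃ x ∈ u, Metric.closedBall x (4 * ρ x) := by
    intro x hx
    obtain ⟨y, hy, hxy⟩ := hcov x hx
    exact Set.mem_biUnion hy (hxy (Metric.mem_closedBall_self (hρ x).le))
  have hscale : ∀ x : Space d, volume (Metric.closedBall x (4 * ρ x)) =
      ENNReal.ofReal (4 ^ d) * volume (Metric.closedBall x (ρ x)) := fun x => by
    rw [Measure.addHaar_closedBall_mul _ _ (by norm_num) (hρ x).le,
      Measure.addHaar_closedBall_center volume x]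
    simp
  calc α * volume E ≤ α * ∑' x : u, volume (Metric.closedBall (x : Space d) (4 * ρ x)) := by
        gcongr
        exact (measure_mono hsub).trans (measure_biUnion_le _ hcount _)
    _ = ENNReal.ofReal (4 ^ d) * ∑' x : u, α * volume (Metric.closedBall (x : Space d) (ρ x)) := by
        simp_rw [hscale, ENNReal.tsum_mul_left]
        ring
    _ ≤ ENNReal.ofReal (4 ^ d) * ∑' x : u, ∫⁻ y in Metric.closedBall (x : Space d) (ρ x), G y := by
        gcongr with x
        exact h x (huE x.2)
    _ = ENNReal.ofReal (4 ^ d) * ∫⁻ y in ⋃ x ∈ u, Metric.closedBall x (ρ x), G y := by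
        rw [lintegral_biUnion hcount (fun x _ => Metric.isClosed_closedBall.measurableSet) hdisj]
    _ ≤ _ := by
        gcongr
        refine Set.iUnion₂_subset fun x hx => Metric.closedBall_subset_closedBall' ?_
        have := mem_closedBall_zero_iff.1 (hE (huE hx))
        rw [dist_zero_right]
        linarith [hS x]

variable {X : Type*} [MeasurableSpace X] [AddAction (Space d) X] [MeasurableVAdd₂ (Space d) X]
  {μ : Measure X}

theorem measurable_neg_vadd : Measurable fun p : X × Space d => -p.2 +ᵥ p.1 :=
  measurable_snd.neg.vadd measurable_fst

theorem measurable_lintegral_orbit {e : X → ℝ≥0∞} (he : Measurable e) (s : Set (Space d)) :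
    Measurable fun lam => ∫⁻ x in s, e (-x +ᵥ lam) :=
  (he.comp measurable_neg_vadd).lintegral_prod_right'

/-- The set where a ball average along the orbit, with one of the first `M` radii, exceeds `α`. -/
def maximalSet (e : X → ℝ≥0∞) (α : ℝ≥0∞) (ρ : ℕ → ℝ) (M : ℕ) : Set X :=
  {lam | ∃ n < M, α * volume (Metric.closedBall (0 : Space d) (ρ n)) <
    ∫⁻ x in Metric.closedBall (0 : Space d) (ρ n), e (-x +ᵥ lam)}

theorem measurableSet_maximalSet {e : X → ℝ≥0∞} (he : Measurable e) (α : ℝ≥0∞) (ρ : ℕ → ℝ)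
    (M : ℕ) : MeasurableSet (maximalSet (d := d) e α ρ M) := by
  have : maximalSet (d := d) e α ρ M = ⋃ n ∈ Finset.range M,
      {lam | α * volume (Metric.closedBall (0 : Space d) (ρ n)) <
        ∫⁻ x in Metric.closedBall (0 : Space d) (ρ n), e (-x +ᵥ lam)} := by
    ext lam; simp [maximalSet]
  rw [this]
  exact Finset.measurableSet_biUnion _ fun n _ =>
    measurableSet_lt measurable_const (measurable_lintegral_orbit he _)

theorem setLIntegral_closedBall_translate (G : Space d → ℝ≥0∞) (x : Space d) (ρ : ℝ) :
    ∫⁻ z in Metric.closedBall 0 ρ, G (x + z) = ∫⁻ y in Metric.closedBall x ρ, G y := by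
  have h := (measurePreserving_add_left volume x).setLIntegral_comp_preimage_emb
    (measurableEmbedding_addLeft x) G (Metric.closedBall x ρ)
  rw [← h]
  congr 2
  ext z
  simp [dist_eq_norm]

theorem lintegral_orbit_eq [SFinite μ] [VAddInvariantMeasure (Space d) X μ] {e : X → ℝ≥0∞}
    (he : Measurable e) (s : Set (Space d)) :
    ∫⁻ lam, (∫⁻ x in s, e (-x +ᵥ lam)) ∂μ = volume s * ∫⁻ lam, e lam ∂μ := by
  rw [lintegral_lintegral_swap (f := fun lam (x : Space d) => e (-x +ᵥ lam))
    (he.comp measurable_neg_vadd).aemeasurable]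
  have : ∀ x : Space d, ∫⁻ lam, e (-x +ᵥ lam) ∂μ = ∫⁻ lam, e lam ∂μ := fun x =>
    (measurePreserving_vadd (-x) μ).lintegral_comp he
  simp_rw [this]
  rw [setLIntegral_const, mul_comm]

/-- Wiener's transference: the Euclidean maximal inequality is applied on each orbit to the points
of a ball of radius `S`, and then integrated over `μ`. By invariance both sides become Lebesgue
volumes times integrals over `X`. Enlarging the ball from `S` to `2S` costs `2 ^ d`, whence `8 ^ d =
4 ^ d * 2 ^ d`. -/
theorem maximal_ergodic_finite [SFinite μ] [VAddInvariantMeasure (Space d) X μ] {e : X → ℝ≥0∞}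
    (he : Measurable e) (α : ℝ≥0∞) {ρ : ℕ → ℝ} (hρ : ∀ n, 0 < ρ n) (M : ℕ) :
    α * μ (maximalSet (d := d) e α ρ M) ≤ ENNReal.ofReal (8 ^ d) * ∫⁻ lam, e lam ∂μ := by
  set E := maximalSet (d := d) e α ρ M with hEdef
  have hEm : MeasurableSet E := measurableSet_maximalSet he α ρ M
  -- A common bound for the radii. Summing up to `M` inclusive keeps `S` positive even if `M = 0`.
  set S : ℝ := ∑ n ∈ Finset.range (M + 1), ρ n with hSdef
  have hρS : ∀ n ≤ M, ρ n ≤ S := fun n hn =>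
    Finset.single_le_sum (fun i _ => (hρ i).le) (Finset.mem_range.2 (Nat.lt_succ_of_le hn))
  have hS : 0 < S := (hρ 0).trans_le (hρS 0 (Nat.zero_le _))
  set V := volume (Metric.closedBall (0 : Space d) S) with hV
  have hV0 : V ≠ 0 := (Metric.measure_closedBall_pos _ _ hS).ne'
  have hVt : V ≠ ⊤ := measure_closedBall_lt_top.ne
  have hpt : ∀ lam : X, α * ∫⁻ x in Metric.closedBall (0 : Space d) S, E.indicator 1 (-x +ᵥ lam) ≤
      ENNReal.ofReal (4 ^ d) * ∫⁻ x in Metric.closedBall (0 : Space d) (S + S), e (-x +ᵥ lam) := by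
    intro lam
    set E' : Set (Space d) := {x | -x +ᵥ lam ∈ E} ∩ Metric.closedBall 0 S with hE'
    have hm : MeasurableSet {x : Space d | -x +ᵥ lam ∈ E} :=
      (measurable_neg_vadd.comp measurable_prodMk_left) hEm
    have h1 : ∫⁻ x in Metric.closedBall (0 : Space d) S, E.indicator 1 (-x +ᵥ lam) =
        volume E' := by
      have : ∀ x : Space d, E.indicator (1 : X → ℝ≥0∞) (-x +ᵥ lam) =
          {x : Space d | -x +ᵥ lam ∈ E}.indicator 1 x := fun x => rfl
      simp_rw [this]
      rw [lintegral_indicator_one hm, Measure.restrict_apply hm]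
    rw [h1]
    -- A radius is needed at every point; outside `E'` the index `0` serves as a default, which is
    -- why the bound reads `n ≤ M` and not `n < M`.
    have hex : ∀ x : Space d, ∃ n ≤ M, x ∈ E' →
        α * volume (Metric.closedBall (0 : Space d) (ρ n)) <
          ∫⁻ z in Metric.closedBall (0 : Space d) (ρ n), e (-z +ᵥ (-x +ᵥ lam)) := by
      intro x
      by_cases hx : x ∈ E'
      · obtain ⟨n, hn, h⟩ := hx.1
        exact ⟨n, hn.le, fun _ => h⟩
      · exact ⟨0, Nat.zero_le _, fun h => absurd h hx⟩
    choose n hnM hn using hex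
    refine hardyLittlewood_maximal (ρ := fun x => ρ (n x)) Set.inter_subset_right
      (fun x => hρ _) (fun x => hρS _ (hnM x)) fun x hx => ?_
    rw [Measure.addHaar_closedBall_center, ← setLIntegral_closedBall_translate]
    refine (hn x hx).le.trans (le_of_eq ?_)
    congr 1
    ext z
    rw [vadd_vadd, neg_add_rev]
  have hint : α * (V * μ E) ≤ ENNReal.ofReal (4 ^ d) *
      (volume (Metric.closedBall (0 : Space d) (S + S)) * ∫⁻ lam, e lam ∂μ) := by
    have h1 : μ E = ∫⁻ lam, E.indicator 1 lam ∂μ := (lintegral_indicator_one hEm).symm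
    rw [h1, ← lintegral_orbit_eq (measurable_one.indicator hEm), ← lintegral_orbit_eq he,
      ← lintegral_const_mul _ (measurable_lintegral_orbit he _),
      ← lintegral_const_mul _ (measurable_lintegral_orbit (measurable_one.indicator hEm) _)]
    exact lintegral_mono hpt
  have hV2 : volume (Metric.closedBall (0 : Space d) (S + S)) = ENNReal.ofReal (2 ^ d) * V := by
    rw [← two_mul, Measure.addHaar_closedBall_mul _ _ (by norm_num) hS.le]
    simp [hV]
  have h8 : ENNReal.ofReal (8 ^ d) = ENNReal.ofReal (4 ^ d) * ENNReal.ofReal (2 ^ d) := by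
    rw [← ENNReal.ofReal_mul (by positivity), ← mul_pow]
    norm_num
  rw [hV2] at hint
  rw [← ENNReal.mul_le_mul_iff_right hV0 hVt]
  calc V * (α * μ E) = α * (V * μ E) := by ring
    _ ≤ _ := hint
    _ = _ := by rw [h8]; ring

theorem maximal_ergodic [SFinite μ] [VAddInvariantMeasure (Space d) X μ] {e : X → ℝ≥0∞}
    (he : Measurable e) (α : ℝ≥0∞) {ρ : ℕ → ℝ} (hρ : ∀ n, 0 < ρ n) :
    α * μ (⋃ M, maximalSet (d := d) e α ρ M) ≤ ENNReal.ofReal (8 ^ d) * ∫⁻ lam, e lam ∂μ := by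
  have hmono : Monotone (maximalSet (d := d) e α ρ) := fun M N h lam ⟨n, hn, hl⟩ =>
    ⟨n, hn.trans_le h, hl⟩
  rw [hmono.measure_iUnion, ENNReal.mul_iSup]
  exact iSup_le fun M => maximal_ergodic_finite he α hρ M

end Maximal

/-! ### The pointwise ergodic theorem over cubes -/

section Ergodic

set_option linter.unusedSectionVars false

variable {d : ℕ} {X : Type*} [MeasurableSpace X] [AddAction (Space d) X]
  [MeasurableVAdd₂ (Space d) X] {μ : Measure X}

/-- Preimages of measurable sets under `u` are invariant modulo null sets, hence null or conull. A
countable family of sets separates the points of `ℂ`, so `u` takes a single value almost everywhere.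
-/
theorem ErgodicVAdd.ae_eq_const [IsProbabilityMeasure μ] [ErgodicVAdd (Space d) X μ] {u : X → ℂ}
    (hu : AEStronglyMeasurable u μ) (h : ∀ t : Space d, (fun lam => u (t +ᵥ lam)) =ᵐ[μ] u) :
    ∃ c, u =ᵐ[μ] fun _ => c := by
  refine exists_eventuallyEq_const_of_forall_separating MeasurableSet fun U hU => ?_
  have hinv : ∀ t : Space d, (t +ᵥ ·) ⁻¹' (u ⁻¹' U) =ᵐ[μ] u ⁻¹' U := fun t => by
    filter_upwards [h t] with lam hl
    exact congrArg (· ∈ U) hl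
  have := MeasureTheory.aeconst_of_forall_preimage_vadd_ae_eq (Space d)
    (hu.aemeasurable.nullMeasurableSet_preimage hU) hinv
  rw [eventuallyConst_set] at this
  exact this

/-- The averages of `b` over cubes along every orbit tend to `0`, and `b` is bounded. -/
structure IsCoboundary (d : ℕ) {X : Type*} [MeasurableSpace X] [AddAction (Space d) X]
    (b : X → ℂ) : Prop where
  measurable : Measurable b
  bounded : ∃ C, ∀ lam, ‖b lam‖ ≤ C
  tendsto : ∀ lam, Tendsto (fun R => cubeAvg R fun x : Space d => b (-x +ᵥ lam)) atTop (𝓝 0)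

theorem measurable_orbit {F : X → ℂ} (hF : Measurable F) (lam : X) :
    Measurable fun x : Space d => F (-x +ᵥ lam) :=
  hF.comp (measurable_neg_vadd.comp measurable_prodMk_left)

theorem cubeAvg_add {F G : Space d → ℂ} {R : ℝ} (hF : IntegrableOn F (cube d R))
    (hG : IntegrableOn G (cube d R)) :
    cubeAvg R (fun x => F x + G x) = cubeAvg R F + cubeAvg R G := by
  rw [cubeAvg, integral_add hF hG, mul_add, cubeAvg, cubeAvg]

theorem cubeAvg_const_mul (c : ℂ) (F : Space d → ℂ) (R : ℝ) :
    cubeAvg R (fun x => c * F x) = c * cubeAvg R F := by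
  rw [cubeAvg, integral_const_mul, cubeAvg, mul_left_comm]

theorem integrableOn_orbit {F : X → ℂ} (hF : Measurable F) {C : ℝ} (hC : ∀ lam, ‖F lam‖ ≤ C)
    (lam : X) (R : ℝ) : IntegrableOn (fun x : Space d => F (-x +ᵥ lam)) (cube d R) :=
  integrableOn_of_bounded (measurable_orbit hF lam) (fun _ => hC _) (volume_cube_lt_top R)

theorem IsCoboundary.add {b c : X → ℂ} (hb : IsCoboundary d b) (hc : IsCoboundary d c) :
    IsCoboundary d (b + c) := by
  obtain ⟨B, hB⟩ := hb.bounded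
  obtain ⟨C, hC⟩ := hc.bounded
  refine ⟨hb.measurable.add hc.measurable, ⟨B + C, fun lam => (norm_add_le _ _).trans
    (add_le_add (hB lam) (hC lam))⟩, fun lam => ?_⟩
  have := (hb.tendsto lam).add (hc.tendsto lam)
  rw [add_zero] at this
  refine this.congr fun R => ?_
  exact (cubeAvg_add (integrableOn_orbit hb.measurable hB lam R)
    (integrableOn_orbit hc.measurable hC lam R)).symm

theorem IsCoboundary.const_smul {b : X → ℂ} (hb : IsCoboundary d b) (c : ℂ) :
    IsCoboundary d (c • b) := by
  obtain ⟨B, hB⟩ := hb.bounded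
  refine ⟨hb.measurable.const_smul c, ⟨‖c‖ * B, fun lam => ?_⟩, fun lam => ?_⟩
  · rw [Pi.smul_apply, norm_smul]
    gcongr
    exact hB lam
  · have := (hb.tendsto lam).const_mul c
    rw [mul_zero] at this
    exact this.congr fun R => (cubeAvg_const_mul c _ R).symm

theorem isCoboundary_zero : IsCoboundary d (0 : X → ℂ) :=
  ⟨measurable_zero, ⟨0, fun lam => by simp⟩, fun lam => by simp [cubeAvg]⟩

theorem isCoboundary_sub_translate {h : X → ℂ} (hh : Measurable h) {C : ℝ}
    (hC : ∀ lam, ‖h lam‖ ≤ C) (t : Space d) :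
    IsCoboundary d fun lam => h lam - h (t +ᵥ lam) := by
  refine ⟨hh.sub (hh.comp (measurable_const_vadd t)), ⟨C + C, fun lam =>
    (norm_sub_le _ _).trans (add_le_add (hC _) (hC _))⟩, fun lam => ?_⟩
  refine (tendsto_cubeAvg_sub_translate (measurable_orbit hh lam) (fun x => hC _) t).congr
    fun R => ?_
  simp only [vadd_vadd, neg_sub]
  simp only [sub_eq_add_neg]

theorem IsCoboundary.memLp [IsFiniteMeasure μ] {b : X → ℂ} (hb : IsCoboundary d b) :
    MemLp b 2 μ := by
  obtain ⟨B, hB⟩ := hb.bounded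
  exact MemLp.of_bound hb.measurable.aestronglyMeasurable B (ae_of_all _ hB)

/-- The classes of coboundaries as a subspace of `L²`. -/
def coboundarySubmodule (d : ℕ) {X : Type*} [MeasurableSpace X] [AddAction (Space d) X]
    [MeasurableVAdd₂ (Space d) X] (μ : Measure X) : Submodule ℂ (Lp ℂ 2 μ) where
  carrier := {u | ∃ b, IsCoboundary d b ∧ u =ᵐ[μ] b}
  add_mem' := by
    rintro u v ⟨b, hb, hub⟩ ⟨c, hc, hvc⟩
    exact ⟨b + c, hb.add hc, (Lp.coeFn_add u v).trans (hub.add hvc)⟩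
  zero_mem' := ⟨0, isCoboundary_zero, Lp.coeFn_zero _ _ _⟩
  smul_mem' := by
    rintro c u ⟨b, hb, hub⟩
    exact ⟨c • b, hb.const_smul c, (Lp.coeFn_smul c u).trans (hub.const_smul c)⟩

/-- Orthogonality to `1_s - 1_{t + s}` says that `u` has the same integral over `s` and over `t +
s`. By invariance of `μ` the latter is the integral of `u(t + ·)` over `s`, so `u` is invariant and
ergodicity applies. -/
theorem ae_eq_const_of_mem_orthogonal [IsProbabilityMeasure μ] [ErgodicVAdd (Space d) X μ]
    {u : Lp ℂ 2 μ} (hu : u ∈ (coboundarySubmodule d μ)ᗮ) : ∃ c : ℂ, u =ᵐ[μ] fun _ => c := by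
  have hui : Integrable u μ := (Lp.memLp u).integrable (by norm_num)
  refine ErgodicVAdd.ae_eq_const (d := d) (Lp.aestronglyMeasurable u) fun t => ?_
  have hmp := measurePreserving_vadd t μ
  have hme : MeasurableEmbedding fun lam : X => t +ᵥ lam := measurableEmbedding_const_vadd t
  have huti : Integrable (fun lam => u (t +ᵥ lam)) μ := hmp.integrable_comp_of_integrable hui
  refine huti.ae_eq_of_forall_setIntegral_eq _ _ hui fun s hs _ => ?_
  set h : X → ℂ := s.indicator 1 with hh
  have hhm : Measurable h := measurable_one.indicator hs
  have hhb : ∀ lam, ‖h lam‖ ≤ 1 := fun lam => by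
    by_cases hl : lam ∈ s <;> simp [hh, hl]
  have hb := isCoboundary_sub_translate hhm hhb (-t)
  have hort := (Submodule.mem_orthogonal _ _).1 hu (hb.memLp.toLp _)
    ⟨_, hb, hb.memLp.coeFn_toLp⟩
  rw [L2.inner_def] at hort
  have hcongr : (fun lam => inner ℂ ((hb.memLp (μ := μ)).toLp _ lam) (u lam)) =ᵐ[μ]
      fun lam => s.indicator u lam - ((t +ᵥ ·) '' s).indicator u lam := by
    filter_upwards [(hb.memLp (μ := μ)).coeFn_toLp] with lam hl
    rw [hl]
    have hmem : lam ∈ ((t +ᵥ ·) '' s : Set X) ↔ -t +ᵥ lam ∈ s := by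
      constructor
      · rintro ⟨y, hy, rfl⟩
        simpa using hy
      · exact fun hy => ⟨_, hy, by simp⟩
    by_cases h1 : lam ∈ s <;> by_cases h2 : -t +ᵥ lam ∈ s <;>
      simp [hh, h1, h2, hmem]
  have hs' : MeasurableSet ((t +ᵥ ·) '' s : Set X) := hme.measurableSet_image.2 hs
  rw [integral_congr_ae hcongr, integral_sub (hui.indicator hs) (hui.indicator hs'),
    integral_indicator hs, integral_indicator hs', sub_eq_zero] at hort
  rw [hort]
  have := hmp.setIntegral_preimage_emb hme u ((t +ᵥ ·) '' s)
  rw [← this, Set.preimage_image_eq _ hme.injective]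

/-- Vectors orthogonal to all coboundaries are constant, and the centred function is orthogonal to
constants. So it lies in the closure of the coboundaries in `L²`, and on a probability space the
`L¹` norm is at most the `L²` norm. -/
theorem exists_coboundary_approx [IsProbabilityMeasure μ] [ErgodicVAdd (Space d) X μ] {F : X → ℂ}
    (hF : Measurable F) {C : ℝ} (hC : ∀ lam, ‖F lam‖ ≤ C) {ε : ℝ} (hε : 0 < ε) :
    ∃ b : X → ℂ, IsCoboundary d b ∧
      ∫⁻ lam, ‖F lam - (∫ l, F l ∂μ) - b lam‖ₑ ∂μ ≤ ENNReal.ofReal ε := by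
  set c := ∫ l, F l ∂μ with hc
  have hm : MemLp (fun lam => F lam - c) 2 μ :=
    MemLp.of_bound (hF.sub_const c).aestronglyMeasurable (C + ‖c‖)
      (ae_of_all _ fun lam => (norm_sub_le _ _).trans (by gcongr; exact hC lam))
  have hFi : Integrable F μ := Integrable.of_bound hF.aestronglyMeasurable C (ae_of_all _ hC)
  set V := coboundarySubmodule d μ with hV
  have hmem : hm.toLp _ ∈ V.topologicalClosure := by
    rw [← Submodule.orthogonal_orthogonal_eq_closure, Submodule.mem_orthogonal]
    intro u hu
    obtain ⟨a, ha⟩ := ae_eq_const_of_mem_orthogonal hu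
    rw [L2.inner_def]
    have : (fun lam => inner ℂ (u lam) (hm.toLp _ lam)) =ᵐ[μ] fun lam => conj a * (F lam - c) := by
      filter_upwards [ha, hm.coeFn_toLp] with lam h1 h2
      rw [h1, h2, RCLike.inner_apply, mul_comm]
    rw [integral_congr_ae this, integral_const_mul, integral_sub hFi (integrable_const c)]
    simp [hc]
  obtain ⟨v, ⟨b, hb, hvb⟩, hdist⟩ := Metric.mem_closure_iff.1 hmem ε hε
  refine ⟨b, hb, ?_⟩
  have hmb : MemLp (fun lam => F lam - c - b lam) 2 μ := hm.sub hb.memLp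
  calc ∫⁻ lam, ‖F lam - c - b lam‖ₑ ∂μ = eLpNorm (fun lam => F lam - c - b lam) 1 μ :=
        eLpNorm_one_eq_lintegral_enorm.symm
    _ ≤ eLpNorm (fun lam => F lam - c - b lam) 2 μ :=
        eLpNorm_le_eLpNorm_of_exponent_le (by norm_num) hmb.aestronglyMeasurable
    _ = eLpNorm (hm.toLp _ - v : Lp ℂ 2 μ) 2 μ := by
        refine eLpNorm_congr_ae ?_
        filter_upwards [Lp.coeFn_sub (hm.toLp _) v, hm.coeFn_toLp, hvb] with lam h1 h2 h3
        rw [h1, Pi.sub_apply, h2, h3]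
    _ = ENNReal.ofReal ‖(hm.toLp _ - v : Lp ℂ 2 μ)‖ := by
        rw [Lp.norm_def, ENNReal.ofReal_toReal (Lp.eLpNorm_ne_top _)]
    _ ≤ ENNReal.ofReal ε := by
        rw [dist_eq_norm] at hdist
        exact ENNReal.ofReal_le_ofReal hdist.le

theorem cubeAvg_const {R : ℝ} (hR : 0 < R) (c : ℂ) : cubeAvg R (fun _ : Space d => c) = c := by
  have h := cubeVol_pos (d := d) hR
  rw [cubeAvg, setIntegral_const, Measure.real, Complex.real_smul, ← mul_assoc, inv_mul_cancel₀,
    one_mul]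
  exact Complex.ofReal_ne_zero.2 h.ne'

/-- The countably many radii `(d + 1) (n + 1)` control all real edge lengths `R ≥ 1`: take `n =
⌊R⌋`. Since `⌊R⌋ + 1 ≤ 2R`, the surrounding ball has volume at most a constant times that of the
cube. -/
theorem norm_cubeAvg_le_of_notMem_maximalSet {e : X → ℂ} {a : ℝ} (ha : 0 ≤ a) {lam : X}
    (h : lam ∉ ⋃ M, maximalSet (d := d) (fun lam => ‖e lam‖ₑ) (ENNReal.ofReal a)
      (fun n => (d + 1) * (n + 1)) M) {R : ℝ} (hR : 1 ≤ R) :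
    ‖cubeAvg R fun x : Space d => e (-x +ᵥ lam)‖ ≤
      2 ^ d * (volume (Metric.closedBall (0 : Space d) (d + 1))).toReal * a := by
  have hR0 : 0 < R := by linarith
  have hle : cube d R ⊆ Metric.closedBall 0 ((d + 1) * ((⌊R⌋₊ : ℝ) + 1)) :=
    (cube_subset_closedBall hR0.le).trans (Metric.closedBall_subset_closedBall (by
      have := (Nat.lt_floor_add_one R).le
      gcongr))
  have hnot : ∫⁻ x in Metric.closedBall (0 : Space d) ((d + 1) * ((⌊R⌋₊ : ℝ) + 1)),
      ‖e (-x +ᵥ lam)‖ₑ ≤ ENNReal.ofReal a *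
        volume (Metric.closedBall (0 : Space d) ((d + 1) * ((⌊R⌋₊ : ℝ) + 1))) := by
    by_contra hcon
    exact h (Set.mem_iUnion.2 ⟨⌊R⌋₊ + 1, ⌊R⌋₊, Nat.lt_succ_self _, not_le.1 hcon⟩)
  have hvol : volume (Metric.closedBall (0 : Space d) ((d + 1) * ((⌊R⌋₊ : ℝ) + 1))) ≤
      ENNReal.ofReal ((2 * R) ^ d) * volume (Metric.closedBall (0 : Space d) (d + 1)) := by
    rw [mul_comm, Measure.addHaar_closedBall_mul _ _ (by positivity) (by positivity)]
    refine mul_le_mul' (ENNReal.ofReal_le_ofReal ?_) le_rfl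
    rw [finrank_euclideanSpace_fin]
    have := Nat.floor_le hR0.le
    gcongr
    linarith
  have hfin : volume (Metric.closedBall (0 : Space d) ((d : ℝ) + 1)) ≠ ⊤ :=
    measure_closedBall_lt_top.ne
  have hint : ‖∫ x in cube d R, e (-x +ᵥ lam)‖ₑ ≤ ENNReal.ofReal (a * ((2 * R) ^ d *
      (volume (Metric.closedBall (0 : Space d) (d + 1))).toReal)) := by
    refine (enorm_integral_le_lintegral_enorm _).trans ?_
    refine (lintegral_mono_set hle).trans (hnot.trans ?_)
    rw [ENNReal.ofReal_mul ha, ENNReal.ofReal_mul (by positivity), ENNReal.ofReal_toReal hfin]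
    gcongr
  rw [← ofReal_norm, ENNReal.ofReal_le_ofReal_iff (by positivity)] at hint
  rw [cubeAvg, norm_mul, norm_inv, Complex.norm_real, Real.norm_of_nonneg ENNReal.toReal_nonneg]
  change (cubeVol d R)⁻¹ * _ ≤ _
  rw [cubeVol_eq hR0, inv_mul_le_iff₀ (by positivity)]
  refine hint.trans (le_of_eq ?_)
  rw [mul_pow]
  ring

/-- Banach's principle: the centred function is a coboundary, whose averages vanish in the limit on
every orbit, plus an error of small `L¹` norm. The maximal inequality bounds the measure of the bad
set by a multiple of that norm, which is arbitrary. -/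
theorem ae_eventually_norm_cubeAvg_sub_le [IsProbabilityMeasure μ] [ErgodicVAdd (Space d) X μ]
    {F : X → ℂ} (hF : Measurable F) {C : ℝ} (hC : ∀ lam, ‖F lam‖ ≤ C) {δ : ℝ} (hδ : 0 < δ) :
    ∀ᵐ lam ∂μ, ∀ᶠ R in atTop,
      ‖(cubeAvg R fun x : Space d => F (-x +ᵥ lam)) - ∫ l, F l ∂μ‖ ≤ δ := by
  set c := ∫ l, F l ∂μ with hc
  set v := (volume (Metric.closedBall (0 : Space d) (d + 1))).toReal with hv
  have hv0 : 0 < v := ENNReal.toReal_pos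
    (Metric.measure_closedBall_pos _ _ (by positivity)).ne' measure_closedBall_lt_top.ne
  -- Chosen so that the bound off the maximal set, `2 ^ d * v * a`, equals `δ / 2`.
  set a := δ / 2 / (2 ^ d * v) with ha
  have ha0 : 0 < a := by positivity
  have key : ∀ ε : ℝ, 0 < ε → ENNReal.ofReal a * μ {lam | ¬ ∀ᶠ R in atTop,
      ‖(cubeAvg R fun x : Space d => F (-x +ᵥ lam)) - c‖ ≤ δ} ≤
        ENNReal.ofReal (8 ^ d * ε) := by
    intro ε hε
    obtain ⟨b, hb, hbε⟩ := exists_coboundary_approx (d := d) (μ := μ) hF hC hε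
    obtain ⟨B, hB⟩ := hb.bounded
    have hem : Measurable fun lam => F lam - c - b lam := (hF.sub_const c).sub hb.measurable
    have heb : ∀ lam, ‖F lam - c - b lam‖ ≤ C + ‖c‖ + B := fun lam =>
      (norm_sub_le _ _).trans (add_le_add ((norm_sub_le _ _).trans
        (add_le_add (hC lam) le_rfl)) (hB lam))
    have hmax := maximal_ergodic (d := d) (μ := μ) (e := fun lam => ‖F lam - c - b lam‖ₑ) hem.enorm
      (ENNReal.ofReal a) (ρ := fun n => (d + 1) * (n + 1)) (fun n => by positivity)
    calc _ ≤ ENNReal.ofReal a * μ (⋃ M, maximalSet (d := d) (fun lam => ‖F lam - c - b lam‖ₑ)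
          (ENNReal.ofReal a) (fun n => (d + 1) * (n + 1)) M) := by
          gcongr
          intro lam hlam
          by_contra hnot
          refine hlam ?_
          have hsmall : ∀ᶠ R in atTop, ‖cubeAvg R fun x : Space d => b (-x +ᵥ lam)‖ ≤ δ / 2 := by
            have := (hb.tendsto lam).norm
            rw [norm_zero] at this
            exact (this.eventually (ge_mem_nhds (by positivity)))
          filter_upwards [hsmall, eventually_ge_atTop 1] with R hR1 hR2
          have hbound := norm_cubeAvg_le_of_notMem_maximalSet ha0.le hnot hR2
          have hdec : (cubeAvg R fun x : Space d => F (-x +ᵥ lam)) - c =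
              (cubeAvg R fun x : Space d => b (-x +ᵥ lam)) +
                cubeAvg R fun x : Space d => (F (-x +ᵥ lam) - c - b (-x +ᵥ lam)) := by
            rw [sub_eq_iff_eq_add, ← cubeAvg_add (integrableOn_orbit hb.measurable hB lam R)
              (integrableOn_orbit hem heb lam R)]
            nth_rewrite 2 [← cubeAvg_const (d := d) (R := R) (by linarith) c]
            rw [← cubeAvg_add]
            · congr 1
              ext x
              ring
            · exact (integrableOn_orbit hb.measurable hB lam R).add
                (integrableOn_orbit hem heb lam R)
            · exact integrableOn_const (volume_cube_lt_top R).ne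
          rw [hdec]
          refine (norm_add_le _ _).trans ?_
          have : 2 ^ d * v * a = δ / 2 := by
            rw [ha]; field_simp
          linarith
      _ ≤ _ := hmax
      _ ≤ ENNReal.ofReal (8 ^ d) * ENNReal.ofReal ε := by gcongr
      _ = _ := (ENNReal.ofReal_mul (by positivity)).symm
  rw [ae_iff]
  have hz : ENNReal.ofReal a * μ {lam | ¬ ∀ᶠ R in atTop,
      ‖(cubeAvg R fun x : Space d => F (-x +ᵥ lam)) - c‖ ≤ δ} = 0 := by
    refine le_antisymm (ENNReal.le_of_forall_pos_le_add fun ε hε _ => ?_) bot_le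
    have h := key (ε / 8 ^ d) (by positivity)
    rw [mul_div_cancel₀ _ (by positivity)] at h
    simpa using h
  exact (mul_eq_zero.1 hz).resolve_left (ENNReal.ofReal_pos.2 ha0).ne'

theorem ae_tendsto_cubeAvg [IsProbabilityMeasure μ] [ErgodicVAdd (Space d) X μ]
    {F : X → ℂ} (hF : Measurable F) {C : ℝ} (hC : ∀ lam, ‖F lam‖ ≤ C) :
    ∀ᵐ lam ∂μ, Tendsto (fun R => cubeAvg R fun x : Space d => F (-x +ᵥ lam)) atTop
      (𝓝 (∫ l, F l ∂μ)) := by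
  have h := ae_all_iff.2 fun n : ℕ => ae_eventually_norm_cubeAvg_sub_le (d := d) (μ := μ) hF hC
    (δ := ((n : ℝ) + 1)⁻¹) (by positivity)
  filter_upwards [h] with lam hl
  rw [Metric.tendsto_nhds]
  intro ε hε
  obtain ⟨n, hn⟩ := exists_nat_one_div_lt hε
  filter_upwards [hl n] with R hR
  rw [dist_eq_norm]
  exact hR.trans_lt (by simpa using hn)

end Ergodic

/-! ### Characters -/

section Characters

variable {d : ℕ}

theorem continuous_chi_uncurry : Continuous fun p : Space d × Space d => chi p.1 p.2 :=
  continuous_subtype_val.comp (Real.continuous_fourierChar.comp (by fun_prop))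

theorem continuous_chi_neg_uncurry : Continuous fun p : Space d × Space d => chi (-p.1) p.2 :=
  continuous_subtype_val.comp (Real.continuous_fourierChar.comp (by fun_prop))

theorem continuous_chi (k : Space d) : Continuous (chi k) :=
  continuous_chi_uncurry.comp (Continuous.prodMk_right k)

theorem norm_chi (k x : Space d) : ‖chi k x‖ = 1 := Circle.norm_coe _

theorem chi_comm (k x : Space d) : chi k x = chi x k := by rw [chi, chi, real_inner_comm]

theorem chi_add_right (k x y : Space d) : chi k (x + y) = chi k x * chi k y := by
  simp [chi, inner_add_right, AddChar.map_add_eq_mul]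

theorem chi_add_left (k l x : Space d) : chi (k + l) x = chi k x * chi l x := by
  rw [chi_comm, chi_add_right, chi_comm x, chi_comm x]

theorem chi_zero_right (k : Space d) : chi k 0 = 1 := by simp [chi]

theorem chi_neg_left (k x : Space d) : chi (-k) x = conj (chi k x) := by
  simp [chi, inner_neg_left, AddChar.map_neg_eq_inv]

theorem chi_neg_right (k x : Space d) : chi k (-x) = conj (chi k x) := by
  rw [chi_comm, chi_neg_left, chi_comm]

theorem chi_neg_mul (k x : Space d) : chi (-k) x * chi k x = 1 := by
  rw [← chi_add_left, neg_add_cancel, chi_comm, chi_zero_right]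

theorem fourier_eq_integral_chi (f : Space d → ℂ) (w : Space d) :
    𝓕 f w = ∫ v, chi (-v) w * f v := by
  rw [Real.fourier_eq]
  simp only [chi, inner_neg_left, Circle.smul_def, smul_eq_mul]

theorem fourierInv_eq_integral_chi (f : Space d → ℂ) (w : Space d) :
    𝓕⁻ f w = ∫ v, chi v w * f v := by
  rw [Real.fourierInv_eq]
  simp only [chi, Circle.smul_def, smul_eq_mul]

end Characters

/-! ### Measures with densities -/

section Density

open ENNReal

variable {α : Type*} [MeasurableSpace α] {μ : Measure α}

theorem integral_withDensity_ofReal {f : α → ℝ} (hf : Measurable f) (h0 : ∀ x, 0 ≤ f x)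
    (g : α → ℂ) :
    ∫ x, g x ∂μ.withDensity (fun x => ENNReal.ofReal (f x)) = ∫ x, (f x : ℂ) * g x ∂μ := by
  refine (integral_withDensity_eq_integral_smul hf.real_toNNReal g).trans ?_
  refine integral_congr_ae (ae_of_all _ fun x => ?_)
  simp [NNReal.smul_def, h0 x]

theorem integrable_withDensity_ofReal_iff {f : α → ℝ} (hf : Measurable f) (h0 : ∀ x, 0 ≤ f x)
    (g : α → ℂ) :
    Integrable g (μ.withDensity fun x => ENNReal.ofReal (f x)) ↔
      Integrable (fun x => (f x : ℂ) * g x) μ := by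
  refine (integrable_withDensity_iff_integrable_smul hf.real_toNNReal).trans ?_
  refine integrable_congr (ae_of_all _ fun x => ?_)
  simp [NNReal.smul_def, h0 x]

end Density

/-! ### The Bochner-Schwartz theorem for translation bounded measures -/

section BochnerSchwartz

open ENNReal

variable {d : ℕ} {ι : Type*} [Fintype ι]

/-- The linear combination of the functionals given by finitely many measures. -/
def combination (c : ι → ℝ) (τ : ι → Measure (Space d)) (φ : Space d → ℂ) : ℂ :=
  ∑ i, (c i : ℂ) * ∫ x, φ x ∂τ i

theorem norm_combination_le {c : ι → ℝ} {τ : ι → Measure (Space d)} {ρ : ℝ} (hρ : 0 < ρ)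
    {M : ι → ℝ≥0∞} (hM : ∀ i, M i ≠ ⊤) (hτ : ∀ i, TranslationBounded (τ i) ρ (M i))
    {φ : Space d → ℂ} {A : ℝ} (hA : 0 ≤ A) (hφ : ∀ x, ‖φ x‖ ≤ A * decayWeight (d + 1) x) :
    ‖combination c τ φ‖ ≤ A * ∑ i, |c i| * (M i * weightConst d ρ (d + 1)).toReal := by
  refine (norm_sum_le _ _).trans ?_
  rw [Finset.mul_sum]
  refine Finset.sum_le_sum fun i _ => ?_
  rw [norm_mul, Complex.norm_real, Real.norm_eq_abs, mul_left_comm]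
  gcongr
  exact (norm_integral_le_integral_norm _).trans
    ((hτ i).integral_norm_le hρ (hM i) (Nat.lt_succ_self d) hA hφ)

theorem integral_mul_combination {c : ι → ℝ} {τ : ι → Measure (Space d)} {ρ : ℝ} (hρ : 0 < ρ)
    {M : ι → ℝ≥0∞} (hM : ∀ i, M i ≠ ⊤) (hτ : ∀ i, TranslationBounded (τ i) ρ (M i))
    {g : Space d → ℂ} (hg : Continuous g) {A : ℝ} (hA : ∀ x, ‖g x‖ ≤ A * decayWeight (d + 1) x)
    {φ : Space d → ℂ} (hφ : Integrable φ) :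
    Integrable (fun k => φ k * combination c τ fun x => chi (-k) x * g x) ∧
    ∫ k, φ k * combination c τ (fun x => chi (-k) x * g x) =
      combination c τ fun x => 𝓕 φ x * g x := by
  have hlf : ∀ i, IsLocallyFiniteMeasure (τ i) := fun i => (hτ i).isLocallyFinite hρ (hM i)
  have hgi : ∀ i, Integrable g (τ i) := fun i =>
    (hτ i).integrable_of_le hρ (hM i) (Nat.lt_succ_self d) hg.aestronglyMeasurable hA
  have hchi : Continuous fun p : Space d × Space d => chi (-p.1) p.2 :=
    continuous_chi_neg_uncurry
  have hprod : ∀ i, Integrable (fun p : Space d × Space d => chi (-p.1) p.2 * (φ p.1 * g p.2))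
      (volume.prod (τ i)) := fun i => by
    refine (hφ.mul_prod (hgi i)).bdd_mul (c := 1) hchi.aestronglyMeasurable
      (ae_of_all _ fun p => (norm_chi _ _).le)
  have hterm : ∀ k i, φ k * ∫ x, chi (-k) x * g x ∂τ i =
      ∫ x, chi (-k) x * (φ k * g x) ∂τ i := fun k i => by
    rw [← integral_const_mul]
    congr 1
    ext x
    ring
  have hcomb : ∀ k, φ k * combination c τ (fun x => chi (-k) x * g x) =
      ∑ i, (c i : ℂ) * ∫ x, chi (-k) x * (φ k * g x) ∂τ i := fun k => by
    rw [combination, Finset.mul_sum]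
    refine Finset.sum_congr rfl fun i _ => ?_
    rw [← hterm]
    ring
  simp_rw [hcomb]
  have hint : ∀ i, Integrable fun k => (c i : ℂ) * ∫ x, chi (-k) x * (φ k * g x) ∂τ i := fun i =>
    (hprod i).integral_prod_left.const_mul _
  refine ⟨integrable_finsetSum _ fun i _ => hint i, ?_⟩
  rw [integral_finsetSum _ fun i _ => hint i, combination]
  refine Finset.sum_congr rfl fun i _ => ?_
  rw [integral_const_mul, integral_integral_swap (hprod i)]
  congr 1
  refine integral_congr_ae (ae_of_all _ fun x => ?_)
  simp only [fourier_eq_integral_chi]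
  rw [← integral_mul_const]
  congr 1
  ext k
  ring

/-- The measure with density `k ↦ L (x ↦ exp(-2πi k·x) g x)`, where `L` is the functional of a
linear combination of measures. -/
def densityMeasure (c : ι → ℝ) (τ : ι → Measure (Space d)) (g : Space d → ℂ) :
    Measure (Space d) :=
  volume.withDensity fun k =>
    ENNReal.ofReal (combination c τ fun x => chi (-k) x * g x).re

theorem measurable_combination_chi {c : ι → ℝ} {τ : ι → Measure (Space d)} [∀ i, SFinite (τ i)]
    {g : Space d → ℂ} (hg : Continuous g) :
    Measurable fun k => combination c τ fun x => chi (-k) x * g x := by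
  refine Finset.measurable_sum _ fun i _ => Measurable.const_mul ?_ _
  have hchi : Continuous fun p : Space d × Space d => chi (-p.1) p.2 * g p.2 :=
    continuous_chi_neg_uncurry.mul (hg.comp continuous_snd)
  exact (hchi.stronglyMeasurable.integral_prod_right').measurable

/-- By `hpos` neither the real part nor `ENNReal.ofReal` in the density loses anything, and the
formula is then Fubini's theorem. -/
theorem integral_densityMeasure {c : ι → ℝ} {τ : ι → Measure (Space d)} {ρ : ℝ} (hρ : 0 < ρ)
    {M : ι → ℝ≥0∞} (hM : ∀ i, M i ≠ ⊤) (hτ : ∀ i, TranslationBounded (τ i) ρ (M i))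
    {g : Space d → ℂ} (hg : Continuous g) {A : ℝ} (hA : ∀ x, ‖g x‖ ≤ A * decayWeight (d + 1) x)
    (hpos : ∀ k, ∃ s : ℝ, 0 ≤ s ∧ combination c τ (fun x => chi (-k) x * g x) = s)
    {φ : Space d → ℂ} (hφ : Integrable φ) :
    Integrable φ (densityMeasure c τ g) ∧
    ∫ k, φ k ∂densityMeasure c τ g = combination c τ fun x => 𝓕 φ x * g x := by
  have hlf : ∀ i, IsLocallyFiniteMeasure (τ i) := fun i => (hτ i).isLocallyFinite hρ (hM i)
  have hre : ∀ k, ((combination c τ fun x => chi (-k) x * g x).re : ℂ) =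
      combination c τ fun x => chi (-k) x * g x := fun k => by
    obtain ⟨s, _, h⟩ := hpos k
    rw [h, Complex.ofReal_re]
  have h0 : ∀ k, 0 ≤ (combination c τ fun x => chi (-k) x * g x).re := fun k => by
    obtain ⟨s, hs, h⟩ := hpos k
    rw [h]
    exact hs
  have hm : Measurable fun k => (combination c τ fun x => chi (-k) x * g x).re :=
    Complex.measurable_re.comp (measurable_combination_chi hg)
  obtain ⟨h1, h2⟩ := integral_mul_combination (c := c) hρ hM hτ hg hA hφ
  constructor
  · rw [densityMeasure, integrable_withDensity_ofReal_iff hm h0]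
    refine h1.congr (ae_of_all _ fun k => ?_)
    beta_reduce
    rw [hre, mul_comm]
  · rw [densityMeasure, integral_withDensity_ofReal hm h0, ← h2]
    refine integral_congr_ae (ae_of_all _ fun k => ?_)
    beta_reduce
    rw [hre, mul_comm]

theorem norm_fourier_compSub (f : Space d → ℂ) (a w : Space d) :
    ‖𝓕 (fun x => f (x - a)) w‖ = ‖𝓕 f w‖ := by
  rw [fourier_eq_integral_chi, fourier_eq_integral_chi,
    ← integral_add_right_eq_self (μ := volume) _ a]
  simp_rw [add_sub_cancel_right, neg_add, chi_add_left, mul_right_comm _ (chi (-a) w)]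
  rw [integral_mul_const, norm_mul, norm_chi, mul_one]

/-- Testing against a smooth bump that is `1` on the unit ball around `a` bounds the mass of that
ball. Moving the bump does not change the modulus of its Fourier transform. The constant comes from
the bump alone and is quantified first, so that the bound is uniform along a sequence of factors
`g`. -/
theorem translationBounded_densityMeasure (d : ℕ) : ∃ A : ℝ, 0 ≤ A ∧
    ∀ {ι : Type*} [Fintype ι] {c : ι → ℝ} {τ : ι → Measure (Space d)} {ρ : ℝ} (_ : 0 < ρ)
    {M : ι → ℝ≥0∞} (_ : ∀ i, M i ≠ ⊤) (_ : ∀ i, TranslationBounded (τ i) ρ (M i))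
    {g : Space d → ℂ} (_ : Continuous g) (_ : ∀ x, ‖g x‖ ≤ 1)
    (_ : ∃ A, ∀ x, ‖g x‖ ≤ A * decayWeight (d + 1) x)
    (_ : ∀ k, ∃ s : ℝ, 0 ≤ s ∧ combination c τ (fun x => chi (-k) x * g x) = s),
    TranslationBounded (densityMeasure c τ g) 1
      (ENNReal.ofReal (A * ∑ i, |c i| * (M i * weightConst d ρ (d + 1)).toReal)) := by
  let b : ContDiffBump (0 : Space d) := ⟨1, 2, one_pos, one_lt_two⟩
  have hbs : HasCompactSupport fun x : Space d => (b x : ℂ) :=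
    b.hasCompactSupport.comp_left (g := Complex.ofReal) Complex.ofReal_zero
  have hbc : ContDiff ℝ ((⊤ : ℕ∞) : WithTop ℕ∞) fun x : Space d => (b x : ℂ) :=
    Complex.ofRealCLM.contDiff.comp b.contDiff
  let f : 𝓢(Space d, ℂ) := hbs.toSchwartzMap hbc
  have hf : ∀ x, f x = (b x : ℂ) := fun x => rfl
  obtain ⟨A, hA0, hA⟩ := (𝓕 f : 𝓢(Space d, ℂ)).exists_norm_le_decayWeight (d + 1)
  refine ⟨A, hA0, fun {ι} _ {c τ ρ} hρ {M} hM hτ {g} hg hg1 hgA hpos a => ?_⟩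
  obtain ⟨B, hB⟩ := hgA
  have hfi : Integrable fun x => f (x - a) := f.integrable.comp_sub_right a
  obtain ⟨h1, h2⟩ := integral_densityMeasure hρ hM hτ hg hB hpos hfi
  set ω := densityMeasure c τ g with hω
  have hreal : ∫ x, f (x - a) ∂ω = ((∫ x, b (x - a) ∂ω : ℝ) : ℂ) := by
    exact integral_complex_ofReal (f := fun x => b (x - a))
  have hb1 : Integrable (fun x => b (x - a)) ω := by
    simpa [hf] using h1.re
  calc ω (Metric.ball a 1) = ∫⁻ x, (Metric.ball a 1).indicator 1 x ∂ω :=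
        (lintegral_indicator_one measurableSet_ball).symm
    _ ≤ ∫⁻ x, ENNReal.ofReal (b (x - a)) ∂ω := by
        refine lintegral_mono fun x => ?_
        by_cases hx : x ∈ Metric.ball a 1
        · have : x - a ∈ Metric.closedBall (0 : Space d) b.rIn := by
            rw [mem_closedBall_zero_iff, ← dist_eq_norm]
            exact (Metric.mem_ball.1 hx).le
          rw [b.one_of_mem_closedBall this]
          simp [hx]
        · simp [hx]
    _ = ENNReal.ofReal (∫ x, b (x - a) ∂ω) :=
        (ofReal_integral_eq_lintegral_ofReal hb1 (ae_of_all _ fun x => b.nonneg)).symm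
    _ ≤ _ := by
        refine ENNReal.ofReal_le_ofReal ?_
        have hnn : 0 ≤ ∫ x, b (x - a) ∂ω := integral_nonneg fun x => b.nonneg
        rw [← Real.norm_of_nonneg hnn, ← Complex.norm_real, ← hreal, h2]
        refine norm_combination_le hρ hM hτ hA0 fun x => ?_
        rw [norm_mul, norm_fourier_compSub]
        exact (mul_le_of_le_one_right (norm_nonneg _) (hg1 x)).trans (hA x)

theorem tendsto_combination_mul {c : ι → ℝ} {τ : ι → Measure (Space d)} {ρ : ℝ} (hρ : 0 < ρ)
    {M : ι → ℝ≥0∞} (hM : ∀ i, M i ≠ ⊤) (hτ : ∀ i, TranslationBounded (τ i) ρ (M i))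
    {g : ℕ → Space d → ℂ} (hg : ∀ n, Continuous (g n)) (hg1 : ∀ n x, ‖g n x‖ ≤ 1)
    (hlim : ∀ x, Tendsto (fun n => g n x) atTop (𝓝 1)) {φ : Space d → ℂ} (hφ : Continuous φ)
    {A : ℝ} (hA : ∀ x, ‖φ x‖ ≤ A * decayWeight (d + 1) x) :
    Tendsto (fun n => combination c τ fun x => φ x * g n x) atTop (𝓝 (combination c τ φ)) := by
  refine tendsto_finsetSum _ fun i _ => Tendsto.const_mul _ ?_
  have hi : Integrable φ (τ i) :=
    (hτ i).integrable_of_le hρ (hM i) (Nat.lt_succ_self d) hφ.aestronglyMeasurable hA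
  refine tendsto_integral_of_dominated_convergence (fun x => ‖φ x‖)
    (fun n => (hφ.mul (hg n)).aestronglyMeasurable) hi.norm (fun n => ae_of_all _ fun x => ?_)
    (ae_of_all _ fun x => ?_)
  · rw [norm_mul]
    exact mul_le_of_le_one_right (norm_nonneg _) (hg1 n x)
  · simpa using (hlim x).const_mul (φ x)

/-- One spare power of decay is worth `(1 + j)⁻¹` outside the ball of radius `j`; this is the
tightness needed for compactness. -/
theorem lintegral_decayWeight_compl_le {ω : Measure (Space d)} {M : ℝ≥0∞} (hM : M ≠ ⊤)
    (h : TranslationBounded ω 1 M) (j : ℕ) :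
    ∫⁻ x in (Metric.closedBall 0 (j : ℝ))ᶜ, ENNReal.ofReal (decayWeight (d + 2) x) ∂ω ≤
      ENNReal.ofReal ((1 + j : ℝ)⁻¹) * (M * weightConst d 1 (d + 1)) := by
  calc _ ≤ ∫⁻ x in (Metric.closedBall 0 (j : ℝ))ᶜ,
        ENNReal.ofReal ((1 + j : ℝ)⁻¹) * ENNReal.ofReal (decayWeight (d + 1) x) ∂ω := by
        refine setLIntegral_mono' Metric.isClosed_closedBall.measurableSet.compl fun x hx => ?_
        rw [← ENNReal.ofReal_mul (by positivity)]
        refine ENNReal.ofReal_le_ofReal ?_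
        have hx' : (j : ℝ) < ‖x‖ := by simpa using hx
        rw [← decayWeight_succ_mul (d + 1) x, inv_mul_eq_div, le_div_iff₀ (by positivity), mul_comm]
        have := (decayWeight_pos (d + 2) x).le
        gcongr
    _ ≤ ∫⁻ x, ENNReal.ofReal ((1 + j : ℝ)⁻¹) * ENNReal.ofReal (decayWeight (d + 1) x) ∂ω :=
        setLIntegral_le_lintegral _ _
    _ = ENNReal.ofReal ((1 + j : ℝ)⁻¹) * ∫⁻ x, ENNReal.ofReal (decayWeight (d + 1) x) ∂ω :=
        lintegral_const_mul _ (continuous_decayWeight _).measurable.ennreal_ofReal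
    _ ≤ _ := by
        gcongr
        exact h.lintegral_decayWeight_le one_pos hM _

/-- Vague compactness of translation bounded measures, tested against Schwartz functions. -/
theorem exists_ultrafilter_limit {M : ℝ≥0∞} (hM : M ≠ ⊤) {ω : ℕ → Measure (Space d)}
    (hω : ∀ n, TranslationBounded (ω n) 1 M) :
    ∃ (U : Ultrafilter ℕ) (ω' : Measure (Space d)), (U : Filter ℕ) ≤ atTop ∧
      Integrable (decayWeight (d + 2) : Space d → ℝ) ω' ∧ ∀ φ : 𝓢(Space d, ℂ),
        Integrable φ ω' ∧ Tendsto (fun n => ∫ x, φ x ∂ω n) U (𝓝 (∫ x, φ x ∂ω')) := by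
  have hWm : Measurable (decayWeight (d + 2) : Space d → ℝ) := (continuous_decayWeight _).measurable
  have hW0 : ∀ x : Space d, 0 ≤ decayWeight (d + 2) x := fun x => (decayWeight_pos _ x).le
  set C : ℝ≥0∞ := M * weightConst d 1 (d + 2) with hC
  have hCt : C ≠ ⊤ := (ENNReal.mul_lt_top hM.lt_top (weightConst_lt_top one_pos (by omega))).ne
  set C' : ℝ≥0∞ := M * weightConst d 1 (d + 1) with hC'
  have hCt' : C' ≠ ⊤ := (ENNReal.mul_lt_top hM.lt_top (weightConst_lt_top one_pos (by omega))).ne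
  -- Weighting by `decayWeight (d + 2)` turns the translation bounded measures into finite ones of
  -- bounded mass that are uniformly tight, hence relatively compact.
  let ν' : ℕ → Measure (Space d) := fun n =>
    (ω n).withDensity fun x => ENNReal.ofReal (decayWeight (d + 2) x)
  have hmass : ∀ n, ν' n Set.univ ≤ C := fun n => by
    simp only [ν']
    rw [withDensity_apply _ MeasurableSet.univ, Measure.restrict_univ]
    exact (hω n).lintegral_decayWeight_le one_pos hM _
  have hfin : ∀ n, IsFiniteMeasure (ν' n) := fun n => ⟨(hmass n).trans_lt hCt.lt_top⟩
  let ν : ℕ → FiniteMeasure (Space d) := fun n => ⟨ν' n, hfin n⟩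
  let u : ℕ → NNReal := fun j => Real.toNNReal ((1 + j : ℝ)⁻¹ * C'.toReal)
  have hu : Tendsto u atTop (𝓝 0) := by
    have h1 : Tendsto (fun j : ℕ => (1 + j : ℝ)⁻¹ * C'.toReal) atTop (𝓝 (0 * C'.toReal)) := by
      refine Tendsto.mul_const _ ((tendsto_one_div_add_atTop_nhds_zero_nat (𝕜 := ℝ)).congr
        fun j => ?_)
      rw [one_div, add_comm]
    have h2 := (continuous_real_toNNReal.tendsto _).comp h1
    rw [zero_mul, Real.toNNReal_zero] at h2
    exact h2
  have hcompact := isCompact_setOfPred_finiteMeasure_mass_le_compl_isCompact_le (E := Space d)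
    (u := u) (K := fun j : ℕ => Metric.closedBall 0 (j : ℝ)) C.toNNReal hu
    (fun j => isCompact_closedBall _ _) (Or.inr fun i j h =>
      Metric.closedBall_subset_closedBall (by exact_mod_cast h))
  have hmem : ∀ n, ν n ∈ {μ : FiniteMeasure (Space d) | μ.mass ≤ C.toNNReal ∧
      ∀ j : ℕ, μ (Metric.closedBall 0 (j : ℝ))ᶜ ≤ u j} := fun n => by
    refine ⟨?_, fun j => ?_⟩
    · rw [← ENNReal.coe_le_coe, FiniteMeasure.ennreal_mass, ENNReal.coe_toNNReal hCt]
      exact hmass n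
    · rw [← ENNReal.coe_le_coe, FiniteMeasure.ennreal_coeFn_eq_coeFn_toMeasure]
      change ν' n _ ≤ _
      simp only [ν', u]
      rw [withDensity_apply _ Metric.isClosed_closedBall.measurableSet.compl]
      refine (lintegral_decayWeight_compl_le hM (hω n) j).trans (le_of_eq ?_)
      change _ = ENNReal.ofReal ((1 + j : ℝ)⁻¹ * C'.toReal)
      rw [ENNReal.ofReal_mul (by positivity), ENNReal.ofReal_toReal hCt']
  -- A limit along an ultrafilter avoids extracting a subsequence and is enough to identify the
  -- limit of a convergent sequence of integrals.
  let U : Ultrafilter ℕ := Ultrafilter.of atTop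
  obtain ⟨ν₀, -, hν₀⟩ := hcompact.ultrafilter_le_nhds (U.map ν)
    (le_principal_iff.2 (Ultrafilter.mem_map.2 (Filter.univ_mem' hmem)))
  have htend : Tendsto ν U (𝓝 ν₀) := hν₀
  rw [FiniteMeasure.tendsto_iff_forall_integral_rclike_tendsto ℂ] at htend
  have hWi : ∀ x : Space d, ENNReal.ofReal (decayWeight (d + 2) x) ≠ 0 := fun x =>
    (ENNReal.ofReal_pos.2 (decayWeight_pos _ x)).ne'
  have hIm : Measurable fun x : Space d => (decayWeight (d + 2) x)⁻¹ := hWm.inv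
  have hI0 : ∀ x : Space d, 0 ≤ (decayWeight (d + 2) x)⁻¹ := fun x => inv_nonneg.2 (hW0 x)
  -- The weight is removed again from the limit. A Schwartz function divided by the weight is
  -- bounded and continuous, so it is an admissible test function for weak convergence.
  refine ⟨U, (ν₀ : Measure (Space d)).withDensity
    fun x => ENNReal.ofReal (decayWeight (d + 2) x)⁻¹, Ultrafilter.of_le _, ?_, fun φ => ?_⟩
  · have h1 : Integrable (fun x : Space d => (decayWeight (d + 2) x : ℂ))
        ((ν₀ : Measure (Space d)).withDensity
          fun x => ENNReal.ofReal (decayWeight (d + 2) x)⁻¹) := by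
      refine (integrable_withDensity_ofReal_iff hIm hI0 _).2 ((integrable_const (1 : ℂ)).congr
        (ae_of_all _ fun x => ?_))
      beta_reduce
      rw [← Complex.ofReal_mul, inv_mul_cancel₀ (decayWeight_pos (d + 2) x).ne',
        Complex.ofReal_one]
    simpa using h1.re
  · obtain ⟨A, hA0, hA⟩ := φ.exists_norm_le_decayWeight (d + 2)
    have hψc : Continuous fun x => ((decayWeight (d + 2) x)⁻¹ : ℝ) * φ x := by
      have : Continuous fun x : Space d => (decayWeight (d + 2) x)⁻¹ :=
        (continuous_decayWeight _).inv₀ fun x => (decayWeight_pos _ x).ne'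
      have := φ.continuous
      fun_prop
    let ψ : BoundedContinuousFunction (Space d) ℂ :=
      BoundedContinuousFunction.ofNormedAddCommGroup
        (fun x => ((decayWeight (d + 2) x)⁻¹ : ℝ) * φ x) hψc A fun x => by
          rw [norm_mul, Complex.norm_real, Real.norm_of_nonneg (hI0 x),
            inv_mul_le_iff₀ (decayWeight_pos _ x), mul_comm]
          exact hA x
    refine ⟨(integrable_withDensity_ofReal_iff hIm hI0 _).2 (ψ.integrable _), ?_⟩
    rw [integral_withDensity_ofReal hIm hI0]
    refine (htend ψ).congr fun n => ?_
    change ∫ x, ψ x ∂ν' n = _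
    rw [integral_withDensity_ofReal hWm hW0]
    refine integral_congr_ae (ae_of_all _ fun x => ?_)
    change (decayWeight (d + 2) x : ℂ) * (((decayWeight (d + 2) x)⁻¹ : ℝ) * φ x) = φ x
    rw [← mul_assoc, ← Complex.ofReal_mul, mul_inv_cancel₀ (decayWeight_pos _ x).ne',
      Complex.ofReal_one, one_mul]

/-- The factors `g n` make the functional integrable against characters, so its Fourier transform is
a positive density. The bound `‖g n‖ ≤ 1` keeps these measures uniformly translation bounded. In a
vague limit the right sides tend to the unregularised functional, because `g n → 1`. -/
theorem exists_fourierTransform_combination {c : ι → ℝ} {τ : ι → Measure (Space d)} {ρ : ℝ}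
    (hρ : 0 < ρ) {M : ι → ℝ≥0∞} (hM : ∀ i, M i ≠ ⊤)
    (hτ : ∀ i, TranslationBounded (τ i) ρ (M i))
    {g : ℕ → Space d → ℂ} (hg : ∀ n, Continuous (g n)) (hg1 : ∀ n x, ‖g n x‖ ≤ 1)
    (hlim : ∀ x, Tendsto (fun n => g n x) atTop (𝓝 1))
    (hgA : ∀ n, ∃ A, ∀ x, ‖g n x‖ ≤ A * decayWeight (d + 1) x)
    (hpos : ∀ n k, ∃ s : ℝ, 0 ≤ s ∧ combination c τ (fun x => chi (-k) x * g n x) = s) :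
    ∃ ω : Measure (Space d), Integrable (decayWeight (d + 2) : Space d → ℝ) ω ∧
      IsFourierTransform (combination c τ) ω := by
  obtain ⟨A, -, hA⟩ := translationBounded_densityMeasure d
  obtain ⟨U, ω, hU, hω, h⟩ := exists_ultrafilter_limit ENNReal.ofReal_ne_top
    fun n => hA hρ hM hτ (hg n) (hg1 n) (hgA n) (hpos n)
  refine ⟨ω, hω, fun φ => ⟨(h φ).1, ?_⟩⟩
  obtain ⟨B, -, hB⟩ := (𝓕 φ : 𝓢(Space d, ℂ)).exists_norm_le_decayWeight (d + 1)
  have h1 := (tendsto_combination_mul (c := c) hρ hM hτ hg hg1 hlim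
    (𝓕 φ : 𝓢(Space d, ℂ)).continuous hB).mono_left hU
  refine tendsto_nhds_unique (h φ).2 (h1.congr fun n => ?_)
  obtain ⟨B', hB'⟩ := hgA n
  exact (integral_densityMeasure hρ hM hτ (hg n) hB' (hpos n) φ.integrable).2.symm

end BochnerSchwartz

/-! ### The Palm measures -/

section Palm

open ProbabilityTheory

variable {d m : ℕ} {r : ℝ} {μ : Measure (Config d m r)}

theorem continuous_integral_colour_bound [Fact (0 < r)] {f : Space d → ℂ} {A : ℝ} (hA : 0 ≤ A)
    (hf : ∀ x, ‖f x‖ ≤ A * decayWeight (d + 1) x) (i : Fin m) (lam : Config d m r) :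
    ‖∫ x, f x ∂colour i lam‖ ≤ A * (1 * weightConst d (r / 2) (d + 1)).toReal :=
  (norm_integral_le_integral_norm _).trans
    ((translationBounded_colour i lam).integral_norm_le half_pos_of_fact ENNReal.one_ne_top
      (Nat.lt_succ_self d) hA hf)

theorem measurable_integral_colour {f : Space d → ℂ} (hf : Measurable f) (i : Fin m) :
    Measurable fun lam : Config d m r => ∫ x, f x ∂colour i lam :=
  (hf.stronglyMeasurable.integral_kernel (κ := colourKernel i)).measurable

theorem integrable_compProd_of_le [Fact (0 < r)] [IsFiniteMeasure μ] (j : Fin m)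
    {h : Config d m r × Space d → ℂ} (hm : Measurable h) {B : ℝ} (hB : 0 ≤ B)
    (hle : ∀ p, ‖h p‖ ≤ B * decayWeight (d + 1) p.2) :
    Integrable h (μ ⊗ₘ colourKernel j) := by
  refine ⟨hm.aestronglyMeasurable, ?_⟩
  rw [hasFiniteIntegral_iff_enorm]
  rw [Measure.lintegral_compProd hm.enorm]
  calc ∫⁻ lam, ∫⁻ x, ‖h (lam, x)‖ₑ ∂colourKernel j lam ∂μ
      ≤ ∫⁻ lam, ENNReal.ofReal B * (1 * weightConst d (r / 2) (d + 1)) ∂μ := by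
        refine lintegral_mono fun lam => ?_
        calc ∫⁻ x, ‖h (lam, x)‖ₑ ∂colourKernel j lam
            ≤ ∫⁻ x, ENNReal.ofReal B * ENNReal.ofReal (decayWeight (d + 1) x)
                ∂colourKernel j lam := by
              refine lintegral_mono fun x => ?_
              rw [← ofReal_norm, ← ENNReal.ofReal_mul hB]
              exact ENNReal.ofReal_le_ofReal (hle (lam, x))
          _ = ENNReal.ofReal B * ∫⁻ x, ENNReal.ofReal (decayWeight (d + 1) x)
                ∂colour j lam :=
              lintegral_const_mul _ (continuous_decayWeight _).measurable.ennreal_ofReal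
          _ ≤ _ := by
              gcongr
              exact (translationBounded_colour j lam).lintegral_decayWeight_le half_pos_of_fact
                ENNReal.one_ne_top _
    _ = ENNReal.ofReal B * (1 * weightConst d (r / 2) (d + 1)) * μ Set.univ :=
        lintegral_const _
    _ < ⊤ := by
        refine ENNReal.mul_lt_top (ENNReal.mul_lt_top ENNReal.ofReal_lt_top
          (ENNReal.mul_lt_top ENNReal.one_lt_top ?_)) (measure_lt_top _ _)
        exact weightConst_lt_top half_pos_of_fact (Nat.lt_succ_self d)

theorem measurableSet_marked [Fact (0 < r)] {B : Set (Space d)} (hB : MeasurableSet B)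
    {D : Set (Config d m r)} (hD : MeasurableSet D) :
    MeasurableSet {p : Config d m r × Space d | p.2 ∈ B ∧ -p.2 +ᵥ p.1 ∈ D} :=
  (measurable_snd hB).inter (measurable_neg_vadd hD)

theorem measurable_palm_integrand [Fact (0 < r)] (i : Fin m) :
    Measurable fun lam : Config d m r =>
      ((colour i lam).restrict (cube d 1)).map fun x : Space d => (-x) +ᵥ lam := by
  refine Measure.measurable_of_measurable_coe _ fun D hD => ?_
  have h := Kernel.measurable_kernel_prodMk_left (κ := colourKernel i)
    (measurableSet_marked (d := d) (m := m) (r := r) (measurableSet_cube 1) hD)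
  convert h using 1
  funext lam
  have hm : Measurable fun x : Space d => (-x) +ᵥ lam :=
    measurable_neg_vadd.comp measurable_prodMk_left
  rw [Measure.map_apply hm hD, Measure.restrict_apply (hm hD), Set.inter_comm]
  rfl

theorem palm_apply [Fact (0 < r)] (i : Fin m) {D : Set (Config d m r)} (hD : MeasurableSet D) :
    palm μ i D = ∫⁻ lam, colour i lam {x | x ∈ cube d 1 ∧ -x +ᵥ lam ∈ D} ∂μ := by
  rw [palm, Measure.bind_apply hD (measurable_palm_integrand i).aemeasurable]
  refine lintegral_congr fun lam => ?_
  have hm : Measurable fun x : Space d => (-x) +ᵥ lam :=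
    measurable_neg_vadd.comp measurable_prodMk_left
  rw [Measure.map_apply hm hD, Measure.restrict_apply (hm hD), Set.inter_comm]
  rfl

/-- The expected number of points of colour `i` in a set, seen from which the configuration lies
in `D`. -/
def markedIntensity (μ : Measure (Config d m r)) (i : Fin m) (D : Set (Config d m r)) :
    Measure (Space d) :=
  ((μ ⊗ₘ colourKernel i).restrict {p | -p.2 +ᵥ p.1 ∈ D}).map Prod.snd

theorem markedIntensity_apply [Fact (0 < r)] [SFinite μ] (i : Fin m) {D : Set (Config d m r)}
    (hD : MeasurableSet D) {B : Set (Space d)} (hB : MeasurableSet B) :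
    markedIntensity μ i D B = ∫⁻ lam, colour i lam {x | x ∈ B ∧ -x +ᵥ lam ∈ D} ∂μ := by
  rw [markedIntensity, Measure.map_apply measurable_snd hB,
    Measure.restrict_apply (measurable_snd hB)]
  exact Measure.compProd_apply (measurableSet_marked hB hD)

theorem translationBounded_markedIntensity [Fact (0 < r)] [IsProbabilityMeasure μ] (i : Fin m)
    {D : Set (Config d m r)} (hD : MeasurableSet D) :
    TranslationBounded (markedIntensity μ i D) (r / 2) 1 := by
  intro x
  rw [markedIntensity_apply i hD measurableSet_ball]
  calc _ ≤ ∫⁻ _lam, 1 ∂μ := lintegral_mono fun lam =>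
        (measure_mono fun y hy => hy.1).trans (translationBounded_colour i lam x)
    _ = 1 := by simp

/-- The mark, being the configuration seen from the point, does not change when point and
configuration move together. So invariance of `μ` makes this measure translation invariant, hence a
multiple of Lebesgue measure; the unit cube shows that the factor is the Palm mass. -/
theorem markedIntensity_eq [Fact (0 < r)] [IsProbabilityMeasure μ]
    [VAddInvariantMeasure (Space d) (Config d m r) μ] (i : Fin m)
    {D : Set (Config d m r)} (hD : MeasurableSet D) :
    markedIntensity μ i D = palm μ i D • volume := by
  have hlf : IsLocallyFiniteMeasure (markedIntensity μ i D) :=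
    (translationBounded_markedIntensity i hD).isLocallyFinite half_pos_of_fact ENNReal.one_ne_top
  have hinv : (markedIntensity μ i D).IsAddLeftInvariant := by
    refine ⟨fun t => ?_⟩
    ext B hB
    rw [Measure.map_apply (measurable_const_add t) hB, markedIntensity_apply i hD hB,
      markedIntensity_apply i hD (measurable_const_add t hB)]
    have hm : Measurable fun lam : Config d m r => colour i lam {x | x ∈ B ∧ -x +ᵥ lam ∈ D} :=
      Kernel.measurable_kernel_prodMk_left (κ := colourKernel i) (measurableSet_marked hB hD)
    rw [← (measurePreserving_vadd t μ).lintegral_comp hm]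
    refine lintegral_congr fun lam => ?_
    have hs : MeasurableSet {x | x ∈ B ∧ -x +ᵥ (t +ᵥ lam) ∈ D} :=
      measurable_prodMk_left (measurableSet_marked hB hD)
    rw [colour_vadd, Measure.map_apply (measurable_const_add t) hs]
    congr 1
    ext x
    simp [vadd_vadd]
  have heq := Measure.isAddLeftInvariant_eq_smul (markedIntensity μ i D) volume
  set c := (markedIntensity μ i D).addHaarScalarFactor volume
  have hc : palm μ i D = c := by
    rw [palm_apply i hD, ← markedIntensity_apply i hD (measurableSet_cube 1), heq]
    rw [Measure.smul_apply, volume_cube one_pos, one_pow, ENNReal.ofReal_one, ENNReal.smul_def,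
      smul_eq_mul, mul_one]
  rw [hc, heq]
  rfl

instance [Fact (0 < r)] [IsProbabilityMeasure μ] [VAddInvariantMeasure (Space d) (Config d m r) μ]
    (i : Fin m) : IsFiniteMeasure (palm μ i) := by
  refine ⟨?_⟩
  have hlf : IsLocallyFiniteMeasure (markedIntensity μ i Set.univ) :=
    (translationBounded_markedIntensity i MeasurableSet.univ).isLocallyFinite half_pos_of_fact
      ENNReal.one_ne_top
  have h : markedIntensity μ i Set.univ (cube d 1) < ⊤ :=
    (measure_mono (cube_subset_closedBall zero_le_one)).trans_lt
      (isCompact_closedBall _ _).measure_lt_top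
  rw [markedIntensity_eq i MeasurableSet.univ] at h
  simpa [volume_cube one_pos] using h

/-- Campbell's formula. -/
theorem map_compProd_colourKernel [Fact (0 < r)] [IsProbabilityMeasure μ]
    [VAddInvariantMeasure (Space d) (Config d m r) μ] (i : Fin m) :
    (μ ⊗ₘ colourKernel i).map (fun p : Config d m r × Space d => (p.2, -p.2 +ᵥ p.1)) =
      volume.prod (palm μ i) := by
  refine (Measure.prod_eq fun B D hB hD => ?_).symm
  have hm : Measurable fun p : Config d m r × Space d => (p.2, -p.2 +ᵥ p.1) :=
    measurable_snd.prodMk measurable_neg_vadd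
  rw [Measure.map_apply hm (hB.prod hD), Measure.compProd_apply (hm (hB.prod hD))]
  have h := markedIntensity_apply (μ := μ) i hD hB
  rw [markedIntensity_eq i hD, Measure.smul_apply, smul_eq_mul, mul_comm] at h
  exact h.symm

theorem decayWeight_antitone {k n : ℕ} (h : k ≤ n) (x : Space d) :
    decayWeight n x ≤ decayWeight k x :=
  inv_anti₀ (by positivity) (pow_le_pow_right₀ (by linarith [norm_nonneg x]) h)

/-- Doubling the exponent in `y` pays for the factor `(1 + ‖y‖) ^ n` of Peetre's inequality. -/
theorem decayWeight_mul_le (n : ℕ) (x y : Space d) :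
    decayWeight (n + n) y * decayWeight n (x + y) ≤ decayWeight n y * decayWeight n x := by
  have h := decayWeight_le_mul n (x + y) x
  rw [add_sub_cancel_left] at h
  have h2 : decayWeight (n + n) y * (1 + ‖y‖) ^ n = decayWeight n y := by
    unfold decayWeight
    have : (1 + ‖y‖) ≠ 0 := by positivity
    rw [pow_add]
    field_simp
  calc _ ≤ decayWeight (n + n) y * ((1 + ‖y‖) ^ n * decayWeight n x) := by
        have := (decayWeight_pos (n + n) y).le
        gcongr
    _ = _ := by rw [← mul_assoc, h2]

/-- The correlation `x ↦ ∫ f (x + y) conj (g y) dy`, that is `f * g~`. -/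
def correlation (f g : Space d → ℂ) (x : Space d) : ℂ := ∫ y, f (x + y) * conj (g y)

theorem norm_correlation_integrand_le {f g : Space d → ℂ} {A B : ℝ} (hB0 : 0 ≤ B)
    (hA : ∀ x, ‖f x‖ ≤ A * decayWeight (d + 1) x)
    (hB : ∀ x, ‖g x‖ ≤ B * decayWeight (d + 1 + (d + 1)) x) (hA0 : 0 ≤ A) (x y : Space d) :
    ‖f (x + y) * conj (g y)‖ ≤ (A * decayWeight (d + 1) x) * (B * decayWeight (d + 1) y) := by
  rw [norm_mul, RCLike.norm_conj]
  calc _ ≤ (A * decayWeight (d + 1) (x + y)) * (B * decayWeight (d + 1 + (d + 1)) y) := by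
        gcongr
        · exact mul_nonneg hA0 (decayWeight_pos _ _).le
        · exact hA _
        · exact hB _
    _ = A * B * (decayWeight (d + 1 + (d + 1)) y * decayWeight (d + 1) (x + y)) := by ring
    _ ≤ A * B * (decayWeight (d + 1) y * decayWeight (d + 1) x) := by
        exact mul_le_mul_of_nonneg_left (decayWeight_mul_le _ _ _) (mul_nonneg hA0 hB0)
    _ = _ := by ring

theorem norm_correlation_le {f g : Space d → ℂ} {A B : ℝ} (hA0 : 0 ≤ A) (hB0 : 0 ≤ B)
    (hA : ∀ x, ‖f x‖ ≤ A * decayWeight (d + 1) x)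
    (hB : ∀ x, ‖g x‖ ≤ B * decayWeight (d + 1 + (d + 1)) x) (x : Space d) :
    ‖correlation f g x‖ ≤
      (A * (B * ∫ y : Space d, decayWeight (d + 1) y)) * decayWeight (d + 1) x := by
  refine (norm_integral_le_of_norm_le
    (((integrable_decayWeight (Nat.lt_succ_self d)).const_mul B).const_mul
      (A * decayWeight (d + 1) x))
    (ae_of_all _ (norm_correlation_integrand_le hB0 hA hB hA0 x))).trans (le_of_eq ?_)
  rw [integral_const_mul, integral_const_mul]
  ring

theorem measurable_correlation {f g : Space d → ℂ} (hf : Measurable f) (hg : Measurable g) :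
    Measurable (correlation f g) := by
  have : Measurable fun p : Space d × Space d => f (p.1 + p.2) * conj (g p.2) :=
    (hf.comp measurable_add).mul
      (Complex.continuous_conj.measurable.comp (hg.comp measurable_snd))
  exact (this.stronglyMeasurable.integral_prod_right').measurable

/-- The sum over the points `y` of colour `j` is evaluated by Campbell's formula: seen from `y`, the
other sum becomes `∫ f (x + y)` under the Palm measure, and integrating over `y` first produces the
correlation. The stronger decay of `g` lets the correlation decay like `f`. -/
theorem integral_mul_conj_colour [Fact (0 < r)] [IsProbabilityMeasure μ]
    [VAddInvariantMeasure (Space d) (Config d m r) μ] {f g : Space d → ℂ} (hf : Measurable f)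
    (hg : Measurable g) {A B : ℝ} (hA0 : 0 ≤ A) (hB0 : 0 ≤ B)
    (hA : ∀ x, ‖f x‖ ≤ A * decayWeight (d + 1) x)
    (hB : ∀ x, ‖g x‖ ≤ B * decayWeight (d + 1 + (d + 1)) x) (i j : Fin m) :
    ∫ lam, (∫ x, f x ∂colour i lam) * conj (∫ y, g y ∂colour j lam) ∂μ =
      ∫ lam, ∫ x, correlation f g x ∂colour i lam ∂palm μ j := by
  set K := (1 * weightConst d (r / 2) (d + 1)).toReal
  have hconj : Measurable (conj : ℂ → ℂ) := Complex.continuous_conj.measurable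
  have hB' : ∀ x, ‖g x‖ ≤ B * decayWeight (d + 1) x := fun x => (hB x).trans
    (mul_le_mul_of_nonneg_left (decayWeight_antitone (by omega) x) hB0)
  let H' : Space d × Config d m r → ℂ := fun q =>
    conj (g q.1) * ∫ x, f x ∂colour i (q.1 +ᵥ q.2)
  have hH'm : Measurable H' :=
    (hconj.comp (hg.comp measurable_fst)).mul ((measurable_integral_colour hf i).comp
      measurable_vadd)
  have hH'b : ∀ q, ‖H' q‖ ≤ A * K * B * decayWeight (d + 1) q.1 := fun q => by
    rw [norm_mul, RCLike.norm_conj]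
    calc _ ≤ (B * decayWeight (d + 1) q.1) * (A * K) := by
          gcongr
          · exact mul_nonneg hB0 (decayWeight_pos _ _).le
          · exact hB' _
          · exact continuous_integral_colour_bound hA0 hA i _
      _ = _ := by ring
  have hm : Measurable fun p : Config d m r × Space d => (p.2, -p.2 +ᵥ p.1) :=
    measurable_snd.prodMk measurable_neg_vadd
  have hK : 0 ≤ K := ENNReal.toReal_nonneg
  have hcomp : Integrable (fun p : Config d m r × Space d => H' (p.2, -p.2 +ᵥ p.1))
      (μ ⊗ₘ colourKernel j) :=
    integrable_compProd_of_le j (hH'm.comp hm) (by positivity) fun p => hH'b _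
  have hprod : Integrable H' (volume.prod (palm μ j)) := by
    rw [← map_compProd_colourKernel]
    exact (integrable_map_measure hH'm.aestronglyMeasurable hm.aemeasurable).2 hcomp
  calc ∫ lam, (∫ x, f x ∂colour i lam) * conj (∫ y, g y ∂colour j lam) ∂μ
      = ∫ lam, ∫ y, H' (y, -y +ᵥ lam) ∂colourKernel j lam ∂μ := by
        refine integral_congr_ae (ae_of_all _ fun lam => ?_)
        simp only [H', vadd_neg_vadd]
        rw [integral_mul_const, mul_comm, integral_conj, colourKernel_apply]
    _ = ∫ p, H' (p.2, -p.2 +ᵥ p.1) ∂(μ ⊗ₘ colourKernel j) :=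
        (Measure.integral_compProd hcomp).symm
    _ = ∫ q, H' q ∂(volume.prod (palm μ j)) := by
        rw [← map_compProd_colourKernel, integral_map hm.aemeasurable hH'm.aestronglyMeasurable]
    _ = ∫ lam, (∫ y, H' (y, lam)) ∂palm μ j := integral_prod_symm _ hprod
    _ = _ := by
        refine integral_congr_ae (ae_of_all _ fun lam => ?_)
        simp only [H', integral_colour_vadd]
        have hint : Integrable (fun p : Space d × Space d => f (p.1 + p.2) * conj (g p.2))
            ((colour i lam).prod volume) := by
          have hW := (integrable_decayWeight (Nat.lt_succ_self d)).const_mul B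
          have hW' : Integrable (fun x => A * decayWeight (d + 1) x) (colour i lam) := by
            have h := (integrable_colour (r := r)
              (f := fun x : Space d => (decayWeight (d + 1) x : ℂ))
              (Complex.continuous_ofReal.comp (continuous_decayWeight _)).measurable (A := 1)
              (fun x => by
                rw [Complex.norm_real, Real.norm_of_nonneg (decayWeight_pos _ x).le, one_mul])
              i lam).re
            refine Integrable.const_mul ?_ A
            simpa using h
          refine (hW'.mul_prod hW).mono' ?_ (ae_of_all _ fun p =>
            norm_correlation_integrand_le hB0 hA hB hA0 p.1 p.2)
          exact ((hf.comp measurable_add).mul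
            (hconj.comp (hg.comp measurable_snd))).aestronglyMeasurable
        simp only [correlation]
        rw [integral_integral_swap hint]
        refine integral_congr_ae (ae_of_all _ fun y => ?_)
        beta_reduce
        rw [integral_mul_const, mul_comm]
        simp only [add_comm]

theorem integral_countingFn_mul_conj [Fact (0 < r)] [IsProbabilityMeasure μ]
    [VAddInvariantMeasure (Space d) (Config d m r) μ] (w : Fin m → ℝ) {f g : Space d → ℂ}
    (hf : Measurable f) (hg : Measurable g) {A B : ℝ} (hA0 : 0 ≤ A) (hB0 : 0 ≤ B)
    (hA : ∀ x, ‖f x‖ ≤ A * decayWeight (d + 1) x)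
    (hB : ∀ x, ‖g x‖ ≤ B * decayWeight (d + 1 + (d + 1)) x) :
    ∫ lam, countingFn w f lam * conj (countingFn w g lam) ∂μ =
      palmMoment μ w (correlation f g) := by
  set K := (1 * weightConst d (r / 2) (d + 1)).toReal
  have hB' : ∀ x, ‖g x‖ ≤ B * decayWeight (d + 1) x := fun x => (hB x).trans
    (mul_le_mul_of_nonneg_left (decayWeight_antitone (by omega) x) hB0)
  have hexp : ∀ lam : Config d m r, countingFn w f lam * conj (countingFn w g lam) =
      ∑ j, ∑ i, (w j : ℂ) * ((w i : ℂ) *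
        ((∫ x, f x ∂colour i lam) * conj (∫ y, g y ∂colour j lam))) := fun lam => by
    simp only [countingFn, map_sum, map_mul, Complex.conj_ofReal, Finset.mul_sum, Finset.sum_mul]
    refine Finset.sum_congr rfl fun j _ => Finset.sum_congr rfl fun i _ => ?_
    ring
  have hint : ∀ i j, Integrable (fun lam : Config d m r =>
      (∫ x, f x ∂colour i lam) * conj (∫ y, g y ∂colour j lam)) μ := fun i j => by
    refine Integrable.of_bound ((measurable_integral_colour hf i).mul
      (Complex.continuous_conj.measurable.comp
        (measurable_integral_colour hg j))).aestronglyMeasurable ((A * K) * (B * K))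
      (ae_of_all _ fun lam => ?_)
    rw [norm_mul, RCLike.norm_conj]
    have hK : 0 ≤ K := ENNReal.toReal_nonneg
    gcongr
    · exact continuous_integral_colour_bound hA0 hA i _
    · exact continuous_integral_colour_bound hB0 hB' j _
  have hcm := measurable_correlation hf hg
  have hcb := norm_correlation_le hA0 hB0 hA hB
  have hI : 0 ≤ ∫ y : Space d, decayWeight (d + 1) y :=
    integral_nonneg fun y => (decayWeight_pos _ y).le
  simp_rw [hexp]
  rw [integral_finsetSum _ fun j _ => integrable_finsetSum _ fun i _ =>
    ((hint i j).const_mul _).const_mul _, palmMoment]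
  refine Finset.sum_congr rfl fun j _ => ?_
  rw [integral_finsetSum _ fun i _ => ((hint i j).const_mul _).const_mul _]
  simp only [countingFn]
  rw [integral_finsetSum, Finset.mul_sum]
  · refine Finset.sum_congr rfl fun i _ => ?_
    rw [integral_const_mul, integral_const_mul, integral_const_mul,
      integral_mul_conj_colour hf hg hA0 hB0 hA hB]
  · intro i _
    refine Integrable.const_mul ?_ _
    exact Integrable.of_bound (measurable_integral_colour hcm i).aestronglyMeasurable _
      (ae_of_all _ fun lam => continuous_integral_colour_bound (by positivity) hcb i lam)

/-- The first moment measure of colour `j` under the Palm measure of colour `i`. -/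
def palmIntensity (μ : Measure (Config d m r)) (p : Fin m × Fin m) : Measure (Space d) :=
  (palm μ p.1).bind (colour p.2)

theorem translationBounded_palmIntensity (μ : Measure (Config d m r)) (p : Fin m × Fin m) :
    TranslationBounded (palmIntensity μ p) (r / 2) (palm μ p.1 Set.univ) := by
  intro x
  rw [palmIntensity, Measure.bind_apply measurableSet_ball (measurable_colour _).aemeasurable]
  calc _ ≤ ∫⁻ _lam, 1 ∂palm μ p.1 := lintegral_mono fun lam => translationBounded_colour _ lam x
    _ = _ := by simp

/-- Fubini brings the Palm moment into the form treated by the Bochner-Schwartz argument. The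
products `w i * w j` can be negative, hence a linear combination of translation bounded measures and
not a single one. -/
theorem palmMoment_eq_combination [Fact (0 < r)] [IsProbabilityMeasure μ]
    [VAddInvariantMeasure (Space d) (Config d m r) μ] (w : Fin m → ℝ) {f : Space d → ℂ}
    (hf : Measurable f) {A : ℝ} (hA0 : 0 ≤ A) (hA : ∀ x, ‖f x‖ ≤ A * decayWeight (d + 1) x) :
    palmMoment μ w f =
      combination (fun p : Fin m × Fin m => w p.1 * w p.2) (palmIntensity μ) f := by
  rw [palmMoment, combination, Fintype.sum_prod_type]
  refine Finset.sum_congr rfl fun i _ => ?_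
  simp only [countingFn]
  rw [integral_finsetSum, Finset.mul_sum]
  · refine Finset.sum_congr rfl fun j _ => ?_
    have hi : Integrable f (palmIntensity μ (i, j)) :=
      (translationBounded_palmIntensity μ (i, j)).integrable_of_le half_pos_of_fact
        (measure_ne_top _ _) (Nat.lt_succ_self d) hf.aestronglyMeasurable hA
    have h : ∫ x, f x ∂palmIntensity μ (i, j) = ∫ lam, ∫ x, f x ∂colour j lam ∂palm μ i :=
      Kernel.integral_comp (κ := Kernel.const Unit (palm μ i)) (η := colourKernel j) (a := ()) hi
    rw [h, integral_const_mul]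
    push_cast
    ring
  · intro j _
    refine Integrable.const_mul ?_ _
    exact Integrable.of_bound (measurable_integral_colour hf j).aestronglyMeasurable _
      (ae_of_all _ fun lam => continuous_integral_colour_bound hA0 hA j lam)

end Palm

/-! ### Autocorrelations that approximate the constant function 1 -/

section Approximation

variable {d : ℕ}

theorem continuous_correlation_self {h : Space d → ℝ} (hc : Continuous h)
    (hs : HasCompactSupport h) :
    Continuous (correlation (fun x => (h x : ℂ)) fun x => (h x : ℂ)) := by
  obtain ⟨C, hC⟩ := hs.exists_bound_of_continuous hc
  refine continuous_of_dominated (bound := fun y => C * ‖h y‖) (fun x => ?_)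
    (fun x => ae_of_all _ fun y => ?_) ((hc.integrable_of_hasCompactSupport hs).norm.const_mul C)
    (ae_of_all _ fun y => ?_)
  · exact Continuous.aestronglyMeasurable (by fun_prop)
  · rw [norm_mul, RCLike.norm_conj, Complex.norm_real, Complex.norm_real]
    exact mul_le_mul_of_nonneg_right (hC _) (norm_nonneg _)
  · fun_prop

theorem correlation_ofReal (h : Space d → ℝ) (x : Space d) :
    correlation (fun x => (h x : ℂ)) (fun x => (h x : ℂ)) x = ((∫ y, h (x + y) * h y : ℝ) : ℂ) := by
  rw [← integral_complex_ofReal]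
  simp only [correlation, Complex.conj_ofReal, Complex.ofReal_mul]

/-- Pointwise, `|ab| ≤ (a² + b²) / 2`, and both squares have integral `1`. -/
theorem norm_correlation_self_le_one {h : Space d → ℝ} (hc : Continuous h)
    (hs : HasCompactSupport h) (h1 : ∫ y, h y ^ 2 = 1) (x : Space d) :
    ‖correlation (fun x => (h x : ℂ)) (fun x => (h x : ℂ)) x‖ ≤ 1 := by
  have hi : Integrable fun y => h y ^ 2 := by
    simp_rw [sq]
    exact (hc.mul hc).integrable_of_hasCompactSupport hs.mul_left
  have hi' : Integrable fun y => h (x + y) ^ 2 :=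
    Integrable.comp_add_left (f := fun y => h y ^ 2) hi x
  rw [correlation_ofReal, Complex.norm_real]
  refine (norm_integral_le_of_norm_le ((hi'.add hi).const_mul 2⁻¹)
    (ae_of_all _ fun y => ?_)).trans (le_of_eq ?_)
  · simp only [Pi.add_apply]
    rw [Real.norm_eq_abs, abs_mul, ← sq_abs (h (x + y)), ← sq_abs (h y)]
    nlinarith [sq_nonneg (|h (x + y)| - |h y|)]
  · rw [integral_const_mul, integral_add' hi' hi,
      integral_add_left_eq_self (fun y => h y ^ 2) x, h1]
    norm_num

/-- A character satisfies `χ(x) = χ(x + y) conj(χ(y))`. Modulated autocorrelations are therefore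
autocorrelations again, which is the source of positivity at every frequency `k`. -/
theorem chi_mul_correlation (h : Space d → ℂ) (k x : Space d) :
    chi (-k) x * correlation h h x =
      correlation (fun y => chi (-k) y * h y) (fun y => chi (-k) y * h y) x := by
  simp only [correlation]
  rw [← integral_const_mul]
  refine integral_congr_ae (ae_of_all _ fun y => ?_)
  have h1 : chi (-k) y * conj (chi (-k) y) = 1 := by
    rw [Complex.mul_conj, Complex.normSq_eq_norm_sq, norm_chi]; norm_num
  simp only [map_mul, chi_add_right]
  linear_combination (-(chi (-k) x * h (x + y) * conj (h y))) * h1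

/-- The functions `a^{d/2} h (a ·)` have norm `1` again, and scaled autocorrelations. -/
theorem correlation_scale (h : Space d → ℝ) {a : ℝ} (ha : 0 < a) (x : Space d) :
    correlation (fun x => ((√(a ^ d) * h (a • x) : ℝ) : ℂ))
      (fun x => ((√(a ^ d) * h (a • x) : ℝ) : ℂ)) x =
    correlation (fun x => (h x : ℂ)) (fun x => (h x : ℂ)) (a • x) := by
  rw [correlation_ofReal, correlation_ofReal]
  congr 1
  have := Measure.integral_comp_smul (volume : Measure (Space d))
    (fun y => h (a • x + y) * h y) a
  rw [finrank_euclideanSpace_fin, abs_of_pos (by positivity)] at this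
  calc _ = ∫ y, a ^ d * (h (a • x + a • y) * h (a • y)) := by
        refine integral_congr_ae (ae_of_all _ fun y => ?_)
        have hs : √(a ^ d) * √(a ^ d) = a ^ d := Real.mul_self_sqrt (by positivity)
        simp only [smul_add]
        linear_combination (h (a • x + a • y) * h (a • y)) * hs
    _ = _ := by
        rw [integral_const_mul, this, smul_eq_mul, ← mul_assoc,
          mul_inv_cancel₀ (by positivity), one_mul]

theorem exists_continuous_integral_sq_eq_one (d : ℕ) :
    ∃ h : Space d → ℝ, Continuous h ∧ HasCompactSupport h ∧ ∫ y, h y ^ 2 = 1 := by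
  let b : ContDiffBump (0 : Space d) := ⟨1, 2, one_pos, one_lt_two⟩
  have hbc : Continuous b := b.continuous
  have hs : HasCompactSupport fun x => b x ^ 2 :=
    b.hasCompactSupport.comp_left (g := fun t : ℝ => t ^ 2) (by norm_num)
  have hpos : 0 < ∫ y, b y ^ 2 := by
    refine (hbc.pow 2).integral_pos_of_hasCompactSupport_nonneg_nonzero hs
      (fun x => sq_nonneg _) (x := 0) ?_
    rw [b.one_of_mem_closedBall (by simp [b])]
    norm_num
  refine ⟨fun x => (√(∫ y, b y ^ 2))⁻¹ * b x, by fun_prop,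
    b.hasCompactSupport.mul_left, ?_⟩
  simp_rw [mul_pow]
  rw [integral_const_mul, inv_pow, Real.sq_sqrt hpos.le, inv_mul_cancel₀ hpos.ne']

/-- Stretching `h` by the factor `n + 1` evaluates its autocorrelation at `x / (n + 1)`, which tends
to `0`, where the value is `∫ h² = 1`. -/
theorem exists_correlation_tendsto_one (d : ℕ) :
    ∃ h : ℕ → Space d → ℝ, (∀ n, Continuous (h n)) ∧ (∀ n, HasCompactSupport (h n)) ∧
      (∀ n, ∫ y, h n y ^ 2 = 1) ∧
      ∀ x, Tendsto (fun n => correlation (fun x => (h n x : ℂ)) (fun x => (h n x : ℂ)) x)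
        atTop (𝓝 1) := by
  obtain ⟨h, hc, hs, h1⟩ := exists_continuous_integral_sq_eq_one d
  have ha : ∀ n : ℕ, (0 : ℝ) < 1 / ((n : ℝ) + 1) := fun n => by positivity
  have hself : ∀ g : Space d → ℝ, ∫ y, g y ^ 2 = 1 ↔
      correlation (fun x => (g x : ℂ)) (fun x => (g x : ℂ)) 0 = 1 := fun g => by
    rw [correlation_ofReal]
    simp only [zero_add, ← sq]
    exact_mod_cast Iff.rfl
  refine ⟨fun n x => √((1 / ((n : ℝ) + 1)) ^ d) * h ((1 / ((n : ℝ) + 1)) • x),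
    fun n => by fun_prop, fun n => ?_, fun n => ?_, fun x => ?_⟩
  · exact (hs.comp_smul (ha n).ne').mul_left
  · rw [hself, correlation_scale h (ha n), smul_zero, ← hself, h1]
  · simp_rw [correlation_scale h (ha _)]
    have hlim : Tendsto (fun n : ℕ => (1 / ((n : ℝ) + 1)) • x) atTop (𝓝 ((0 : ℝ) • x)) :=
      tendsto_one_div_add_atTop_nhds_zero_nat.smul_const x
    rw [zero_smul] at hlim
    rw [← (hself h).1 h1]
    exact ((continuous_correlation_self hc hs).tendsto 0).comp hlim

end Approximation

/-! ### The Fourier transform of the Palm moment -/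

section PalmFourier

variable {d m : ℕ} {r : ℝ} {μ : Measure (Config d m r)}

/-- The positivity required by Bochner-Schwartz holds because the density at `k` is the second
moment `∫ |N|² dμ` of the counting function of `χ_{-k} h_n`. -/
theorem exists_fourierTransform_palmMoment [Fact (0 < r)] [IsProbabilityMeasure μ]
    [VAddInvariantMeasure (Space d) (Config d m r) μ] (w : Fin m → ℝ) :
    ∃ ω : Measure (Space d), Integrable (decayWeight (d + 2) : Space d → ℝ) ω ∧
      IsFourierTransform (palmMoment μ w) ω := by
  obtain ⟨h, hc, hs, h1, hlim⟩ := exists_correlation_tendsto_one d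
  have hs' : ∀ n, HasCompactSupport fun x => (h n x : ℂ) := fun n =>
    (hs n).comp_left (g := Complex.ofReal) Complex.ofReal_zero
  have hcor := fun n => continuous_correlation_self (hc n) (hs n)
  have hdecay : ∀ n N, ∃ A : ℝ, 0 ≤ A ∧ ∀ x, ‖(h n x : ℂ)‖ ≤ A * decayWeight N x := fun n N =>
    exists_norm_le_decayWeight_of_hasCompactSupport
      (Complex.continuous_ofReal.comp (hc n)) (hs' n) N
  have hcd : ∀ n, ∃ A, 0 ≤ A ∧ ∀ x, ‖correlation (fun x => (h n x : ℂ)) (fun x => (h n x : ℂ)) x‖ ≤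
      A * decayWeight (d + 1) x := fun n => by
    obtain ⟨A, hA0, hA⟩ := hdecay n (d + 1)
    obtain ⟨B, hB0, hB⟩ := hdecay n (d + 1 + (d + 1))
    have hI : 0 ≤ ∫ y : Space d, decayWeight (d + 1) y :=
      integral_nonneg fun y => (decayWeight_pos _ y).le
    exact ⟨_, by positivity, norm_correlation_le hA0 hB0 hA hB⟩
  obtain ⟨ω, hω, hF⟩ := exists_fourierTransform_combination
    (c := fun p : Fin m × Fin m => w p.1 * w p.2) half_pos_of_fact
    (fun p => measure_ne_top (palm μ p.1) Set.univ) (translationBounded_palmIntensity μ)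
    hcor (fun n => norm_correlation_self_le_one (hc n) (hs n) (h1 n)) hlim
    (fun n => (hcd n).imp fun A hA => hA.2) fun n k => by
      obtain ⟨A, hA0, hA⟩ := hdecay n (d + 1)
      obtain ⟨B, hB0, hB⟩ := hdecay n (d + 1 + (d + 1))
      obtain ⟨C, hC0, hC⟩ := hcd n
      have hm : Measurable fun y => chi (-k) y * (h n y : ℂ) :=
        ((continuous_chi _).mul (Complex.continuous_ofReal.comp (hc n))).measurable
      have hn : ∀ y, ‖chi (-k) y * (h n y : ℂ)‖ = ‖(h n y : ℂ)‖ := fun y => by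
        rw [norm_mul, norm_chi, one_mul]
      rw [← palmMoment_eq_combination (f := fun x => chi (-k) x *
          correlation (fun x => (h n x : ℂ)) (fun x => (h n x : ℂ)) x) w
        ((continuous_chi _).mul (hcor n)).measurable hC0
        fun x => by rw [norm_mul, norm_chi, one_mul]; exact hC x]
      simp_rw [chi_mul_correlation]
      rw [← integral_countingFn_mul_conj w hm hm hA0 hB0 (fun x => (hn x).trans_le (hA x))
        fun x => (hn x).trans_le (hB x)]
      simp_rw [Complex.mul_conj]
      exact ⟨_, integral_nonneg fun _ => Complex.normSq_nonneg _, integral_complex_ofReal⟩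
  refine ⟨ω, hω, fun φ => ⟨(hF φ).1, ?_⟩⟩
  obtain ⟨A, hA0, hA⟩ := (𝓕 φ : 𝓢(Space d, ℂ)).exists_norm_le_decayWeight (d + 1)
  rw [(hF φ).2, palmMoment_eq_combination w (𝓕 φ : 𝓢(Space d, ℂ)).continuous.measurable hA0 hA]

end PalmFourier

/-! ### Uniqueness and symmetry of Fourier transforms; correlations as Fourier transforms -/

section Determination

variable {d : ℕ}

/-- Locally finite measures are determined by their integrals of Schwartz functions. -/
theorem MeasureTheory.Measure.ext_of_integral_schwartz {ω ω' : Measure (Space d)}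
    [IsLocallyFiniteMeasure ω] [IsLocallyFiniteMeasure ω']
    (h : ∀ φ : 𝓢(Space d, ℂ), HasCompactSupport φ → ∫ x, φ x ∂ω = ∫ x, φ x ∂ω') : ω = ω' := by
  have hfin : ∀ (τ : Measure (Space d)) [IsLocallyFiniteMeasure τ] (U : Set (Space d)),
      Bornology.IsBounded U → τ U ≠ ⊤ := fun τ _ U hU => hU.measure_lt_top.ne
  have key : ∀ U : Set (Space d), IsOpen U → Bornology.IsBounded U → ω U = ω' U := by
    intro U hU hb
    obtain ⟨f, hsupp, hsm, hrange⟩ := hU.exists_contDiff_support_eq (n := ⊤)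
    have h01 : ∀ x, 0 ≤ f x ∧ f x ≤ 1 := fun x => hrange (Set.mem_range_self x)
    -- The smooth `f` is positive exactly on `U` and at most `1`, so `1 - (1 - f) ^ n` increases to
    -- the indicator of `U` through smooth functions supported in the closure of `U`.
    let g : ℕ → Space d → ℂ := fun n x => ((1 - (1 - f x) ^ n : ℝ) : ℂ)
    have hg0 : ∀ n x, x ∉ U → g n x = 0 := fun n x hx => by
      have : f x = 0 := by rwa [← Function.notMem_support, hsupp]
      simp [g, this]
    have hgs : ∀ n, HasCompactSupport (g n) := fun n =>
      HasCompactSupport.intro hb.isCompact_closure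
        fun x hx => hg0 n x fun h => hx (subset_closure h)
    have hgsm : ∀ n, ContDiff ℝ ((⊤ : ℕ∞) : WithTop ℕ∞) (g n) := fun n =>
      Complex.ofRealCLM.contDiff.comp (contDiff_const.sub ((contDiff_const.sub hsm).pow n))
    have hgn : ∀ n x, ‖g n x‖ ≤ U.indicator (fun _ => (1 : ℝ)) x := fun n x => by
      by_cases hx : x ∈ U
      · rw [Set.indicator_of_mem hx]
        simp only [g]
        rw [Complex.norm_real, Real.norm_eq_abs, abs_le]
        have h1 : 0 ≤ (1 - f x) ^ n := pow_nonneg (by linarith [(h01 x).2]) n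
        have h2 : (1 - f x) ^ n ≤ 1 :=
          pow_le_one₀ (by linarith [(h01 x).2]) (by linarith [(h01 x).1])
        constructor <;> linarith
      · rw [hg0 n x hx, norm_zero]
        exact Set.indicator_nonneg (fun _ _ => zero_le_one) _
    have hlim : ∀ x, Tendsto (fun n => g n x) atTop (𝓝 (U.indicator (fun _ => (1 : ℂ)) x)) := by
      intro x
      by_cases hx : x ∈ U
      · rw [Set.indicator_of_mem hx]
        have hpos : 0 < f x := lt_of_le_of_ne (h01 x).1 (by
          rw [ne_comm, ← Function.mem_support, hsupp]; exact hx)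
        have h1 : Tendsto (fun n => 1 - (1 - f x) ^ n) atTop (𝓝 (1 - 0)) :=
          (tendsto_pow_atTop_nhds_zero_of_lt_one (by linarith [(h01 x).2])
            (by linarith)).const_sub 1
        rw [sub_zero] at h1
        exact (Complex.continuous_ofReal.tendsto' 1 1 Complex.ofReal_one).comp h1
      · rw [Set.indicator_of_notMem hx]
        simp_rw [hg0 _ x hx]
        exact tendsto_const_nhds
    have hconv : ∀ (τ : Measure (Space d)) [IsLocallyFiniteMeasure τ],
        Tendsto (fun n => ∫ x, g n x ∂τ) atTop (𝓝 ((τ.real U : ℝ) : ℂ)) := by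
      intro τ _
      have h1 := tendsto_integral_of_dominated_convergence (μ := τ)
        (U.indicator fun _ => (1 : ℝ)) (fun n => (hgsm n).continuous.aestronglyMeasurable)
        ((integrable_indicator_iff hU.measurableSet).2 (integrableOn_const (hfin τ U hb)))
        (fun n => ae_of_all _ (hgn n)) (ae_of_all _ hlim)
      rwa [integral_indicator_const _ hU.measurableSet, Complex.real_smul, mul_one] at h1
    have heq : ∀ n, ∫ x, g n x ∂ω = ∫ x, g n x ∂ω' := fun n =>
      h ((hgs n).toSchwartzMap (hgsm n)) (hgs n)
    have h1 := tendsto_nhds_unique (hconv ω) ((hconv ω').congr fun n => (heq n).symm)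
    exact (ENNReal.toReal_eq_toReal_iff' (hfin ω U hb) (hfin ω' U hb)).1
      (Complex.ofReal_injective h1)
  let S : Set (Set (Space d)) := {U | IsOpen U ∧ Bornology.IsBounded U}
  have hbasis : TopologicalSpace.IsTopologicalBasis S := by
    refine TopologicalSpace.isTopologicalBasis_of_isOpen_of_nhds (fun U hU => hU.1) ?_
    intro x U hx hU
    obtain ⟨ε, hε, hsub⟩ := Metric.isOpen_iff.1 hU x hx
    exact ⟨Metric.ball x ε, ⟨Metric.isOpen_ball, Metric.isBounded_ball⟩,
      Metric.mem_ball_self hε, hsub⟩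
  refine Measure.ext_of_generateFrom_of_iUnion S (fun n : ℕ => Metric.ball 0 (n : ℝ)) ?_ ?_ ?_
    (fun n => ⟨Metric.isOpen_ball, Metric.isBounded_ball⟩)
    (fun n => hfin ω _ Metric.isBounded_ball) fun U hU => key U hU.1 hU.2
  · rw [← hbasis.borel_eq_generateFrom]
    exact BorelSpace.measurable_eq
  · intro U hU V hV _
    exact ⟨hU.1.inter hV.1, hU.2.subset Set.inter_subset_left⟩
  · exact Metric.iUnion_ball_nat 0

theorem IsFourierTransform.unique {L : (Space d → ℂ) → ℂ} {ω ω' : Measure (Space d)}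
    [IsLocallyFiniteMeasure ω] [IsLocallyFiniteMeasure ω'] (h : IsFourierTransform L ω)
    (h' : IsFourierTransform L ω') : ω = ω' :=
  Measure.ext_of_integral_schwartz fun φ _ => (h φ).2.trans (h' φ).2.symm

/-- Complex conjugation on Schwartz functions. -/
def schwartzConj : 𝓢(Space d, ℂ) → 𝓢(Space d, ℂ) :=
  SchwartzMap.postcompCLM (Complex.conjCLE : ℂ →L[ℝ] ℂ)

theorem schwartzConj_apply (f : 𝓢(Space d, ℂ)) (x : Space d) : schwartzConj f x = conj (f x) := rfl

/-- The reflection of a Schwartz function. -/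
def schwartzNeg : 𝓢(Space d, ℂ) → 𝓢(Space d, ℂ) :=
  SchwartzMap.compCLMOfContinuousLinearEquiv ℝ (ContinuousLinearEquiv.neg ℝ)

theorem schwartzNeg_apply (f : 𝓢(Space d, ℂ)) (x : Space d) : schwartzNeg f x = f (-x) := rfl

theorem fourier_schwartzConj (f : 𝓢(Space d, ℂ)) (k : Space d) :
    (𝓕 (schwartzConj f) : 𝓢(Space d, ℂ)) k = conj ((𝓕 f : 𝓢(Space d, ℂ)) (-k)) := by
  rw [SchwartzMap.fourier_coe, SchwartzMap.fourier_coe, fourier_eq_integral_chi,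
    fourier_eq_integral_chi, ← integral_conj]
  refine integral_congr_ae (ae_of_all _ fun x => ?_)
  simp only [schwartzConj_apply, map_mul, chi_neg_left, chi_neg_right, Complex.conj_conj]

theorem fourier_schwartzNeg (f : 𝓢(Space d, ℂ)) (k : Space d) :
    (𝓕 (schwartzNeg f) : 𝓢(Space d, ℂ)) k = (𝓕 f : 𝓢(Space d, ℂ)) (-k) := by
  rw [SchwartzMap.fourier_coe, SchwartzMap.fourier_coe, fourier_eq_integral_chi,
    fourier_eq_integral_chi, ← integral_neg_eq_self]
  refine integral_congr_ae (ae_of_all _ fun x => ?_)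
  simp only [schwartzNeg_apply, neg_neg, chi_neg_right, chi_neg_left, Complex.conj_conj]

theorem integral_map_neg (ω : Measure (Space d)) (φ : Space d → ℂ) :
    ∫ x, φ x ∂ω.map (fun x => -x) = ∫ x, φ (-x) ∂ω :=
  (MeasurableEquiv.neg (Space d)).measurableEmbedding.integral_map φ

/-- A functional that commutes with conjugation has a symmetric Fourier transform: conjugating a
function conjugates and reflects its transform, and the positive measure `ω` is real. -/
theorem IsFourierTransform.map_neg {L : (Space d → ℂ) → ℂ} {ω : Measure (Space d)}
    [IsLocallyFiniteMeasure ω] (h : IsFourierTransform L ω)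
    (hL : ∀ f : Space d → ℂ, L (fun x => conj (f x)) = conj (L f)) :
    ω.map (fun x => -x) = ω := by
  have : IsFiniteMeasureOnCompacts (ω.map fun x => -x) := ⟨fun K hK => by
    rw [Measure.map_apply measurable_neg hK.measurableSet]
    exact ((Homeomorph.neg (Space d)).isCompact_preimage.2 hK).measure_lt_top⟩
  refine Measure.ext_of_integral_schwartz fun φ _ => ?_
  rw [integral_map_neg]
  have h1 : ∫ x, φ (-x) ∂ω = L (𝓕 (schwartzNeg φ) : 𝓢(Space d, ℂ)) := (h (schwartzNeg φ)).2
  have h2 : (⇑(𝓕 (schwartzNeg φ) : 𝓢(Space d, ℂ)) : Space d → ℂ) =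
      fun x => conj ((𝓕 (schwartzConj φ) : 𝓢(Space d, ℂ)) x) := by
    funext x
    rw [fourier_schwartzNeg, fourier_schwartzConj, Complex.conj_conj]
  refine h1.trans ?_
  rw [h2, hL, ← (h (schwartzConj φ)).2, ← integral_conj]
  simp only [schwartzConj_apply, Complex.conj_conj]

theorem correlation_eq_convolution (f g : 𝓢(Space d, ℂ)) :
    correlation f g =
      SchwartzMap.convolution (ContinuousLinearMap.mul ℂ ℂ) f (schwartzNeg (schwartzConj g)) := by
  funext x
  rw [SchwartzMap.convolution_apply, MeasureTheory.convolution, correlation]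
  rw [← integral_add_left_eq_self (μ := volume) (fun t => ContinuousLinearMap.mul ℂ ℂ (f t)
    (schwartzNeg (schwartzConj g) (x - t))) x]
  refine integral_congr_ae (ae_of_all _ fun y => ?_)
  simp [schwartzNeg_apply, schwartzConj_apply]

/-- The correlation of two Schwartz functions is the Fourier transform of a Schwartz function. -/
theorem exists_fourier_eq_correlation (f g : 𝓢(Space d, ℂ)) :
    ∃ ψ : 𝓢(Space d, ℂ), (𝓕 ψ : 𝓢(Space d, ℂ)) = correlation f g ∧
      ∀ k, ψ k = (𝓕 f : 𝓢(Space d, ℂ)) (-k) * conj ((𝓕 g : 𝓢(Space d, ℂ)) (-k)) := by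
  refine ⟨𝓕⁻ (SchwartzMap.convolution (ContinuousLinearMap.mul ℂ ℂ) f
    (schwartzNeg (schwartzConj g))), ?_, fun k => ?_⟩
  · rw [FourierTransform.fourier_fourierInv_eq, correlation_eq_convolution]
  · have h : ∀ φ : 𝓢(Space d, ℂ), (𝓕⁻ φ : 𝓢(Space d, ℂ)) k = (𝓕 φ : 𝓢(Space d, ℂ)) (-k) := by
      intro φ
      rw [SchwartzMap.fourierInv_coe, SchwartzMap.fourier_coe]
      exact Real.fourierInv_eq_fourier_neg _ _
    rw [h, SchwartzMap.fourier_convolution]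
    simp [fourier_schwartzNeg, fourier_schwartzConj]

end Determination

/-! ### The Plancherel formula for counting functions -/

section Parseval

variable {d m : ℕ} {r : ℝ} {μ : Measure (Config d m r)}

theorem palmMoment_conj (w : Fin m → ℝ) (f : Space d → ℂ) :
    palmMoment μ w (fun x => conj (f x)) = conj (palmMoment μ w f) := by
  simp only [palmMoment, countingFn, map_sum, map_mul, Complex.conj_ofReal,
    ← integral_conj]

/-- The second moment is the Palm moment of a correlation, which is the Fourier transform of `f^
conj(g^)` reflected. Symmetry of `ω` removes the reflection. -/
theorem integral_countingFn_schwartz [Fact (0 < r)] [IsProbabilityMeasure μ]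
    [VAddInvariantMeasure (Space d) (Config d m r) μ] {w : Fin m → ℝ} {ω : Measure (Space d)}
    [IsLocallyFiniteMeasure ω] (h : IsFourierTransform (palmMoment μ w) ω) (f g : 𝓢(Space d, ℂ)) :
    ∫ lam, countingFn w f lam * conj (countingFn w g lam) ∂μ =
      ∫ k, (𝓕 f : 𝓢(Space d, ℂ)) k * conj ((𝓕 g : 𝓢(Space d, ℂ)) k) ∂ω := by
  obtain ⟨A, hA0, hA⟩ := f.exists_norm_le_decayWeight (d + 1)
  obtain ⟨B, hB0, hB⟩ := g.exists_norm_le_decayWeight (d + 1 + (d + 1))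
  obtain ⟨ψ, h1, h2⟩ := exists_fourier_eq_correlation f g
  rw [integral_countingFn_mul_conj w f.continuous.measurable g.continuous.measurable hA0 hB0 hA hB,
    ← h1, ← (h ψ).2]
  simp_rw [h2]
  rw [← integral_map_neg ω (fun k => (𝓕 f : 𝓢(Space d, ℂ)) k * conj ((𝓕 g : 𝓢(Space d, ℂ)) k))]
  rw [h.map_neg (palmMoment_conj w)]

end Parseval

/-! ### Integration against complex measures -/

section ComplexMeasures

variable {X : Type*} [MeasurableSpace X]

/-- The variation is dominated by `∑ ‖c j‖ τ j`, hence finite. Both sides agree on simple functions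
and pass to bounded limits by dominated convergence. -/
theorem integral_complexMeasure_eq_sum {ι : Type*} [Fintype ι] {ρ : ComplexMeasure X}
    {τ : ι → Measure X} [∀ j, IsFiniteMeasure (τ j)] {c : ι → ℂ}
    (h : ∀ s, MeasurableSet s → ρ s = ∑ j, c j * ((τ j).real s : ℂ)) {φ : X → ℂ}
    (hφ : Measurable φ) {C : ℝ} (hC : ∀ x, ‖φ x‖ ≤ C) :
    VectorMeasure.integral ρ φ (ContinuousLinearMap.mul ℝ ℂ) = ∑ j, c j * ∫ x, φ x ∂τ j := by
  have hvar : ρ.variation ≤ ∑ j, ‖c j‖₊ • τ j := by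
    refine VectorMeasure.variation_le_of_forall_enorm_le fun s hs => ?_
    rw [h s hs, Measure.finsetSum_apply]
    refine (enorm_sum_le _ _).trans (Finset.sum_le_sum fun j _ => ?_)
    rw [enorm_mul, Measure.smul_apply, ENNReal.smul_def, smul_eq_mul]
    refine mul_le_mul_right (le_of_eq ?_) _
    rw [← ofReal_norm, Complex.norm_real, Real.norm_of_nonneg measureReal_nonneg,
      ofReal_measureReal]
  have hfin : IsFiniteMeasure ρ.variation := isFiniteMeasure_of_le _ hvar
  have hsimple : ∀ f : SimpleFunc X ℂ,
      VectorMeasure.integral ρ f (ContinuousLinearMap.mul ℝ ℂ) = ∑ j, c j * ∫ x, f x ∂τ j := by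
    intro f
    induction f using SimpleFunc.induction with
    | const a hs =>
      rename_i s
      simp only [SimpleFunc.coe_piecewise, SimpleFunc.coe_const, SimpleFunc.const_zero,
        SimpleFunc.coe_zero, Set.piecewise_eq_indicator]
      have h1 : VectorMeasure.integral ρ (s.indicator (Function.const X a))
          (ContinuousLinearMap.mul ℝ ℂ) = a * ρ s := by
        refine (VectorMeasure.integral_indicator hs).trans ?_
        exact VectorMeasure.setIntegral_const a
      rw [h1, h s hs, Finset.mul_sum]
      refine Finset.sum_congr rfl fun j _ => ?_
      rw [integral_indicator hs]
      simp only [Function.const_apply]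
      rw [setIntegral_const, Complex.real_smul]
      ring
    | add hd hf hg =>
      rename_i f g
      have hi : ∀ (f : SimpleFunc X ℂ) (τ : Measure X) [IsFiniteMeasure τ], Integrable f τ :=
        fun f τ _ => SimpleFunc.integrable_of_isFiniteMeasure f
      rw [SimpleFunc.coe_add, VectorMeasure.integral_add (hi f _) (hi g _), hf, hg,
        ← Finset.sum_add_distrib]
      refine Finset.sum_congr rfl fun j _ => ?_
      rw [integral_add' (hi f _) (hi g _), mul_add]
  have hsm : StronglyMeasurable φ := hφ.stronglyMeasurable
  have hC0 : ∀ x, 0 ≤ C := fun x => (norm_nonneg _).trans (hC x)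
  have hlim : ∀ x, Tendsto (fun n => hsm.approxBounded C n x) atTop (𝓝 (φ x)) := fun x =>
    hsm.tendsto_approxBounded_of_norm_le (hC x)
  have hb : ∀ n x, ‖hsm.approxBounded C n x‖ ≤ C := fun n x =>
    hsm.norm_approxBounded_le (hC0 x) n x
  have h1 : Tendsto (fun n => VectorMeasure.integral ρ (hsm.approxBounded C n)
      (ContinuousLinearMap.mul ℝ ℂ)) atTop
      (𝓝 (VectorMeasure.integral ρ φ (ContinuousLinearMap.mul ℝ ℂ))) :=
    VectorMeasure.tendsto_integral_of_dominated_convergence (fun _ => C)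
      (fun n => (SimpleFunc.stronglyMeasurable _).aestronglyMeasurable)
      (integrable_const C) (fun n => ae_of_all _ (hb n)) (ae_of_all _ hlim)
  refine tendsto_nhds_unique h1 ?_
  refine Tendsto.congr (fun n => (hsimple _).symm) ?_
  refine tendsto_finsetSum _ fun j _ => Tendsto.const_mul _ ?_
  exact tendsto_integral_of_dominated_convergence (fun _ => C)
    (fun n => (SimpleFunc.stronglyMeasurable _).aestronglyMeasurable)
    (integrable_const C) (fun n => ae_of_all _ (hb n)) (ae_of_all _ hlim)

/-- The complex measure with a given integrable density. -/
theorem exists_complexMeasure_density {ω : Measure X} {h : X → ℂ} (hm : Measurable h)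
    (hi : Integrable h ω) :
    ∃ ρ : ComplexMeasure X, ∀ φ : X → ℂ, Measurable φ → (∃ C : ℝ, ∀ x, ‖φ x‖ ≤ C) →
      VectorMeasure.integral ρ φ (ContinuousLinearMap.mul ℝ ℂ) = ∫ x, φ x * h x ∂ω := by
  -- Positive and negative parts of the real and imaginary parts, so that `h = ∑ c j * p j` with
  -- positive `p j`.
  let p : Fin 4 → X → ℝ :=
    ![fun x => max (h x).re 0, fun x => max (-(h x).re) 0, fun x => max (h x).im 0,
      fun x => max (-(h x).im) 0]
  let c : Fin 4 → ℂ := ![1, -1, Complex.I, -Complex.I]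
  have hre : Measurable fun x => (h x).re := Complex.measurable_re.comp hm
  have him : Measurable fun x => (h x).im := Complex.measurable_im.comp hm
  have hpm : ∀ j, Measurable (p j) := by
    intro j
    fin_cases j
    · exact hre.max measurable_const
    · exact hre.neg.max measurable_const
    · exact him.max measurable_const
    · exact him.neg.max measurable_const
  have hp0 : ∀ j x, 0 ≤ p j x := by
    intro j x
    fin_cases j <;> exact le_max_right _ _
  have hpi : ∀ j, Integrable (p j) ω := by
    intro j
    fin_cases j
    · exact hi.re.pos_part
    · exact hi.re.neg_part
    · exact hi.im.pos_part
    · exact hi.im.neg_part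
  have hsum : ∀ x, ∑ j, c j * (p j x : ℂ) = h x := by
    intro x
    have h1 : (max (h x).re 0 : ℝ) - max (-(h x).re) 0 = (h x).re := by
      rcases le_total 0 (h x).re with h | h
      · rw [max_eq_left h, max_eq_right (by linarith), sub_zero]
      · rw [max_eq_right h, max_eq_left (by linarith)]; ring
    have h2 : (max (h x).im 0 : ℝ) - max (-(h x).im) 0 = (h x).im := by
      rcases le_total 0 (h x).im with h | h
      · rw [max_eq_left h, max_eq_right (by linarith), sub_zero]
      · rw [max_eq_right h, max_eq_left (by linarith)]; ring
    rw [Fin.sum_univ_four]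
    conv_rhs => rw [← Complex.re_add_im (h x), ← h1, ← h2]
    simp only [c, p, Matrix.cons_val]
    push_cast
    ring
  have hfin : ∀ j, IsFiniteMeasure (ω.withDensity fun x => ENNReal.ofReal (p j x)) := fun j =>
    isFiniteMeasure_withDensity_ofReal (hpi j).hasFiniteIntegral
  refine ⟨ω.withDensityᵥ h, fun φ hφ ⟨C, hC⟩ => ?_⟩
  rw [integral_complexMeasure_eq_sum
    (τ := fun j => ω.withDensity fun x => ENNReal.ofReal (p j x)) (c := c) ?_ hφ hC]
  · have : ∀ j, Integrable (fun x => c j * ((p j x : ℂ) * φ x)) ω := fun j =>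
      (((hpi j).ofReal (𝕜 := ℂ)).mul_bdd hφ.aestronglyMeasurable
        (ae_of_all _ hC)).const_mul _
    simp_rw [integral_withDensity_ofReal (hpm _) (hp0 _), ← integral_const_mul]
    rw [← integral_finsetSum _ fun j _ => this j]
    refine integral_congr_ae (ae_of_all _ fun x => ?_)
    beta_reduce
    rw [← hsum x, Finset.mul_sum]
    refine Finset.sum_congr rfl fun j _ => ?_
    ring
  · intro s hs
    rw [withDensityᵥ_apply hi hs]
    have : ∀ j, (ω.withDensity fun x => ENNReal.ofReal (p j x)).real s =
        ∫ x in s, p j x ∂ω := fun j => by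
      rw [measureReal_def, withDensity_apply _ hs,
        integral_eq_lintegral_of_nonneg_ae (ae_of_all _ (hp0 j))
          (hpm j).aestronglyMeasurable]
    simp_rw [this, ← integral_complex_ofReal, ← integral_const_mul]
    rw [← integral_finsetSum (f := fun j x => c j * (p j x : ℂ)) _ fun j _ =>
      (((hpi j).ofReal (𝕜 := ℂ)).const_mul _).integrableOn]
    exact integral_congr_ae (ae_of_all _ fun x => (hsum x).symm)

end ComplexMeasures

/-! ### Measures are determined by their Fourier transforms -/

section Uniqueness

variable {d : ℕ}

theorem MeasureTheory.Measure.ext_of_integral_chi {τ τ' : Measure (Space d)} [IsFiniteMeasure τ]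
    [IsFiniteMeasure τ'] (h : ∀ t, ∫ x, chi x t ∂τ = ∫ x, chi x t ∂τ') : τ = τ' := by
  refine Measure.ext_of_charFun (funext fun t => ?_)
  have key : ∀ x : Space d, Complex.exp ((inner ℝ x t : ℝ) * Complex.I) =
      chi x ((2 * Real.pi)⁻¹ • t) := fun x => by
    rw [chi, Real.fourierChar_apply, inner_smul_right]
    congr 3
    have : (2 * Real.pi) ≠ 0 := by positivity
    field_simp
  simp_rw [charFun_apply, key]
  exact h _

/-- Both complex measures are split into the four Jordan parts of their real and imaginary parts.
Moving the negative parts to the other side leaves equalities between transforms of finite positive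
measures, where uniqueness of characteristic functions applies. -/
theorem ComplexMeasure.ext_of_integral_chi {ρ ρ' : ComplexMeasure (Space d)}
    (h : ∀ t, VectorMeasure.integral ρ (fun x => chi (-x) t) (ContinuousLinearMap.mul ℝ ℂ) =
      VectorMeasure.integral ρ' (fun x => chi (-x) t) (ContinuousLinearMap.mul ℝ ℂ)) :
    ρ = ρ' := by
  let c : Fin 4 → ℂ := ![1, -1, Complex.I, -Complex.I]
  let τ : ComplexMeasure (Space d) → Fin 4 → Measure (Space d) := fun ρ =>
    ![(ComplexMeasure.re ρ).toJordanDecomposition.posPart,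
      (ComplexMeasure.re ρ).toJordanDecomposition.negPart,
      (ComplexMeasure.im ρ).toJordanDecomposition.posPart,
      (ComplexMeasure.im ρ).toJordanDecomposition.negPart]
  have hfin : ∀ ρ j, IsFiniteMeasure (τ ρ j) := by
    intro ρ j
    fin_cases j
    · exact (ComplexMeasure.re ρ).toJordanDecomposition.posPart_finite
    · exact (ComplexMeasure.re ρ).toJordanDecomposition.negPart_finite
    · exact (ComplexMeasure.im ρ).toJordanDecomposition.posPart_finite
    · exact (ComplexMeasure.im ρ).toJordanDecomposition.negPart_finite
  have hre : ∀ (ρ : ComplexMeasure (Space d)) s, MeasurableSet s →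
      (ρ s).re = (τ ρ 0).real s - (τ ρ 1).real s := fun ρ s hs =>
    (ComplexMeasure.re ρ).apply_eq_posPart_real_sub_negPart_real hs
  have him : ∀ (ρ : ComplexMeasure (Space d)) s, MeasurableSet s →
      (ρ s).im = (τ ρ 2).real s - (τ ρ 3).real s := fun ρ s hs =>
    (ComplexMeasure.im ρ).apply_eq_posPart_real_sub_negPart_real hs
  have hρ : ∀ (ρ : ComplexMeasure (Space d)) s, MeasurableSet s →
      ρ s = ∑ j, c j * ((τ ρ j).real s : ℂ) := fun ρ s hs => by
    rw [Fin.sum_univ_four]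
    conv_lhs => rw [← Complex.re_add_im (ρ s), hre ρ s hs, him ρ s hs]
    simp only [c, Matrix.cons_val]
    push_cast
    ring
  have hint : ∀ (ρ : ComplexMeasure (Space d)) t,
      VectorMeasure.integral ρ (fun x => chi (-x) t) (ContinuousLinearMap.mul ℝ ℂ) =
        ∑ j, c j * ∫ x, chi (-x) t ∂τ ρ j := fun ρ t =>
    integral_complexMeasure_eq_sum (hρ ρ)
      (continuous_chi_neg_uncurry.comp (Continuous.prodMk_left t)).measurable
      fun x => (norm_chi _ _).le
  have hconj : ∀ (ν : Measure (Space d)) t, ∫ x, chi (-x) (-t) ∂ν = conj (∫ x, chi (-x) t ∂ν) :=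
    fun ν t => by
      rw [← integral_conj]
      simp_rw [chi_neg_right]
  have hpos : ∀ (ν : Measure (Space d)) t, ∫ x, chi x t ∂ν = ∫ x, chi (-x) (-t) ∂ν :=
    fun ν t => by simp_rw [chi_neg_right, chi_neg_left, Complex.conj_conj]
  -- The hypothesis at `-t`, conjugated, is the hypothesis at `t` with the sign of the imaginary
  -- part changed. The sum and the difference of the two separate the real from the imaginary part.
  have hmain : ∀ t, (∫ x, chi (-x) t ∂τ ρ 0) + ∫ x, chi (-x) t ∂τ ρ' 1 =
        (∫ x, chi (-x) t ∂τ ρ' 0) + ∫ x, chi (-x) t ∂τ ρ 1 ∧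
      (∫ x, chi (-x) t ∂τ ρ 2) + ∫ x, chi (-x) t ∂τ ρ' 3 =
        (∫ x, chi (-x) t ∂τ ρ' 2) + ∫ x, chi (-x) t ∂τ ρ 3 := by
    intro t
    have h1 := h t
    have h2 := h (-t)
    simp only [hint, Fin.sum_univ_four, hconj] at h1 h2
    have h3 := congrArg conj h2
    simp only [c, Matrix.cons_val, map_add, map_mul, map_neg, map_one, Complex.conj_conj,
      Complex.conj_I] at h1 h3
    constructor
    · linear_combination (h1 + h3) / 2
    · have hI : Complex.I * Complex.I = -1 := Complex.I_mul_I
      have h4 := congrArg (fun z => -Complex.I * z) h1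
      have h5 := congrArg (fun z => -Complex.I * z) h3
      simp only [mul_add, mul_neg, neg_mul, ← mul_assoc, hI] at h4 h5
      linear_combination (h4 - h5) / 2
  have hint' : ∀ (ν : Measure (Space d)) [IsFiniteMeasure ν] t, Integrable (fun x => chi x t) ν :=
    fun ν _ t => Integrable.of_bound
      (continuous_chi_uncurry.comp (Continuous.prodMk_left t)).aestronglyMeasurable 1
      (ae_of_all _ fun x => (norm_chi _ _).le)
  have hext : ∀ ν₁ ν₂ ν₃ ν₄ : Measure (Space d), IsFiniteMeasure ν₁ → IsFiniteMeasure ν₂ →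
      IsFiniteMeasure ν₃ → IsFiniteMeasure ν₄ →
      (∀ t, (∫ x, chi (-x) t ∂ν₁) + ∫ x, chi (-x) t ∂ν₂ =
        (∫ x, chi (-x) t ∂ν₃) + ∫ x, chi (-x) t ∂ν₄) →
      ∀ s, ν₁.real s - ν₄.real s = ν₃.real s - ν₂.real s := by
    intro ν₁ ν₂ ν₃ ν₄ _ _ _ _ hh s
    have heq : ν₁ + ν₂ = ν₃ + ν₄ := by
      refine Measure.ext_of_integral_chi fun t => ?_
      rw [integral_add_measure (hint' _ t) (hint' _ t),
        integral_add_measure (hint' _ t) (hint' _ t), hpos, hpos, hpos, hpos]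
      exact hh (-t)
    have h1 : (ν₁ + ν₂).real s = (ν₃ + ν₄).real s := by rw [heq]
    rw [measureReal_add_apply, measureReal_add_apply] at h1
    linarith
  refine VectorMeasure.ext fun s hs => Complex.ext ?_ ?_
  · rw [hre ρ s hs, hre ρ' s hs]
    exact hext _ _ _ _ (hfin _ _) (hfin _ _) (hfin _ _) (hfin _ _) (fun t => (hmain t).1) s
  · rw [him ρ s hs, him ρ' s hs]
    exact hext _ _ _ _ (hfin _ _) (hfin _ _) (hfin _ _) (hfin _ _) (fun t => (hmain t).2) s

end Uniqueness

/-! ### The isometric embedding and the cross spectral measures -/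

section Embedding

variable {d m : ℕ} {r : ℝ} {μ : Measure (Config d m r)}

theorem hasTemperateGrowth_of_integrable_decayWeight {ω : Measure (Space d)} {n : ℕ}
    (h : Integrable (decayWeight n : Space d → ℝ) ω) : ω.HasTemperateGrowth := by
  refine ⟨n, h.congr (ae_of_all _ fun x => ?_)⟩
  beta_reduce
  rw [decayWeight, Real.rpow_neg (by positivity), Real.rpow_natCast]

theorem isLocallyFinite_of_integrable_decayWeight {ω : Measure (Space d)} {n : ℕ}
    (h : Integrable (decayWeight n : Space d → ℝ) ω) : IsLocallyFiniteMeasure ω := by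
  refine ⟨fun x => ⟨Metric.ball x 1, Metric.ball_mem_nhds x one_pos, ?_⟩⟩
  have hpos : (0 : ℝ) < ((2 + ‖x‖) ^ n)⁻¹ := by positivity
  refine lt_of_le_of_lt (measure_mono fun y hy => ?_) (h.measure_ge_lt_top hpos)
  have hy' : ‖y‖ ≤ 1 + ‖x‖ := by
    have h1 := norm_sub_norm_le y x
    have h2 : ‖y - x‖ < 1 := by rwa [← dist_eq_norm]
    linarith
  have h3 : (1 + ‖y‖) ^ n ≤ (2 + ‖x‖) ^ n := pow_le_pow_left₀ (by positivity) (by linarith) n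
  exact inv_anti₀ (by positivity) h3

theorem memLp_countingFn [Fact (0 < r)] [IsFiniteMeasure μ] (w : Fin m → ℝ) {f : Space d → ℂ}
    (hf : Measurable f) {A : ℝ} (hA0 : 0 ≤ A) (hA : ∀ x, ‖f x‖ ≤ A * decayWeight (d + 1) x) :
    MemLp (countingFn w f) 2 μ :=
  MemLp.of_bound (measurable_countingFn w hf).aestronglyMeasurable _
    (ae_of_all _ (norm_countingFn_le w hA0 hA))

theorem memLp_countingFn_schwartz [Fact (0 < r)] [IsFiniteMeasure μ] (w : Fin m → ℝ)
    (f : 𝓢(Space d, ℂ)) : MemLp (countingFn w f) 2 μ :=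
  let ⟨_, hA0, hA⟩ := f.exists_norm_le_decayWeight (d + 1)
  memLp_countingFn w f.continuous.measurable hA0 hA

theorem integrable_colour_schwartz [Fact (0 < r)] (f : 𝓢(Space d, ℂ)) (i : Fin m)
    (lam : Config d m r) : Integrable f (colour i lam) :=
  let ⟨_, _, hA⟩ := f.exists_norm_le_decayWeight (d + 1)
  integrable_colour f.continuous.measurable hA i lam

theorem countingFn_add [Fact (0 < r)] (w : Fin m → ℝ) {f g : Space d → ℂ} {lam : Config d m r}
    (hf : ∀ i, Integrable f (colour i lam)) (hg : ∀ i, Integrable g (colour i lam)) :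
    countingFn w (f + g) lam = countingFn w f lam + countingFn w g lam := by
  simp only [countingFn, ← Finset.sum_add_distrib, ← mul_add]
  exact Finset.sum_congr rfl fun i _ => by rw [integral_add' (hf i) (hg i)]

theorem countingFn_smul (w : Fin m → ℝ) (c : ℂ) (f : Space d → ℂ) (lam : Config d m r) :
    countingFn w (c • f) lam = c * countingFn w f lam := by
  simp only [countingFn, Finset.mul_sum, Pi.smul_apply, smul_eq_mul, integral_const_mul]
  exact Finset.sum_congr rfl fun i _ => by ring

/-- The linear map `f ↦ N^w_f` on Schwartz functions. -/
def countingMap [Fact (0 < r)] (μ : Measure (Config d m r)) [IsFiniteMeasure μ] (w : Fin m → ℝ) :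
    𝓢(Space d, ℂ) →ₗ[ℂ] Lp ℂ 2 μ where
  toFun f := (memLp_countingFn_schwartz w f).toLp _
  map_add' f g := by
    rw [← MemLp.toLp_add]
    refine MemLp.toLp_congr _ _ (ae_of_all _ fun lam => ?_)
    exact countingFn_add w (fun i => integrable_colour_schwartz f i lam)
      fun i => integrable_colour_schwartz g i lam
  map_smul' c f := by
    rw [RingHom.id_apply, ← MemLp.toLp_const_smul]
    exact MemLp.toLp_congr _ _ (ae_of_all _ fun lam => countingFn_smul w c f lam)

/-- The linear map `f ↦ f^` from Schwartz functions to `L²(ω)`. -/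
def fourierToLp (ω : Measure (Space d)) [ω.HasTemperateGrowth] :
    𝓢(Space d, ℂ) →ₗ[ℂ] Lp ℂ 2 ω :=
  (SchwartzMap.toLpCLM ℂ ℂ 2 ω).toLinearMap ∘ₗ
    (FourierTransform.fourierCLM ℂ 𝓢(Space d, ℂ)).toLinearMap

theorem fourierToLp_apply (ω : Measure (Space d)) [ω.HasTemperateGrowth] (f : 𝓢(Space d, ℂ)) :
    fourierToLp ω f = (𝓕 f : 𝓢(Space d, ℂ)).toLp 2 ω := rfl

/-- The Fourier transform is onto the Schwartz space, so this is the density of Schwartz functions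
in `L²(ω)`. -/
theorem denseRange_fourierToLp (ω : Measure (Space d)) [ω.HasTemperateGrowth]
    [IsLocallyFiniteMeasure ω] : DenseRange (fourierToLp ω) := by
  have h : DenseRange (SchwartzMap.toLpCLM ℂ ℂ 2 ω : 𝓢(Space d, ℂ) → Lp ℂ 2 ω) :=
    SchwartzMap.denseRange_toLpCLM (by norm_num)
  refine Dense.mono ?_ h
  rintro _ ⟨f, rfl⟩
  refine ⟨𝓕⁻ f, ?_⟩
  rw [fourierToLp_apply, FourierTransform.fourier_fourierInv_eq]
  rfl

theorem inner_toLp_toLp {α : Type*} [MeasurableSpace α] {ν : Measure α} {f g : α → ℂ}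
    (hf : MemLp f 2 ν) (hg : MemLp g 2 ν) :
    inner ℂ (hg.toLp g) (hf.toLp f) = ∫ x, f x * conj (g x) ∂ν := by
  rw [L2.inner_def]
  refine integral_congr_ae ?_
  filter_upwards [hf.coeFn_toLp, hg.coeFn_toLp] with x h1 h2
  rw [h1, h2, RCLike.inner_apply]

theorem norm_countingMap_eq [Fact (0 < r)] [IsProbabilityMeasure μ]
    [VAddInvariantMeasure (Space d) (Config d m r) μ] {w : Fin m → ℝ} {ω : Measure (Space d)}
    [IsLocallyFiniteMeasure ω] [ω.HasTemperateGrowth] (h : IsFourierTransform (palmMoment μ w) ω)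
    (f : 𝓢(Space d, ℂ)) : ‖countingMap μ w f‖ = ‖fourierToLp ω f‖ := by
  have h1 : inner ℂ (countingMap μ w f) (countingMap μ w f) =
      inner ℂ (fourierToLp ω f) (fourierToLp ω f) :=
    (inner_toLp_toLp (memLp_countingFn_schwartz w f) (memLp_countingFn_schwartz w f)).trans
      ((integral_countingFn_schwartz h f f).trans
        (inner_toLp_toLp ((𝓕 f : 𝓢(Space d, ℂ)).memLp 2 ω)
          ((𝓕 f : 𝓢(Space d, ℂ)).memLp 2 ω)).symm)
  rw [inner_self_eq_norm_sq_to_K, inner_self_eq_norm_sq_to_K] at h1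
  have h2 : ‖countingMap μ w f‖ ^ 2 = ‖fourierToLp ω f‖ ^ 2 := by exact_mod_cast h1
  exact (pow_left_inj₀ (norm_nonneg _) (norm_nonneg _) two_ne_zero).1 h2

/-- Equality of norms makes `f^ ↦ N_f` well defined on classes modulo `ω`, even if different `f`
have the same class, and lets it extend isometrically from a dense subspace. -/
theorem exists_isCountingEmbedding [Fact (0 < r)] [IsProbabilityMeasure μ]
    [VAddInvariantMeasure (Space d) (Config d m r) μ] {w : Fin m → ℝ} {ω : Measure (Space d)}
    [IsLocallyFiniteMeasure ω] [ω.HasTemperateGrowth]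
    (h : IsFourierTransform (palmMoment μ w) ω) :
    ∃ θ : Lp ℂ 2 ω →ₗᵢ[ℂ] Lp ℂ 2 μ, IsCountingEmbedding μ w ω θ := by
  have hnorm : ∃ C, ∀ f, ‖countingMap μ w f‖ ≤ C * ‖fourierToLp ω f‖ :=
    ⟨1, fun f => by rw [one_mul, norm_countingMap_eq h]⟩
  let T : Lp ℂ 2 ω →L[ℂ] Lp ℂ 2 μ := (countingMap μ w).extendOfNorm (fourierToLp ω)
  have hT : ∀ f, T (fourierToLp ω f) = countingMap μ w f :=
    LinearMap.extendOfNorm_eq (denseRange_fourierToLp ω) hnorm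
  have hTn : ∀ u, ‖T u‖ = ‖u‖ := fun u => by
    refine (denseRange_fourierToLp ω).induction_on (p := fun u => ‖T u‖ = ‖u‖) u
      (isClosed_eq (by fun_prop) (by fun_prop)) fun f => ?_
    rw [hT, norm_countingMap_eq h]
  exact ⟨⟨T.toLinearMap, hTn⟩, fun f =>
    ⟨(𝓕 f : 𝓢(Space d, ℂ)).memLp 2 ω, memLp_countingFn_schwartz w f, hT f⟩⟩

theorem IsCountingEmbedding.apply_fourierToLp [Fact (0 < r)] [IsFiniteMeasure μ] {w : Fin m → ℝ}
    {ω : Measure (Space d)} [ω.HasTemperateGrowth] {θ : Lp ℂ 2 ω →ₗᵢ[ℂ] Lp ℂ 2 μ}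
    (h : IsCountingEmbedding μ w ω θ) (f : 𝓢(Space d, ℂ)) :
    θ (fourierToLp ω f) = countingMap μ w f :=
  (h f).2.2

theorem IsCountingEmbedding.unique [Fact (0 < r)] [IsFiniteMeasure μ] {w : Fin m → ℝ}
    {ω : Measure (Space d)} [ω.HasTemperateGrowth] [IsLocallyFiniteMeasure ω]
    {θ θ' : Lp ℂ 2 ω →ₗᵢ[ℂ] Lp ℂ 2 μ}
    (h : IsCountingEmbedding μ w ω θ) (h' : IsCountingEmbedding μ w ω θ') : θ' = θ :=
  DFunLike.coe_injective <| (denseRange_fourierToLp ω).equalizer θ'.continuous θ.continuous <|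
    funext fun f => (h'.apply_fourierToLp f).trans (h.apply_fourierToLp f).symm

theorem coeFn_multiplicationRep (ω : Measure (Space d)) (t : Space d) (f : Lp ℂ 2 ω) :
    multiplicationRep ω t f =ᵐ[ω] fun x => chi (-t) x * f x :=
  (memLp_chi_mul ω t f).coeFn_toLp

theorem continuous_multiplicationRep (ω : Measure (Space d)) (t : Space d) :
    Continuous (multiplicationRep ω t) := by
  refine Isometry.continuous fun f g => ?_
  rw [Lp.edist_def, Lp.edist_def]
  refine eLpNorm_congr_norm_ae ?_
  filter_upwards [coeFn_multiplicationRep ω t f, coeFn_multiplicationRep ω t g] with x h1 h2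
  rw [Pi.sub_apply, Pi.sub_apply, h1, h2, ← mul_sub, norm_mul, norm_chi, one_mul]

theorem continuous_translationRep [VAddInvariantMeasure (Space d) (Config d m r) μ]
    (t : Space d) : Continuous (translationRep μ t) :=
  (Lp.isometry_compMeasurePreserving _).continuous

theorem coeFn_translationRep [VAddInvariantMeasure (Space d) (Config d m r) μ] (t : Space d)
    (F : Lp ℂ 2 μ) : translationRep μ t F =ᵐ[μ] fun lam => F (-t +ᵥ lam) :=
  Lp.coeFn_compMeasurePreserving _ _

theorem fourier_translate (f : Space d → ℂ) (t k : Space d) :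
    𝓕 (fun x => f (-t + x)) k = chi (-t) k * 𝓕 f k := by
  rw [fourier_eq_integral_chi, fourier_eq_integral_chi, ← integral_const_mul,
    ← integral_add_left_eq_self (fun x => chi (-x) k * f (-t + x)) t]
  refine integral_congr_ae (ae_of_all _ fun x => ?_)
  beta_reduce
  rw [neg_add_cancel_left, neg_add, chi_add_left, mul_assoc]

/-- Both sides are continuous, so it suffices to look at `f^`. There, multiplication by the
character is the transform of the translate of `f`, and translating `f` translates `N_f`. -/
theorem IsCountingEmbedding.intertwines [Fact (0 < r)] [IsFiniteMeasure μ]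
    [VAddInvariantMeasure (Space d) (Config d m r) μ] {w : Fin m → ℝ}
    {ω : Measure (Space d)} [ω.HasTemperateGrowth] [IsLocallyFiniteMeasure ω]
    {θ : Lp ℂ 2 ω →ₗᵢ[ℂ] Lp ℂ 2 μ} (h : IsCountingEmbedding μ w ω θ) (t : Space d)
    (u : Lp ℂ 2 ω) : θ (multiplicationRep ω t u) = translationRep μ t (θ u) := by
  refine (denseRange_fourierToLp ω).induction_on
    (p := fun u => θ (multiplicationRep ω t u) = translationRep μ t (θ u)) u
    (isClosed_eq (θ.continuous.comp (continuous_multiplicationRep ω t))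
      ((continuous_translationRep t).comp θ.continuous)) fun f => ?_
  let f' : 𝓢(Space d, ℂ) := f.compSubConstCLM ℂ t
  have hf' : (f' : Space d → ℂ) = fun x => f (-t + x) := by
    funext x
    rw [neg_add_eq_sub]
    rfl
  have h1 : multiplicationRep ω t (fourierToLp ω f) = fourierToLp ω f' := by
    refine Lp.ext ?_
    filter_upwards [coeFn_multiplicationRep ω t (fourierToLp ω f),
      (𝓕 f : 𝓢(Space d, ℂ)).coeFn_toLp 2 ω, (𝓕 f' : 𝓢(Space d, ℂ)).coeFn_toLp 2 ω] with k h1 h2 h3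
    rw [h1, fourierToLp_apply, fourierToLp_apply, h2, h3, SchwartzMap.fourier_coe,
      SchwartzMap.fourier_coe, hf', fourier_translate]
  rw [h1, h.apply_fourierToLp, h.apply_fourierToLp]
  have h2 : translationRep μ t (countingMap μ w f) =
      ((memLp_countingFn_schwartz w f).comp_measurePreserving
        (measurePreserving_vadd (-t) μ)).toLp _ :=
    Lp.toLp_compMeasurePreserving (memLp_countingFn_schwartz w f) _
  rw [h2]
  refine MemLp.toLp_congr (memLp_countingFn_schwartz w f') _ (ae_of_all _ fun lam => ?_)
  rw [Function.comp_apply, countingFn_vadd, hf']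

/-- The measure is `f conj(g) ω`. As `θ` preserves inner products and intertwines, both
representations have the same matrix coefficients, so the two conditions on `ρ'` are equivalent. -/
theorem exists_crossSpectralMeasure [VAddInvariantMeasure (Space d) (Config d m r) μ]
    {ω : Measure (Space d)} {θ : Lp ℂ 2 ω →ₗᵢ[ℂ] Lp ℂ 2 μ}
    (hθ : ∀ (t : Space d) (u : Lp ℂ 2 ω),
      θ (multiplicationRep ω t u) = translationRep μ t (θ u)) (f g : Lp ℂ 2 ω) :
    ∃ ρ : ComplexMeasure (Space d),
      (∀ ρ', IsCrossSpectralMeasure (multiplicationRep ω) f g ρ' ↔ ρ' = ρ) ∧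
      ∀ ρ', IsCrossSpectralMeasure (translationRep μ) (θ f) (θ g) ρ' ↔ ρ' = ρ := by
  have hm : Measurable fun x => f x * conj (g x) :=
    (Lp.stronglyMeasurable f).measurable.mul
      (Complex.continuous_conj.measurable.comp (Lp.stronglyMeasurable g).measurable)
  have hi : Integrable (fun x => f x * conj (g x)) ω := by
    simpa only [RCLike.inner_apply] using L2.integrable_inner (𝕜 := ℂ) g f
  obtain ⟨ρ, hρ⟩ := exists_complexMeasure_density hm hi
  have h1 : IsCrossSpectralMeasure (multiplicationRep ω) f g ρ := by
    intro t
    rw [hρ (fun x => chi (-x) t)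
      (continuous_chi_neg_uncurry.comp (Continuous.prodMk_left t)).measurable
      ⟨1, fun x => (norm_chi _ _).le⟩, L2.inner_def]
    refine integral_congr_ae ?_
    filter_upwards [coeFn_multiplicationRep ω t f] with x hx
    rw [hx, RCLike.inner_apply, chi_neg_left, chi_comm, ← chi_neg_left, mul_assoc]
  have h2 : ∀ ρ', IsCrossSpectralMeasure (multiplicationRep ω) f g ρ' ↔ ρ' = ρ := fun ρ' =>
    ⟨fun h => ComplexMeasure.ext_of_integral_chi fun t => (h t).symm.trans (h1 t),
      fun h => h ▸ h1⟩
  refine ⟨ρ, h2, fun ρ' => ?_⟩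
  rw [← h2 ρ']
  refine forall_congr' fun t => ?_
  rw [← hθ, LinearIsometry.inner_map_map]

end Embedding

/-! ### Eigenfunctions of the two representations -/

section PointSpectrum

variable {d m : ℕ} {r : ℝ} {μ : Measure (Config d m r)}

theorem eq_zero_of_chi_eq_one {x : Space d} (h : ∀ t, chi x t = 1) : x = 0 := by
  by_contra hx
  -- At this point the inner product with `x` is `1 / 2`, where the character takes the value `-1`.
  have h1 := h ((2 * ‖x‖ ^ 2)⁻¹ • x)
  have hn : ‖x‖ ≠ 0 := norm_ne_zero_iff.2 hx
  rw [chi, inner_smul_right, real_inner_self_eq_norm_sq, Real.fourierChar_apply] at h1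
  have h2 : (2 * Real.pi * ((2 * ‖x‖ ^ 2)⁻¹ * ‖x‖ ^ 2) : ℝ) = Real.pi := by field_simp
  rw [h2, Complex.exp_pi_mul_I] at h1
  norm_num at h1

/-- The eigenvalue equation holds off a null set that depends on `t`, so only countably many `t` can
be used at once; continuity of characters makes a dense sequence sufficient. -/
theorem chi_eq_of_denseSeq {k x : Space d}
    (h : ∀ n, chi (-(TopologicalSpace.denseSeq (Space d) n)) x =
      chi k (TopologicalSpace.denseSeq (Space d) n)) : x = -k := by
  have hc : Continuous fun t => chi (-t) x :=
    continuous_subtype_val.comp (Real.continuous_fourierChar.comp (by fun_prop))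
  have hall : (fun t => chi (-t) x) = chi k :=
    (TopologicalSpace.denseRange_denseSeq (Space d)).equalizer hc (continuous_chi k) (funext h)
  refine eq_neg_of_add_eq_zero_left (eq_zero_of_chi_eq_one fun t => ?_)
  rw [chi_add_left, ← congrFun hall t, chi_comm x t, mul_comm, chi_neg_mul]

theorem pointIndicator_ne_zero_iff {ω : Measure (Space d)} [IsLocallyFiniteMeasure ω]
    (x : Space d) : pointIndicator ω x ≠ 0 ↔ ω {x} ≠ 0 := by
  rw [← norm_ne_zero_iff, pointIndicator,
    norm_indicatorConstLp (by norm_num) (by norm_num), norm_one, one_mul]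
  rw [Ne, Real.rpow_eq_zero measureReal_nonneg (by norm_num), measureReal_eq_zero_iff
    isCompact_singleton.measure_ne_top]

theorem norm_pointIndicator (ω : Measure (Space d)) [IsLocallyFiniteMeasure ω] (x : Space d) :
    ‖pointIndicator ω x‖ = √((ω {x}).toReal) := by
  rw [pointIndicator, norm_indicatorConstLp (by norm_num) (by norm_num), norm_one, one_mul,
    Real.sqrt_eq_rpow]
  norm_num
  rfl

theorem coeFn_pointIndicator (ω : Measure (Space d)) [IsLocallyFiniteMeasure ω] (x : Space d) :
    pointIndicator ω x =ᵐ[ω] Set.indicator {x} fun _ => 1 :=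
  indicatorConstLp_coeFn

theorem multiplicationRep_pointIndicator (ω : Measure (Space d)) [IsLocallyFiniteMeasure ω]
    (k t : Space d) :
    multiplicationRep ω t (pointIndicator ω (-k)) = chi k t • pointIndicator ω (-k) := by
  refine Lp.ext ?_
  filter_upwards [coeFn_multiplicationRep ω t (pointIndicator ω (-k)),
    Lp.coeFn_smul (chi k t) (pointIndicator ω (-k)),
    coeFn_pointIndicator ω (-k)] with x h1 h2 h3
  rw [h1, h2, Pi.smul_apply, h3, smul_eq_mul]
  by_cases hx : x = -k
  · rw [hx, chi_neg_left, chi_neg_right, Complex.conj_conj, chi_comm]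
  · rw [Set.indicator_of_notMem (by simpa using hx), mul_zero, mul_zero]

/-- Where `f` does not vanish, the characters `t ↦ χ_{-t}(x)` and `χ_k` must agree, which forces `x
= -k`. -/
theorem isEigenfunction_multiplicationRep_iff {ω : Measure (Space d)} [IsLocallyFiniteMeasure ω]
    (k : Space d) (f : Lp ℂ 2 ω) :
    IsEigenfunction (multiplicationRep ω) k f ↔
      ω {-k} ≠ 0 ∧ ∃ c : ℂ, c ≠ 0 ∧ f = c • pointIndicator ω (-k) := by
  constructor
  · rintro ⟨hf0, hf⟩
    have hae : ∀ᵐ x ∂ω, ∀ n, chi (-(TopologicalSpace.denseSeq (Space d) n)) x * f x =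
        chi k (TopologicalSpace.denseSeq (Space d) n) * f x := by
      refine ae_all_iff.2 fun n => ?_
      set t := TopologicalSpace.denseSeq (Space d) n
      filter_upwards [coeFn_multiplicationRep ω t f, Lp.coeFn_smul (chi k t) f] with x h1 h2
      rw [← h1, hf t, h2, Pi.smul_apply, smul_eq_mul]
    have hzero : ∀ᵐ x ∂ω, x ≠ -k → f x = 0 := by
      filter_upwards [hae] with x hx hne
      by_contra hfx
      exact hne (chi_eq_of_denseSeq fun n => mul_right_cancel₀ hfx (hx n))
    obtain ⟨c, hc⟩ : ∃ c : ℂ, c = f (-k) := ⟨_, rfl⟩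
    have heq : f = c • pointIndicator ω (-k) := by
      refine Lp.ext ?_
      filter_upwards [hzero, Lp.coeFn_smul c (pointIndicator ω (-k)),
        coeFn_pointIndicator ω (-k)] with x h1 h2 h3
      rw [h2, Pi.smul_apply, h3, smul_eq_mul]
      by_cases hx : x = -k
      · rw [hx, Set.indicator_of_mem (Set.mem_singleton _), mul_one, hc]
      · rw [Set.indicator_of_notMem (Set.mem_singleton_iff.not.2 hx), mul_zero, h1 hx]
    have hne : c • pointIndicator ω (-k) ≠ 0 := heq ▸ hf0
    rw [smul_ne_zero_iff, pointIndicator_ne_zero_iff] at hne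
    exact ⟨hne.2, c, hne.1, heq⟩
  · rintro ⟨hk, c, hc, rfl⟩
    refine ⟨smul_ne_zero hc ((pointIndicator_ne_zero_iff _).2 hk), fun t => ?_⟩
    have h1 := multiplicationRep_pointIndicator ω k t
    refine Lp.ext ?_
    filter_upwards [coeFn_multiplicationRep ω t (c • pointIndicator ω (-k)),
      coeFn_multiplicationRep ω t (pointIndicator ω (-k)),
      Lp.coeFn_smul c (pointIndicator ω (-k)),
      Lp.coeFn_smul (chi k t) (c • pointIndicator ω (-k)),
      Lp.coeFn_smul (chi k t) (pointIndicator ω (-k))] with x e1 e2 e3 e4 e5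
    rw [h1] at e2
    rw [e1, e4, Pi.smul_apply, e3, Pi.smul_apply, smul_eq_mul, smul_eq_mul, mul_left_comm, ← e2,
      e5, Pi.smul_apply, smul_eq_mul]
    ring

/-- Eigenvalues have modulus `1`, so `F conj(G)` and `|G|²` are invariant and by ergodicity
constants `a` and `b`, with `b ≠ 0` since `G ≠ 0`. Then `F = (a / b) G`. -/
theorem isEigenfunction_translationRep_iff [IsProbabilityMeasure μ]
    [ErgodicVAdd (Space d) (Config d m r) μ] [Fact (0 < r)] {k : Space d} {G : Lp ℂ 2 μ}
    (hG : IsEigenfunction (translationRep μ) k G) (F : Lp ℂ 2 μ) :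
    IsEigenfunction (translationRep μ) k F ↔ ∃ c : ℂ, c ≠ 0 ∧ F = c • G := by
  have hpt : ∀ F : Lp ℂ 2 μ, IsEigenfunction (translationRep μ) k F → ∀ t : Space d,
      ∀ᵐ lam ∂μ, F (t +ᵥ lam) = chi k (-t) * F lam := fun F hF t => by
    have h1 := coeFn_translationRep (μ := μ) (-t) F
    rw [hF.2 (-t), neg_neg] at h1
    filter_upwards [h1, Lp.coeFn_smul (chi k (-t)) F] with lam h2 h3
    rw [← h2, h3, Pi.smul_apply, smul_eq_mul]
  have hprod : ∀ F : Lp ℂ 2 μ, IsEigenfunction (translationRep μ) k F →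
      ∃ c : ℂ, ∀ᵐ lam ∂μ, F lam * conj (G lam) = c := fun F hF => by
    refine ErgodicVAdd.ae_eq_const (d := d) (μ := μ) (u := fun lam => F lam * conj (G lam))
      ((Lp.aestronglyMeasurable F).mul
        (Complex.continuous_conj.comp_aestronglyMeasurable (Lp.aestronglyMeasurable G)))
      fun t => ?_
    filter_upwards [hpt F hF t, hpt G hG t] with lam h1 h2
    have h3 : chi k (-t) * conj (chi k (-t)) = 1 := by
      rw [Complex.mul_conj, Complex.normSq_eq_norm_sq, norm_chi]; norm_num
    rw [h1, h2, map_mul]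
    linear_combination (F lam * conj (G lam)) * h3
  constructor
  · intro hF
    obtain ⟨b, hb⟩ := hprod G hG
    obtain ⟨a, ha⟩ := hprod F hF
    have hb0 : b ≠ 0 := by
      rintro rfl
      refine hG.1 (Lp.ext ?_)
      filter_upwards [hb, Lp.coeFn_zero ℂ 2 μ] with lam h1 h2
      rw [h2, Pi.zero_apply]
      simpa using h1
    have heq : F = (a / b) • G := by
      refine Lp.ext ?_
      filter_upwards [ha, hb, Lp.coeFn_smul (a / b) G] with lam h1 h2 h3
      rw [h3, Pi.smul_apply, smul_eq_mul, div_mul_eq_mul_div, eq_div_iff hb0, ← h1, ← h2]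
      ring
    refine ⟨a / b, fun h0 => hF.1 ?_, heq⟩
    rw [heq, h0, zero_smul]
  · rintro ⟨c, hc, rfl⟩
    refine ⟨smul_ne_zero hc hG.1, fun t => ?_⟩
    refine Lp.ext ?_
    have h0 : ∀ᵐ lam ∂μ, (c • G) (-t +ᵥ lam) = (c • (G : Config d m r → ℂ)) (-t +ᵥ lam) :=
      (measurePreserving_vadd (-t) μ).quasiMeasurePreserving.ae (Lp.coeFn_smul c G)
    filter_upwards [coeFn_translationRep (μ := μ) t (c • G), h0, hpt G hG (-t),
      Lp.coeFn_smul (chi k t) (c • G), Lp.coeFn_smul c G] with lam h1 h2 h3 h4 h5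
    rw [h1, h2, Pi.smul_apply, h3, h4, Pi.smul_apply, h5, Pi.smul_apply, neg_neg, smul_eq_mul,
      smul_eq_mul, smul_eq_mul]
    ring

end PointSpectrum

/-! ### Extension to continuous functions of compact support; spectral measures -/

section CompactSupport

variable {d m : ℕ} {r : ℝ} {μ : Measure (Config d m r)}

theorem exists_schwartz_approx {f : Space d → ℂ} (hf : Continuous f) (hs : HasCompactSupport f)
    (n : ℕ) {ε : ℝ} (hε : 0 < ε) :
    ∃ g : 𝓢(Space d, ℂ), ∀ x, ‖g x - f x‖ ≤ ε * decayWeight n x := by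
  obtain ⟨ρ, hρ0, hρ⟩ := hs.isCompact.isBounded.subset_closedBall_lt 0 (0 : Space d)
  have hout : ∀ x, ρ < ‖x‖ → f x = 0 := fun x hx => by
    by_contra h
    have := hρ (subset_tsupport _ h)
    rw [mem_closedBall_zero_iff] at this
    linarith
  -- The smallest value of the weight on the ball of radius `ρ + 1`, outside which both `f` and its
  -- mollification vanish.
  set c : ℝ := ((1 + (ρ + 1)) ^ n)⁻¹
  have hc : 0 < c := by positivity
  obtain ⟨δ, hδ, hu⟩ := Metric.uniformContinuous_iff.1 (hs.uniformContinuous_of_continuous hf)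
    (ε * c) (by positivity)
  obtain ⟨g, hg, hgf⟩ := hf.exists_contDiff_dist_le_of_forall_mem_ball_dist_le
    (lt_min one_pos hδ)
  have hgout : ∀ x, ρ + 1 < ‖x‖ → g x = 0 := fun x hx => by
    have h1 := hgf x 0 fun y hy => by
      have h2 : ‖y - x‖ < 1 := by
        rw [← dist_eq_norm]; exact (Metric.mem_ball.1 hy).trans_le (min_le_left _ _)
      have h3 := norm_sub_norm_le x y
      rw [norm_sub_rev] at h3
      rw [hout y (by linarith), hout x (by linarith), dist_self]
    rw [hout x (by linarith), dist_zero_right] at h1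
    exact norm_le_zero_iff.1 h1
  have hgs : HasCompactSupport g :=
    HasCompactSupport.intro (isCompact_closedBall (0 : Space d) (ρ + 1)) fun x hx =>
      hgout x (by simpa using hx)
  refine ⟨hgs.toSchwartzMap hg, fun x => ?_⟩
  change ‖g x - f x‖ ≤ _
  by_cases hx : ‖x‖ ≤ ρ + 1
  · rw [← dist_eq_norm]
    refine (hgf x (ε * c) fun y hy => (hu ((Metric.mem_ball.1 hy).trans_le
      (min_le_right _ _))).le).trans ?_
    refine mul_le_mul_of_nonneg_left ?_ hε.le
    have h3 : (1 + ‖x‖) ^ n ≤ (1 + (ρ + 1)) ^ n := pow_le_pow_left₀ (by positivity) (by linarith) n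
    exact inv_anti₀ (by positivity) h3
  · rw [not_le] at hx
    rw [hgout x hx, hout x (by linarith), sub_zero, norm_zero]
    exact mul_nonneg hε.le (decayWeight_pos n x).le

theorem norm_fourier_sub_le {f g : Space d → ℂ} (hf : Integrable f) (hg : Integrable g) {ε : ℝ}
    (h : ∀ x, ‖g x - f x‖ ≤ ε * decayWeight (d + 1) x) (k : Space d) :
    ‖𝓕 g k - 𝓕 f k‖ ≤ ε * ∫ x : Space d, decayWeight (d + 1) x := by
  have hint : ∀ {f : Space d → ℂ}, Integrable f → Integrable fun v => chi (-v) k * f v :=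
    fun {f} hf => hf.bdd_mul (continuous_chi_neg_uncurry.comp
      (Continuous.prodMk_left k)).aestronglyMeasurable (ae_of_all _ fun v => (norm_chi (-v) k).le)
  rw [fourier_eq_integral_chi, fourier_eq_integral_chi, ← integral_sub (hint hg) (hint hf),
    ← integral_const_mul]
  refine norm_integral_le_of_norm_le
    ((integrable_decayWeight (Nat.lt_succ_self d)).const_mul ε) (ae_of_all _ fun x => ?_)
  rw [← mul_sub, norm_mul, norm_chi, one_mul]
  exact h x

theorem memLp_countingFn_of_hasCompactSupport [Fact (0 < r)] [IsFiniteMeasure μ] (w : Fin m → ℝ)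
    {f : Space d → ℂ} (hf : Continuous f) (hs : HasCompactSupport f) :
    MemLp (countingFn w f) 2 μ :=
  let ⟨_, hA0, hA⟩ := exists_norm_le_decayWeight_of_hasCompactSupport hf hs (d + 1)
  memLp_countingFn w hf.measurable hA0 hA

/-- The embedding `θ` sends `f^` to `N_f` also if `f` is only continuous with compact support. -/
theorem IsCountingEmbedding.apply_fourier [Fact (0 < r)] [IsProbabilityMeasure μ] {w : Fin m → ℝ}
    {ω : Measure (Space d)} [ω.HasTemperateGrowth] {θ : Lp ℂ 2 ω →ₗᵢ[ℂ] Lp ℂ 2 μ}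
    (h : IsCountingEmbedding μ w ω θ) {f : Space d → ℂ} (hf : Continuous f)
    (hs : HasCompactSupport f) :
    ∃ hF : MemLp (𝓕 f) 2 ω,
      θ (hF.toLp _) = (memLp_countingFn_of_hasCompactSupport w hf hs).toLp _ := by
  have hε : ∀ n : ℕ, (0 : ℝ) < 1 / ((n : ℝ) + 1) := fun n => by positivity
  choose g hg using fun n => exists_schwartz_approx hf hs (d + 1) (hε n)
  obtain ⟨A, hA0, hA⟩ := exists_norm_le_decayWeight_of_hasCompactSupport hf hs (d + 1)
  set N : Lp ℂ 2 μ := (memLp_countingFn_of_hasCompactSupport w hf hs).toLp _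
  set K : ℝ := (∑ i, |w i|) * (1 * weightConst d (r / 2) (d + 1)).toReal
  have hlim0 : ∀ C : ℝ, Tendsto (fun n : ℕ => 1 / ((n : ℝ) + 1) * C) atTop (𝓝 0) := fun C => by
    simpa using tendsto_one_div_add_atTop_nhds_zero_nat.mul_const C
  have hcount : Tendsto (fun n => countingMap μ w (g n)) atTop (𝓝 N) := by
    rw [tendsto_iff_norm_sub_tendsto_zero]
    refine squeeze_zero (fun n => norm_nonneg _) (fun n => ?_) (hlim0 K)
    have hb : ∀ᵐ lam ∂μ, ‖(countingMap μ w (g n) - N : Lp ℂ 2 μ) lam‖ ≤ 1 / ((n : ℝ) + 1) * K := by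
      filter_upwards [Lp.coeFn_sub (countingMap μ w (g n)) N,
        (memLp_countingFn_schwartz w (g n) : MemLp _ 2 μ).coeFn_toLp,
        (memLp_countingFn_of_hasCompactSupport w hf hs : MemLp _ 2 μ).coeFn_toLp]
        with lam h1 h2 h3
      have h2' : countingMap μ w (g n) lam = countingFn w (g n) lam := h2
      have h4 : countingFn w (g n) lam = countingFn w (fun x => g n x - f x) lam +
          countingFn w f lam := by
        rw [← countingFn_add w (f := fun x => g n x - f x)
          (fun i => (integrable_colour_schwartz (g n) i lam).sub
            (integrable_colour hf.measurable hA i lam))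
          fun i => integrable_colour hf.measurable hA i lam]
        congr 1
        funext x
        simp
      rw [h1, Pi.sub_apply, h2', h3, h4, add_sub_cancel_right]
      exact norm_countingFn_le w (hε n).le (hg n) lam
    have hK : 0 ≤ 1 / ((n : ℝ) + 1) * K := by
      have : 0 ≤ K := mul_nonneg (Finset.sum_nonneg fun i _ => abs_nonneg _) ENNReal.toReal_nonneg
      have := hε n
      positivity
    refine (Lp.norm_le_of_ae_bound hK hb).trans (le_of_eq ?_)
    simp [measureUnivNNReal]
  have hθ : Tendsto (fun n => θ (fourierToLp ω (g n))) atTop (𝓝 N) := by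
    simp_rw [h.apply_fourierToLp]
    exact hcount
  -- An isometry reflects Cauchy sequences: convergence of `N_{g n}` forces convergence of the
  -- transforms in `L²(ω)`. Their limit is identified below by an almost everywhere convergent
  -- subsequence and the pointwise convergence of the transforms.
  have hcauchy : CauchySeq fun n => fourierToLp ω (g n) :=
    θ.isometry.isUniformInducing.cauchy_map_iff.1 (by
      rw [Filter.map_map]
      exact hθ.cauchySeq)
  obtain ⟨u, hu⟩ := cauchySeq_tendsto_of_complete hcauchy
  have hθu : θ u = N := tendsto_nhds_unique ((θ.continuous.tendsto u).comp hu) hθ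
  have hmeas := tendstoInMeasure_of_tendsto_Lp hu
  obtain ⟨ns, hns, hae⟩ := hmeas.exists_seq_tendsto_ae
  have hpt : ∀ k, Tendsto (fun n => 𝓕 (g n : Space d → ℂ) k) atTop (𝓝 (𝓕 f k)) := fun k => by
    rw [tendsto_iff_norm_sub_tendsto_zero]
    exact squeeze_zero (fun n => norm_nonneg _)
      (fun n => norm_fourier_sub_le (hf.integrable_of_hasCompactSupport hs) (g n).integrable
        (hg n) k) (hlim0 _)
  have heq : u =ᵐ[ω] 𝓕 f := by
    have hall : ∀ᵐ k ∂ω, ∀ n, fourierToLp ω (g n) k = 𝓕 (g n : Space d → ℂ) k :=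
      ae_all_iff.2 fun n => by
        filter_upwards [(𝓕 (g n) : 𝓢(Space d, ℂ)).coeFn_toLp 2 ω] with k hk
        rw [fourierToLp_apply, hk, SchwartzMap.fourier_coe]
    filter_upwards [hae, hall] with k h1 h2
    refine tendsto_nhds_unique h1 (((hpt k).comp hns.tendsto_atTop).congr fun n => ?_)
    exact (h2 _).symm
  refine ⟨(memLp_congr_ae heq).1 (Lp.memLp u), ?_⟩
  rw [← hθu]
  congr 1
  refine Lp.ext ?_
  filter_upwards [((memLp_congr_ae heq).1 (Lp.memLp u)).coeFn_toLp, heq] with k h1 h2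
  rw [h1, h2]

theorem continuous_fourier_of_hasCompactSupport {f : Space d → ℂ} (hf : Continuous f)
    (hs : HasCompactSupport f) : Continuous (𝓕 f) := by
  have hi := hf.integrable_of_hasCompactSupport (μ := volume) hs
  have h1 : 𝓕 f = fun w => ∫ v, chi (-v) w * f v := funext (fourier_eq_integral_chi f)
  rw [h1]
  refine continuous_of_dominated (bound := fun v => ‖f v‖) (fun w => ?_)
    (fun w => ae_of_all _ fun v => ?_) hi.norm (ae_of_all _ fun v => ?_)
  · exact ((continuous_chi_neg_uncurry.comp (Continuous.prodMk_left w)).mul hf).aestronglyMeasurable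
  · rw [norm_mul, norm_chi, one_mul]
  · exact (continuous_chi _).mul continuous_const

/-- The measure `|f^|² ω`. -/
def spectralDensity (ω : Measure (Space d)) (f : Space d → ℂ) : Measure (Space d) :=
  ω.withDensity fun k => ENNReal.ofReal (‖𝓕 f k‖ ^ 2)

theorem integral_spectralDensity (ω : Measure (Space d)) {f : Space d → ℂ} (hf : Continuous f)
    (hs : HasCompactSupport f) (φ : Space d → ℂ) :
    ∫ k, φ k ∂spectralDensity ω f = ∫ k, ((‖𝓕 f k‖ ^ 2 : ℝ) : ℂ) * φ k ∂ω :=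
  integral_withDensity_ofReal
    ((continuous_fourier_of_hasCompactSupport hf hs).norm.pow 2).measurable
    (fun _ => sq_nonneg _) φ

/-- Since `N_f = θ(f^)`, the matrix coefficient can be computed in `L²(ω)`, where it is the integral
of a character against `|f^|² ω`. -/
theorem IsCountingEmbedding.isSpectralMeasure [Fact (0 < r)] [IsProbabilityMeasure μ]
    [VAddInvariantMeasure (Space d) (Config d m r) μ] {w : Fin m → ℝ}
    {ω : Measure (Space d)} [ω.HasTemperateGrowth] [IsLocallyFiniteMeasure ω]
    {θ : Lp ℂ 2 ω →ₗᵢ[ℂ] Lp ℂ 2 μ}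
    (h : IsCountingEmbedding μ w ω θ) {f : Space d → ℂ} (hf : Continuous f)
    (hs : HasCompactSupport f) :
    IsSpectralMeasure (translationRep μ)
      ((memLp_countingFn_of_hasCompactSupport w hf hs).toLp _) (spectralDensity ω f) := by
  obtain ⟨hF, hθ⟩ := h.apply_fourier hf hs
  refine ⟨isFiniteMeasure_withDensity_ofReal
    ((memLp_two_iff_integrable_sq_norm hF.1).1 hF).hasFiniteIntegral, fun t => ?_⟩
  rw [← hθ, ← h.intertwines, LinearIsometry.inner_map_map, integral_spectralDensity ω hf hs,
    L2.inner_def]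
  refine integral_congr_ae ?_
  filter_upwards [coeFn_multiplicationRep ω t (hF.toLp _), hF.coeFn_toLp] with k h1 h2
  rw [h1, h2, RCLike.inner_apply, map_mul, chi_neg_left, Complex.conj_conj, chi_comm]
  have h3 := Complex.mul_conj' (𝓕 f k)
  push_cast
  linear_combination chi k t * h3

theorem IsSpectralMeasure.unique {H : Type*} [NormedAddCommGroup H] [InnerProductSpace ℂ H]
    {S : Space d → H → H} {u : H} {σ σ' : Measure (Space d)} (h : IsSpectralMeasure S u σ)
    (h' : IsSpectralMeasure S u σ') : σ' = σ := by
  have := h.1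
  have := h'.1
  exact Measure.ext_of_integral_chi fun t => (h'.2 t).symm.trans (h.2 t)

end CompactSupport

/-! ### Autocorrelations along the orbits -/

section AutocorrelationApprox

variable {d : ℕ}

/-- The average over a cube in the definition of the autocorrelation. -/
def autocorrelationApprox (g φ : Space d → ℂ) (R : ℝ) : ℂ :=
  ((volume (cube d R)).toReal : ℂ)⁻¹ *
    ∫ x in cube d R, ∫ y in cube d R, g x * conj (g y) * φ (x - y)

variable {g : Space d → ℂ} {C : ℝ}

theorem measurable_autocorrelation_integrand (hg : Measurable g) {φ : Space d → ℂ}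
    (hφ : Continuous φ) :
    Measurable fun p : Space d × Space d => g p.1 * conj (g p.2) * φ (p.1 - p.2) :=
  ((hg.comp measurable_fst).mul (Complex.continuous_conj.measurable.comp
    (hg.comp measurable_snd))).mul (hφ.comp (by fun_prop)).measurable

theorem norm_autocorrelation_integrand_le (hC : ∀ x, ‖g x‖ ≤ C) (φ : Space d → ℂ)
    (x y : Space d) : ‖g x * conj (g y) * φ (x - y)‖ ≤ C ^ 2 * ‖φ (x - y)‖ := by
  have hC0 : 0 ≤ C := (norm_nonneg _).trans (hC x)
  rw [norm_mul, norm_mul, RCLike.norm_conj, sq]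
  have := mul_le_mul (hC x) (hC y) (norm_nonneg _) hC0
  exact mul_le_mul_of_nonneg_right this (norm_nonneg _)

theorem integrable_autocorrelation_integrand (hg : Measurable g) (hC : ∀ x, ‖g x‖ ≤ C)
    {φ : Space d → ℂ} (hφ : Continuous φ) (hi : Integrable φ) (x : Space d) :
    Integrable fun y => g x * conj (g y) * φ (x - y) :=
  ((hi.comp_sub_left x).norm.const_mul (C ^ 2)).mono'
    ((measurable_autocorrelation_integrand hg hφ).comp measurable_prodMk_left).aestronglyMeasurable
    (ae_of_all _ (norm_autocorrelation_integrand_le hC φ x))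

theorem norm_autocorrelation_inner_le (hC : ∀ x, ‖g x‖ ≤ C) {φ : Space d → ℂ}
    (hi : Integrable φ) (x : Space d) (s : Set (Space d)) :
    ‖∫ y in s, g x * conj (g y) * φ (x - y)‖ ≤ C ^ 2 * ∫ z, ‖φ z‖ := by
  have h1 : Integrable fun y => C ^ 2 * ‖φ (x - y)‖ := (hi.comp_sub_left x).norm.const_mul _
  calc _ ≤ ∫ y in s, C ^ 2 * ‖φ (x - y)‖ := norm_integral_le_of_norm_le h1.integrableOn
        (ae_of_all _ (norm_autocorrelation_integrand_le hC φ x))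
    _ ≤ ∫ y, C ^ 2 * ‖φ (x - y)‖ :=
        setIntegral_le_integral h1 (ae_of_all _ fun y => mul_nonneg (sq_nonneg C) (norm_nonneg _))
    _ = _ := by
        rw [integral_const_mul, integral_sub_left_eq_self (fun z => ‖φ z‖) volume x]

theorem integrableOn_autocorrelation_inner (hg : Measurable g) (hC : ∀ x, ‖g x‖ ≤ C)
    {φ : Space d → ℂ} (hφ : Continuous φ) (hi : Integrable φ) (s : Set (Space d)) (R : ℝ) :
    IntegrableOn (fun x => ∫ y in s, g x * conj (g y) * φ (x - y)) (cube d R) :=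
  integrableOn_of_bounded
    (measurable_autocorrelation_integrand
      hg hφ).stronglyMeasurable.integral_prod_right'.measurable
    (fun x => norm_autocorrelation_inner_le hC hi x s) (volume_cube_lt_top R)

/-- The estimate is Lipschitz in the `L¹` norm of the test function, uniformly in `R`; it reduces
convergence to a countable dense set. -/
theorem norm_autocorrelationApprox_sub_le (hg : Measurable g) (hC : ∀ x, ‖g x‖ ≤ C)
    {φ ψ : Space d → ℂ} (hφ : Continuous φ) (hψ : Continuous ψ) (hφi : Integrable φ)
    (hψi : Integrable ψ) {R : ℝ} (hR : 0 < R) :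
    ‖autocorrelationApprox g φ R - autocorrelationApprox g ψ R‖ ≤
      C ^ 2 * ∫ z, ‖φ z - ψ z‖ := by
  have hsub : ∀ x, (∫ y in cube d R, g x * conj (g y) * φ (x - y)) -
      (∫ y in cube d R, g x * conj (g y) * ψ (x - y)) =
      ∫ y in cube d R, g x * conj (g y) * (φ - ψ) (x - y) := fun x => by
    rw [← integral_sub (integrable_autocorrelation_integrand hg hC hφ hφi x).integrableOn
      (integrable_autocorrelation_integrand hg hC hψ hψi x).integrableOn]
    simp only [Pi.sub_apply, mul_sub]
  rw [autocorrelationApprox, autocorrelationApprox, ← mul_sub,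
    ← integral_sub (integrableOn_autocorrelation_inner hg hC hφ hφi _ R)
      (integrableOn_autocorrelation_inner hg hC hψ hψi _ R)]
  simp_rw [hsub]
  rw [norm_mul, norm_inv, Complex.norm_real, Real.norm_of_nonneg ENNReal.toReal_nonneg]
  have h1 := norm_setIntegral_le_of_norm_le_const (μ := volume) (volume_cube_lt_top (d := d) R)
    fun x _ => norm_autocorrelation_inner_le hC (hφi.sub hψi) x (cube d R)
  have hpos : 0 < (volume (cube d R)).toReal := cubeVol_pos hR
  rw [inv_mul_le_iff₀ hpos, mul_comm]
  exact h1

/-- The autocorrelation may be computed with averages over a cube in one variable only. -/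
theorem tendsto_autocorrelationApprox (hg : Measurable g) (hC : ∀ x, ‖g x‖ ≤ C)
    {φ : Space d → ℂ} (hφ : Continuous φ) (hs : HasCompactSupport φ) {L : ℂ}
    (h : Tendsto (fun R => cubeAvg R fun x => ∫ y, g x * conj (g y) * φ (x - y)) atTop (𝓝 L)) :
    Tendsto (autocorrelationApprox g φ) atTop (𝓝 L) := by
  have hi : Integrable φ := hφ.integrable_of_hasCompactSupport hs
  obtain ⟨a, ha, hsub⟩ := hs.isCompact.isBounded.subset_closedBall_lt 0 (0 : Space d)
  have hout : ∀ z, a < ‖z‖ → φ z = 0 := fun z hz => by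
    by_contra h
    have := hsub (subset_tsupport _ h)
    rw [mem_closedBall_zero_iff] at this
    linarith
  have hfull : ∀ R, IntegrableOn (fun x => ∫ y, g x * conj (g y) * φ (x - y)) (cube d R) :=
    fun R => by
      have := integrableOn_autocorrelation_inner hg hC hφ hi Set.univ R
      simpa only [Measure.restrict_univ] using this
  -- The error of letting `y` range over the whole space. It vanishes unless `x` is within a
  -- distance of order `a` from the boundary of the cube, as `φ` is supported in the ball of radius
  -- `a`.
  let D : Space d → ℝ → ℂ := fun x R => (∫ y in cube d R, g x * conj (g y) * φ (x - y)) -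
    ∫ y, g x * conj (g y) * φ (x - y)
  have hD0 : ∀ R x, x ∈ cube d (R - 2 * a) → D x R = 0 := fun R x hx => by
    refine sub_eq_zero.2 (setIntegral_eq_integral_of_forall_compl_eq_zero fun y hy => ?_)
    rw [hout, mul_zero]
    by_contra hle
    rw [not_lt] at hle
    refine hy ?_
    have := add_mem_cube (x := x) (t := y - x) (R := R)
      (cube_mono (by rw [norm_sub_rev]; linarith) hx)
    rwa [add_sub_cancel] at this
  have hDb : ∀ R x, ‖D x R‖ ≤ 2 * (C ^ 2 * ∫ z, ‖φ z‖) := fun R x => by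
    have h1 := norm_autocorrelation_inner_le hC hi x (cube d R)
    have h2 := norm_autocorrelation_inner_le hC hi x Set.univ
    rw [Measure.restrict_univ] at h2
    exact (norm_sub_le _ _).trans (by linarith)
  have hbound : Tendsto (fun R : ℝ => ((volume (cube d R)).toReal : ℂ)⁻¹ * ∫ x in cube d R, D x R)
      atTop (𝓝 0) := by
    refine tendsto_inv_cubeVol_mul_of_boundary (K := 2 * (C ^ 2 * ∫ z, ‖φ z‖)) (a := 2 * a)
      (Eventually.of_forall fun R => ?_)
    have hset : ∫ x in cube d R, D x R = ∫ x in cube d R \ cube d (R - 2 * a), D x R := by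
      have hzero : ∀ x ∈ cube d R \ (cube d R \ cube d (R - 2 * a)), D x R = 0 := fun x hx =>
        hD0 R x (by_contra fun hn => hx.2 ⟨hx.1, hn⟩)
      exact (setIntegral_eq_of_subset_of_forall_sdiff_eq_zero (f := fun x => D x R)
        (measurableSet_cube R) Set.sdiff_subset hzero)
    rw [hset, ← measureReal_cube_diff (by linarith)]
    exact norm_setIntegral_le_of_norm_le_const
      ((measure_mono Set.sdiff_subset).trans_lt (volume_cube_lt_top R)) fun x _ => hDb R x
  have hDi : ∀ R, IntegrableOn (fun x => D x R) (cube d R) := fun R =>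
    (integrableOn_autocorrelation_inner hg hC hφ hi _ R).sub (hfull R)
  have hsum := h.add hbound
  rw [add_zero] at hsum
  refine hsum.congr fun R => ?_
  rw [cubeAvg, ← mul_add, ← integral_add (hfull R) (hDi R), autocorrelationApprox]
  simp only [D, add_sub_cancel]

end AutocorrelationApprox

/-! ### Almost sure convergence of autocorrelations along orbits -/

section OrbitAutocorrelation

theorem norm_orbit_product_le {d : ℕ} {X : Type*} [AddAction (Space d) X] {N : X → ℂ} {C : ℝ}
    (hC : ∀ lam, ‖N lam‖ ≤ C) (lam : X) (z : Space d) : ‖N lam * conj (N (z +ᵥ lam))‖ ≤ C ^ 2 := by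
  rw [norm_mul, RCLike.norm_conj, sq]
  exact mul_le_mul (hC _) (hC _) (norm_nonneg _) ((norm_nonneg _).trans (hC lam))

/-- The correlation function `z ↦ ∫ N(λ) conj (N(z + λ)) dμ`. -/
def orbitCorrelation {d : ℕ} {X : Type*} [MeasurableSpace X] [AddAction (Space d) X]
    (μ : Measure X) (N : X → ℂ) (z : Space d) : ℂ :=
  ∫ lam, N lam * conj (N (z +ᵥ lam)) ∂μ

theorem norm_orbitCorrelation_le {d : ℕ} {X : Type*} [MeasurableSpace X]
    [AddAction (Space d) X] {μ : Measure X} [IsProbabilityMeasure μ] {N : X → ℂ} {C : ℝ}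
    (hC : ∀ lam, ‖N lam‖ ≤ C) (z : Space d) : ‖orbitCorrelation μ N z‖ ≤ C ^ 2 := by
  simpa [orbitCorrelation] using norm_integral_le_of_norm_le_const (μ := μ)
    (ae_of_all _ fun lam => norm_orbit_product_le hC lam z)

variable {d : ℕ} {X : Type*} [MeasurableSpace X] [AddAction (Space d) X]
  [MeasurableVAdd₂ (Space d) X] {μ : Measure X}

theorem measurable_orbit_product {N : X → ℂ} (hN : Measurable N) :
    Measurable fun p : X × Space d => N p.1 * conj (N (p.2 +ᵥ p.1)) :=
  (hN.comp measurable_fst).mul (Complex.continuous_conj.measurable.comp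
    (hN.comp (measurable_snd.vadd measurable_fst)))

theorem measurable_orbitCorrelation [SFinite μ] {N : X → ℂ} (hN : Measurable N) :
    Measurable (orbitCorrelation μ N : Space d → ℂ) :=
  ((measurable_orbit_product hN).comp
    measurable_swap).stronglyMeasurable.integral_prod_right'.measurable

/-- Substituting `y = x - z`, the one-sided average is the cube average of `H` along the orbit. The
ergodic theorem gives the limit `∫ H dμ`, and Fubini rewrites it with the orbit correlation. -/
theorem ae_tendsto_autocorrelationApprox [IsProbabilityMeasure μ] [ErgodicVAdd (Space d) X μ]
    {N : X → ℂ} (hN : Measurable N) {C : ℝ} (hC : ∀ lam, ‖N lam‖ ≤ C) {φ : Space d → ℂ}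
    (hφ : Continuous φ) (hs : HasCompactSupport φ) :
    ∀ᵐ lam ∂μ, Tendsto (autocorrelationApprox (fun x : Space d => N (-x +ᵥ lam)) φ) atTop
      (𝓝 (∫ z, orbitCorrelation μ N z * φ z)) := by
  have hi : Integrable φ := hφ.integrable_of_hasCompactSupport hs
  have hm : Measurable fun p : X × Space d => N p.1 * conj (N (p.2 +ᵥ p.1)) * φ p.2 :=
    (measurable_orbit_product hN).mul (hφ.measurable.comp measurable_snd)
  have hle : ∀ lam (z : Space d), ‖N lam * conj (N (z +ᵥ lam)) * φ z‖ ≤ C ^ 2 * ‖φ z‖ :=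
    fun lam z => by
      rw [norm_mul]
      exact mul_le_mul_of_nonneg_right (norm_orbit_product_le hC lam z) (norm_nonneg _)
  let H : X → ℂ := fun lam => ∫ z, N lam * conj (N (z +ᵥ lam)) * φ z
  have hH : Measurable H := hm.stronglyMeasurable.integral_prod_right'.measurable
  have hHb : ∀ lam, ‖H lam‖ ≤ ∫ z, C ^ 2 * ‖φ z‖ := fun lam =>
    norm_integral_le_of_norm_le (hi.norm.const_mul _) (ae_of_all _ (hle lam))
  have hint : ∫ lam, H lam ∂μ = ∫ z, orbitCorrelation μ N z * φ z := by
    simp only [H, orbitCorrelation]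
    rw [integral_integral_swap]
    · simp_rw [integral_mul_const]
    · exact ((hi.norm.const_mul (C ^ 2)).comp_snd μ).mono' hm.aestronglyMeasurable
        (ae_of_all _ fun p => hle p.1 p.2)
  filter_upwards [ae_tendsto_cubeAvg (d := d) (μ := μ) hH hHb] with lam hlam
  rw [hint] at hlam
  refine tendsto_autocorrelationApprox (measurable_orbit hN lam) (fun x => hC _) hφ hs
    (hlam.congr fun R => ?_)
  congr 1
  funext x
  simp only [H]
  rw [← integral_sub_left_eq_self _ volume x]
  refine integral_congr_ae (ae_of_all _ fun y => ?_)
  beta_reduce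
  rw [vadd_vadd]
  congr 4
  congr 1
  abel

/-- A countable set of continuous functions with compact support that is dense for the
`L¹`-norm. -/
theorem exists_countable_dense_compactlySupported (d : ℕ) :
    ∃ S : Set C_c(Space d, ℂ), S.Countable ∧ ∀ (φ : C_c(Space d, ℂ)) (ε : ℝ), 0 < ε →
      ∃ ψ ∈ S, ∫ z, ‖φ z - ψ z‖ < ε := by
  have hmem : ∀ φ : C_c(Space d, ℂ), MemLp φ 1 (volume : Measure (Space d)) := fun φ =>
    memLp_one_iff_integrable.2 (φ.continuous.integrable_of_hasCompactSupport φ.hasCompactSupport)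
  let E : C_c(Space d, ℂ) → Lp ℂ 1 (volume : Measure (Space d)) := fun φ => (hmem φ).toLp _
  have hone : Fact ((1 : ENNReal) ≠ ⊤) := ⟨ENNReal.one_ne_top⟩
  obtain ⟨t, hts, htc, hdense⟩ :=
    (TopologicalSpace.IsSeparable.of_separableSpace (Set.range E)).exists_countable_dense_subset
  have hts' : ∀ v ∈ t, ∃ φ, E φ = v := fun v hv => hts hv
  choose! F hF using hts'
  refine ⟨F '' t, htc.image F, fun φ ε hε => ?_⟩
  obtain ⟨v, hv, hdist⟩ := Metric.mem_closure_iff.1 (hdense (Set.mem_range_self φ)) ε hε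
  refine ⟨F v, Set.mem_image_of_mem F hv, ?_⟩
  rw [← hF v hv, Lp.dist_edist, Lp.edist_toLp_toLp, eLpNorm_one_eq_lintegral_enorm] at hdist
  rw [integral_norm_eq_lintegral_enorm]
  · exact hdist
  · exact (φ.continuous.sub (F v).continuous).aestronglyMeasurable

/-- The exceptional null set must not depend on `φ`: almost sure convergence is used on a countable
`L¹`-dense set, and the Lipschitz bounds for the averages and for the limit carry it to every `φ` by
an `ε / 3` argument. -/
theorem ae_forall_tendsto_autocorrelationApprox [IsProbabilityMeasure μ]
    [ErgodicVAdd (Space d) X μ] {N : X → ℂ} (hN : Measurable N) {C : ℝ}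
    (hC : ∀ lam, ‖N lam‖ ≤ C) :
    ∀ᵐ lam ∂μ, ∀ φ : C_c(Space d, ℂ),
      Tendsto (autocorrelationApprox (fun x : Space d => N (-x +ᵥ lam)) φ) atTop
        (𝓝 (∫ z, orbitCorrelation μ N z * φ z)) := by
  obtain ⟨S, hS, hdense⟩ := exists_countable_dense_compactlySupported d
  have hall : ∀ᵐ lam ∂μ, ∀ φ ∈ S,
      Tendsto (autocorrelationApprox (fun x : Space d => N (-x +ᵥ lam)) φ) atTop
        (𝓝 (∫ z, orbitCorrelation μ N z * φ z)) :=
    (ae_ball_iff hS).2 fun φ _ =>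
      ae_tendsto_autocorrelationApprox hN hC φ.continuous φ.hasCompactSupport
  have hi : ∀ φ : C_c(Space d, ℂ), Integrable φ := fun φ =>
    φ.continuous.integrable_of_hasCompactSupport φ.hasCompactSupport
  have hhi : ∀ φ : C_c(Space d, ℂ), Integrable fun z => orbitCorrelation μ N z * φ z := fun φ =>
    (hi φ).bdd_mul (measurable_orbitCorrelation hN).aestronglyMeasurable
      (ae_of_all _ (norm_orbitCorrelation_le hC))
  filter_upwards [hall] with lam hlam φ
  rw [Metric.tendsto_atTop]
  intro ε hε
  have hK : 0 < C ^ 2 + 1 := by positivity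
  obtain ⟨ψ, hψ, hlt⟩ := hdense φ (ε / (3 * (C ^ 2 + 1))) (by positivity)
  have hsmall : C ^ 2 * ∫ z, ‖φ z - ψ z‖ < ε / 3 := by
    have h0 : 0 ≤ ∫ z, ‖φ z - ψ z‖ := integral_nonneg fun z => norm_nonneg _
    calc C ^ 2 * ∫ z, ‖φ z - ψ z‖ ≤ (C ^ 2 + 1) * ∫ z, ‖φ z - ψ z‖ := by nlinarith
      _ < (C ^ 2 + 1) * (ε / (3 * (C ^ 2 + 1))) := by gcongr
      _ = ε / 3 := by field_simp
  obtain ⟨R₀, hR₀⟩ := Metric.tendsto_atTop.1 (hlam ψ hψ) (ε / 3) (by positivity)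
  refine ⟨max R₀ 1, fun R hR => ?_⟩
  have h1 := norm_autocorrelationApprox_sub_le (measurable_orbit hN lam) (fun x => hC _)
    φ.continuous ψ.continuous (hi φ) (hi ψ)
    (lt_of_lt_of_le one_pos ((le_max_right _ _).trans hR))
  have h2 := hR₀ R ((le_max_left _ _).trans hR)
  have h3 : ‖(∫ z, orbitCorrelation μ N z * ψ z) - ∫ z, orbitCorrelation μ N z * φ z‖ ≤
      C ^ 2 * ∫ z, ‖φ z - ψ z‖ := by
    rw [← integral_sub (hhi ψ) (hhi φ), ← integral_const_mul]
    refine norm_integral_le_of_norm_le (((hi φ).sub (hi ψ)).norm.const_mul _)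
      (ae_of_all _ fun z => ?_)
    rw [← mul_sub, norm_mul, norm_sub_rev]
    exact mul_le_mul_of_nonneg_right (norm_orbitCorrelation_le hC z) (norm_nonneg _)
  rw [← dist_eq_norm] at h1 h3
  calc _ ≤ _ := dist_triangle4 _ _ _ _
    _ < ε / 3 + ε / 3 + ε / 3 := by
        refine add_lt_add_of_lt_of_le (add_lt_add_of_le_of_lt (h1.trans hsmall.le) h2)
          (h3.trans hsmall.le)
    _ = ε := by ring

end OrbitAutocorrelation

/-! ### Diffraction of autocorrelations with bounded density -/

section Diffraction

variable {d : ℕ}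

/-- The complex Radon measure with a given bounded density. -/
def ComplexRadon.ofDensity (h : Space d → ℂ) (hm : Measurable h) {B : ℝ} (hB : ∀ z, ‖h z‖ ≤ B) :
    ComplexRadon d where
  variation := volume.withDensity fun z => ENNReal.ofReal ‖h z‖
  locallyFinite := by
    have : IsFiniteMeasureOnCompacts (volume.withDensity fun z => ENNReal.ofReal ‖h z‖) := by
      refine ⟨fun K hK => ?_⟩
      rw [withDensity_apply _ hK.measurableSet]
      calc _ ≤ ∫⁻ _ in K, ENNReal.ofReal B :=
            lintegral_mono fun z => ENNReal.ofReal_le_ofReal (hB z)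
        _ < ⊤ := by
            rw [setLIntegral_const]
            exact ENNReal.mul_lt_top ENNReal.ofReal_lt_top hK.measure_lt_top
    infer_instance
  -- The phase must have modulus `1` everywhere; its value where `h` vanishes is irrelevant to the
  -- integral.
  phase z := if h z = 0 then 1 else h z / ‖h z‖
  measurable_phase := Measurable.ite (hm (measurableSet_singleton 0)) measurable_const
    (hm.div (Complex.continuous_ofReal.measurable.comp hm.norm))
  norm_phase z := by
    split_ifs with h0
    · exact norm_one
    · rw [norm_div, Complex.norm_real, norm_norm, div_self (norm_ne_zero_iff.2 h0)]

theorem ComplexRadon.integral_ofDensity {h : Space d → ℂ} (hm : Measurable h) {B : ℝ}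
    (hB : ∀ z, ‖h z‖ ≤ B) (φ : Space d → ℂ) :
    (ComplexRadon.ofDensity h hm hB).integral φ = ∫ z, h z * φ z := by
  refine (integral_withDensity_ofReal hm.norm (fun _ => norm_nonneg _) _).trans ?_
  refine integral_congr_ae (ae_of_all _ fun z => ?_)
  simp only [ComplexRadon.ofDensity]
  split_ifs with h0
  · rw [h0, norm_zero, Complex.ofReal_zero, zero_mul, zero_mul]
  · have : (‖h z‖ : ℂ) ≠ 0 := by exact_mod_cast norm_ne_zero_iff.2 h0
    field_simp

theorem ComplexRadon.integrable_ofDensity {h : Space d → ℂ} (hm : Measurable h) {B : ℝ}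
    (hB : ∀ z, ‖h z‖ ≤ B) {φ : Space d → ℂ} (hφ : Integrable φ) :
    Integrable φ (ComplexRadon.ofDensity h hm hB).variation := by
  refine (integrable_withDensity_ofReal_iff hm.norm (fun _ => norm_nonneg _) φ).2 ?_
  refine hφ.bdd_mul (c := B)
    (Complex.continuous_ofReal.measurable.comp hm.norm).aestronglyMeasurable
    (ae_of_all _ fun z => ?_)
  simpa using hB z

/-- Vague limits fix the autocorrelation only on compactly supported functions, while its Fourier
transform is tested on Schwartz functions. Smooth cutoffs and dominated convergence bridge the gap.
-/
theorem ComplexRadon.integral_eq_of_forall_compactlySupported {γ γ' : ComplexRadon d}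
    (h : ∀ φ : C_c(Space d, ℂ), γ.integral φ = γ'.integral φ) {ψ : Space d → ℂ}
    (hψ : Continuous ψ) (hi : Integrable ψ γ.variation) (hi' : Integrable ψ γ'.variation) :
    γ.integral ψ = γ'.integral ψ := by
  let b : ℕ → ContDiffBump (0 : Space d) := fun n =>
    ⟨(n : ℝ) + 1, (n : ℝ) + 2, by positivity, by linarith⟩
  have hb1 : ∀ x : Space d, ∀ᶠ n in atTop, b n x = 1 := fun x => by
    obtain ⟨n, hn⟩ := exists_nat_ge ‖x‖
    filter_upwards [eventually_ge_atTop n] with k hk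
    refine (b k).one_of_mem_closedBall ?_
    rw [mem_closedBall_zero_iff]
    have : (n : ℝ) ≤ k := by exact_mod_cast hk
    change ‖x‖ ≤ (k : ℝ) + 1
    linarith
  have hbc : ∀ n, Continuous fun x => (b n x : ℂ) * ψ x := fun n =>
    (Complex.continuous_ofReal.comp (b n).continuous).mul hψ
  have hbs : ∀ n, HasCompactSupport fun x => (b n x : ℂ) * ψ x := fun n =>
    ((b n).hasCompactSupport.comp_left (g := Complex.ofReal) Complex.ofReal_zero).mul_right
  have hlim : ∀ γ : ComplexRadon d, Integrable ψ γ.variation →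
      Tendsto (fun n => γ.integral fun x => (b n x : ℂ) * ψ x) atTop (𝓝 (γ.integral ψ)) := by
    intro γ hi
    refine tendsto_integral_of_dominated_convergence (fun x => ‖ψ x‖)
      (fun n => (γ.measurable_phase.mul (hbc n).measurable).aestronglyMeasurable) hi.norm
      (fun n => ae_of_all _ fun x => ?_) (ae_of_all _ fun x => ?_)
    · rw [norm_mul, norm_mul, γ.norm_phase, one_mul, Complex.norm_real,
        Real.norm_of_nonneg (b n).nonneg]
      exact mul_le_of_le_one_left (norm_nonneg _) (b n).le_one
    · refine tendsto_const_nhds.congr' ?_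
      filter_upwards [hb1 x] with n hn
      rw [hn, Complex.ofReal_one, one_mul]
  refine tendsto_nhds_unique (hlim γ hi) ((hlim γ' hi').congr fun n => ?_)
  exact (h ⟨⟨_, hbc n⟩, hbs n⟩).symm

/-- If the autocorrelation has a bounded density that is the inverse Fourier transform of the
finite measure `σ`, then the diffraction is `σ`. -/
theorem isDiffraction_iff_of_density {g h : Space d → ℂ} (hg : LocallyIntegrable g volume)
    (hm : Measurable h) {B : ℝ} (hB : ∀ z, ‖h z‖ ≤ B)
    (hlim : ∀ φ : C_c(Space d, ℂ), Tendsto (autocorrelationApprox g φ) atTop (𝓝 (∫ z, h z * φ z)))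
    {σ : Measure (Space d)} [IsFiniteMeasure σ] (hσ : ∀ z, h z = ∫ x, chi x z ∂σ)
    (σ' : Measure (Space d)) : IsDiffraction g σ' ↔ σ' = σ := by
  set γ := ComplexRadon.ofDensity h hm hB
  have hauto : IsAutocorrelation g γ := ⟨hg, fun φ => by
    rw [ComplexRadon.integral_ofDensity]
    exact hlim φ⟩
  have hint : ∀ φ : 𝓢(Space d, ℂ), Integrable (𝓕 φ : 𝓢(Space d, ℂ)) γ.variation := fun φ =>
    ComplexRadon.integrable_ofDensity hm hB (𝓕 φ : 𝓢(Space d, ℂ)).integrable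
  have hF : IsFourierTransform γ.integral σ := by
    intro φ
    refine ⟨φ.integrable (μ := σ), ?_⟩
    rw [ComplexRadon.integral_ofDensity]
    simp_rw [hσ, ← integral_mul_const]
    rw [integral_integral_swap]
    -- After Fubini the inner integral is the inverse Fourier transform of `𝓕 φ`, that is `φ`.
    · refine integral_congr_ae (ae_of_all _ fun x => ?_)
      have h1 := fourierInv_eq_integral_chi (𝓕 φ : 𝓢(Space d, ℂ)) x
      rw [← SchwartzMap.fourierInv_coe, FourierTransform.fourierInv_fourier_eq] at h1
      rw [h1]
      simp_rw [chi_comm x]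
    · have hm : Continuous fun p : Space d × Space d => chi p.2 p.1 * (𝓕 φ : 𝓢(Space d, ℂ)) p.1 :=
        (continuous_chi_uncurry.comp continuous_swap).mul
          ((𝓕 φ : 𝓢(Space d, ℂ)).continuous.comp continuous_fst)
      refine ((𝓕 φ : 𝓢(Space d, ℂ)).integrable.norm.comp_fst σ).mono' hm.aestronglyMeasurable
        (ae_of_all _ fun p => ?_)
      change ‖chi p.2 p.1 * (𝓕 φ : 𝓢(Space d, ℂ)) p.1‖ ≤ _
      rw [norm_mul, norm_chi, one_mul]
  constructor
  · rintro ⟨γ', hγ', hint', hlf, hF'⟩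
    refine Measure.ext_of_integral_schwartz fun φ _ => ?_
    rw [(hF' φ).2, (hF φ).2]
    refine ComplexRadon.integral_eq_of_forall_compactlySupported (fun ψ => ?_)
      (𝓕 φ : 𝓢(Space d, ℂ)).continuous (hint' φ) (hint φ)
    exact tendsto_nhds_unique (hγ'.2 ψ) (hauto.2 ψ)
  · rintro rfl
    exact ⟨γ, hauto, hint, inferInstance, hF⟩

end Diffraction

/-! ### Diffraction and the point spectrum -/

section Dworkin

variable {d m : ℕ} {r : ℝ} {μ : Measure (Config d m r)}

/-- This exhibits `f * λ` as a function on the orbit of `λ`, to which the ergodic theorem applies.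
The reflection of `f` comes from the convolution. -/
theorem weightedConv_eq_countingFn (w : Fin m → ℝ) (f : Space d → ℂ) (lam : Config d m r)
    (x : Space d) :
    weightedConv w f lam x = countingFn w (fun y => f (-y)) (-x +ᵥ lam) := by
  rw [countingFn_vadd]
  simp only [weightedConv, countingFn, neg_add_rev, neg_neg, sub_eq_neg_add]

theorem fourier_comp_neg (f : Space d → ℂ) (k : Space d) :
    𝓕 (fun x => f (-x)) k = 𝓕 f (-k) := by
  rw [fourier_eq_integral_chi, fourier_eq_integral_chi, ← integral_neg_eq_self]
  refine integral_congr_ae (ae_of_all _ fun x => ?_)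
  beta_reduce
  rw [neg_neg, chi_neg_left x (-k), chi_neg_right, Complex.conj_conj]

theorem orbitCorrelation_eq_inner [VAddInvariantMeasure (Space d) (Config d m r) μ]
    {N : Config d m r → ℂ} (hN : MemLp N 2 μ) (z : Space d) :
    orbitCorrelation μ N z = inner ℂ (translationRep μ (-z) (hN.toLp N)) (hN.toLp N) := by
  rw [L2.inner_def]
  have hq := (measurePreserving_vadd z μ).quasiMeasurePreserving.ae_eq_comp hN.coeFn_toLp
  refine integral_congr_ae ?_
  filter_upwards [coeFn_translationRep (-z) (hN.toLp N), hN.coeFn_toLp, hq] with lam h1 h2 h3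
  rw [RCLike.inner_apply, h1, h2, neg_neg]
  rw [Function.comp_apply, Function.comp_apply] at h3
  rw [h3]

/-- The orbit correlation is a matrix coefficient at `-z`, for the reflected function. Reflecting
the integration variable, which leaves `ω` unchanged, cancels both signs. -/
theorem orbitCorrelation_countingFn_comp_neg [Fact (0 < r)] [IsProbabilityMeasure μ]
    [VAddInvariantMeasure (Space d) (Config d m r) μ] {w : Fin m → ℝ} {ω : Measure (Space d)}
    [ω.HasTemperateGrowth] [IsLocallyFiniteMeasure ω] {θ : Lp ℂ 2 ω →ₗᵢ[ℂ] Lp ℂ 2 μ}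
    (hθ : IsCountingEmbedding μ w ω θ) (hω : ω.map (fun x => -x) = ω) {f : Space d → ℂ}
    (hf : Continuous f) (hs : HasCompactSupport f) (z : Space d) :
    orbitCorrelation μ (countingFn w fun x => f (-x)) z = ∫ x, chi x z ∂spectralDensity ω f := by
  have hf' : Continuous fun x => f (-x) := hf.comp continuous_neg
  have hs' : HasCompactSupport fun x => f (-x) := hs.comp_homeomorph (Homeomorph.neg (Space d))
  rw [orbitCorrelation_eq_inner (memLp_countingFn_of_hasCompactSupport w hf' hs'),
    (hθ.isSpectralMeasure hf' hs').2, integral_spectralDensity ω hf' hs',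
    integral_spectralDensity ω hf hs, ← hω, integral_map_neg, hω]
  refine integral_congr_ae (ae_of_all _ fun x => ?_)
  beta_reduce
  rw [fourier_comp_neg, neg_neg, chi_neg_left, chi_neg_right, Complex.conj_conj]

theorem IsCountingEmbedding.ae_isDiffraction_iff [Fact (0 < r)] [IsProbabilityMeasure μ]
    [ErgodicVAdd (Space d) (Config d m r) μ] {w : Fin m → ℝ} {ω : Measure (Space d)}
    [ω.HasTemperateGrowth] [IsLocallyFiniteMeasure ω] {θ : Lp ℂ 2 ω →ₗᵢ[ℂ] Lp ℂ 2 μ}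
    (hθ : IsCountingEmbedding μ w ω θ) (hω : ω.map (fun x => -x) = ω) {f : Space d → ℂ}
    (hf : Continuous f) (hs : HasCompactSupport f) :
    ∀ᵐ lam ∂μ, ∀ σ' : Measure (Space d),
      IsDiffraction (weightedConv w f lam) σ' ↔ σ' = spectralDensity ω f := by
  have hf' : Continuous fun x => f (-x) := hf.comp continuous_neg
  have hs' : HasCompactSupport fun x => f (-x) := hs.comp_homeomorph (Homeomorph.neg (Space d))
  have hN : Measurable (countingFn w (fun x => f (-x)) : Config d m r → ℂ) :=
    measurable_countingFn w hf'.measurable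
  obtain ⟨A, hA0, hA⟩ := exists_norm_le_decayWeight_of_hasCompactSupport hf' hs' (d + 1)
  have hC : ∀ lam : Config d m r, ‖countingFn w (fun x => f (-x)) lam‖ ≤ _ :=
    norm_countingFn_le w hA0 hA
  have hfin := (hθ.isSpectralMeasure hf hs).1
  filter_upwards [ae_forall_tendsto_autocorrelationApprox (d := d) hN hC] with lam hlam
  have heq : weightedConv w f lam = fun x : Space d => countingFn w (fun y => f (-y)) (-x +ᵥ lam) :=
    funext (weightedConv_eq_countingFn w f lam)
  rw [heq]
  refine isDiffraction_iff_of_density ?_ (measurable_orbitCorrelation hN)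
    (norm_orbitCorrelation_le hC) hlam (orbitCorrelation_countingFn_comp_neg hθ hω hf hs)
  exact (locallyIntegrable_const (_ : ℝ)).mono (measurable_orbit hN lam).aestronglyMeasurable
    (ae_of_all _ fun x => (hC _).trans (le_abs_self _))

end Dworkin

/-! ### Point masses of the Palm transform and translation eigenfunctions -/

section PointSpectrumEmbedding

variable {d m : ℕ} {r : ℝ} {μ : Measure (Config d m r)}

theorem measure_singleton_neg {ω : Measure (Space d)} (hω : ω.map (fun x => -x) = ω)
    (k : Space d) : ω {-k} = ω {k} := by
  conv_rhs => rw [← hω]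
  rw [Measure.map_apply measurable_neg (measurableSet_singleton k)]
  congr 1
  ext x
  simp

theorem isEigenfunction_map_pointIndicator_iff
    [VAddInvariantMeasure (Space d) (Config d m r) μ] {ω : Measure (Space d)}
    [IsLocallyFiniteMeasure ω] {θ : Lp ℂ 2 ω →ₗᵢ[ℂ] Lp ℂ 2 μ}
    (hθ : ∀ (t : Space d) (f : Lp ℂ 2 ω),
      θ (multiplicationRep ω t f) = translationRep μ t (θ f)) (k : Space d) :
    IsEigenfunction (translationRep μ) k (θ (pointIndicator ω (-k))) ↔ ω {-k} ≠ 0 := by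
  rw [IsEigenfunction, ← pointIndicator_ne_zero_iff, Ne, map_eq_zero_iff θ θ.injective]
  refine and_iff_left fun t => ?_
  rw [← hθ, multiplicationRep_pointIndicator, map_smul]

end PointSpectrumEmbedding

end

theorem corollary1 {d m : ℕ} {r : ℝ} (hr : 0 < r)
    (μ : Measure (Config d m r)) [IsProbabilityMeasure μ]
    [ErgodicVAdd (Space d) (Config d m r) μ]
    (hI : ∀ i, 0 < intensity μ i) (w : Fin m → ℝ) :
    -- the diffraction of `f * lam` is almost surely the spectral measure of `N^w_f`
    (∀ f : C_c(Space d, ℂ), ∃ (hf : MemLp (countingFn w f) 2 μ) (σ : Measure (Space d)),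
      (∀ σ' : Measure (Space d),
        IsSpectralMeasure (translationRep μ) (hf.toLp _) σ' ↔ σ' = σ) ∧
      ∀ᵐ lam ∂μ, ∀ σ' : Measure (Space d),
        IsDiffraction (weightedConv w f lam) σ' ↔ σ' = σ) ∧
    -- the Fourier transform `ω` of the weighted first moment of the Palm measure
    ∃ (ω : Measure (Space d)) (_ : IsLocallyFiniteMeasure ω),
      IsFourierTransform (palmMoment μ w) ω ∧
      (∀ ω' : Measure (Space d), IsLocallyFiniteMeasure ω' →
        IsFourierTransform (palmMoment μ w) ω' → ω' = ω) ∧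
      -- the embedding `θ^w`
      ∃ θ : Lp ℂ 2 ω →ₗᵢ[ℂ] Lp ℂ 2 μ,
        IsCountingEmbedding μ w ω θ ∧
        (∀ θ' : Lp ℂ 2 ω →ₗᵢ[ℂ] Lp ℂ 2 μ, IsCountingEmbedding μ w ω θ' → θ' = θ) ∧
        (∀ (t : Space d) (f : Lp ℂ 2 ω),
          θ (multiplicationRep ω t f) = translationRep μ t (θ f)) ∧
        -- the spectral measures on the two sides coincide
        (∀ f g : Lp ℂ 2 ω, ∃ ρ : ComplexMeasure (Space d),
          (∀ ρ' : ComplexMeasure (Space d),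
            IsCrossSpectralMeasure (multiplicationRep ω) f g ρ' ↔ ρ' = ρ) ∧
          (∀ ρ' : ComplexMeasure (Space d),
            IsCrossSpectralMeasure (translationRep μ) (θ f) (θ g) ρ' ↔ ρ' = ρ)) ∧
        -- the point spectrum
        ∀ k : Space d,
          ((∃ f, IsEigenfunction (multiplicationRep ω) k f) ↔ ω {k} ≠ 0) ∧
          (IsEigenfunction (translationRep μ) k (θ (pointIndicator ω (-k))) ↔ ω {k} ≠ 0) ∧
          (ω {k} ≠ 0 →
            (∀ f, IsEigenfunction (multiplicationRep ω) k f ↔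
              ∃ c : ℂ, c ≠ 0 ∧ f = c • pointIndicator ω (-k)) ∧
            (∀ F, IsEigenfunction (translationRep μ) k F ↔
              ∃ c : ℂ, c ≠ 0 ∧ F = c • θ (pointIndicator ω (-k))) ∧
            ‖θ (pointIndicator ω (-k))‖ = √((ω {k}).toReal)) := by

  have : Fact (0 < r) := ⟨hr⟩
  obtain ⟨ω, hint, hω⟩ := exists_fourierTransform_palmMoment (μ := μ) w
  have := isLocallyFinite_of_integrable_decayWeight hint
  have := hasTemperateGrowth_of_integrable_decayWeight hint
  have hsymm := hω.map_neg (palmMoment_conj w)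
  obtain ⟨θ, hθ⟩ := exists_isCountingEmbedding hω
  refine ⟨fun f => ?_, ω, inferInstance, hω, fun ω' _ h => h.unique hω, θ, hθ,
    fun θ' h => hθ.unique h, hθ.intertwines, exists_crossSpectralMeasure hθ.intertwines,
    fun k => ?_⟩
  · have hσ := hθ.isSpectralMeasure f.continuous f.hasCompactSupport
    refine ⟨_, _, fun σ' => ⟨hσ.unique, ?_⟩,
      hθ.ae_isDiffraction_iff hsymm f.continuous f.hasCompactSupport⟩
    rintro rfl
    exact hσ
  · have hT := isEigenfunction_map_pointIndicator_iff hθ.intertwines k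
    -- The eigenfunctions live at `-k` while the criterion weighs `{k}`; symmetry of `ω` identifies
    -- the two masses.
    have hk := measure_singleton_neg hsymm k
    refine ⟨?_, hk ▸ hT, fun h0 => ⟨fun f => ?_, ?_, ?_⟩⟩
    · simp only [isEigenfunction_multiplicationRep_iff, hk]
      exact ⟨fun ⟨_, h, _⟩ => h, fun h => ⟨_, h, 1, one_ne_zero, rfl⟩⟩
    · rw [isEigenfunction_multiplicationRep_iff, hk]
      exact and_iff_right h0
    · exact isEigenfunction_translationRep_iff (hT.2 (hk ▸ h0))
    · rw [θ.norm_map, norm_pointIndicator, hk]
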